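/- **Setting.** Let $D\ge 1$, $L\ge 1$, and let $\Lambda=(\mathbb Z/L)^D$ be the $D$-dimensional torus, with one qubit on each link $(\mathbf r,a)=\langle \mathbf r,\mathbf r+\hat{\mathbf a}\rangle$, $a=1,\dots,D$. The code has a $Z$-type stabilizer at each vertex (the product of $Z$ over the incident links) and an $X$-type stabilizer at each plaquette (none for $D=1$, the repetition code; the toric code for $D=2$). The reference logical state $\rho_{\sf log}$ is the $+1$ eigenstate of all stabilizers and of all logical $Z$ operators. An $X$-error pattern is a chain $c\in\mathbb F_2^{\text{links}}$; there is an *anyon* at $\mathbf r$ if an odd number of errors meet $\mathbf r$, and $X^c$ fixes $\rho_{\sf log}$ iff $c$ is a sum of plaquettes. *Noise.* A noise model $\mathcal E$ is a probability distribution on sets $\mathsf N$ of links ($X$ is applied on the links of $\mathsf N$). It is *$p$-bounded* if $\mathsf P(A\subseteq \mathsf N)\le p^{|A|}$ for every set $A$ of links. *Decoder of speed $v$.* Each site carries message variables $m^{\pm a}_{\mathbf r}\in\{0,\dots,L\}$, $a=1,\dots,D$, all initially $0$ ($0$ = no message). In one *message update*, for each $\mathbf r$, $s=\pm1$, $a$,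 let $C$ be the set of sites $\mathbf r-s\hat{\mathbf a}+\mathbf e$ with $e^a=0$ and $e^b\in\{-1,0,1\}$ for $b\neq a$; the new $m^{sa}_{\mathbf r}$ is $1$ if $C$ contains an anyon, $0$ if $C$ contains neither an anyon nor a nonzero message $m^{sa}$, and otherwise one plus the smallest nonzero value of $m^{sa}$ on $C$, a message that would exceed $L$ being deleted. One *time step* consists of $v$ message updates followed by a feedback: each anyon considers its smallest nonzero message $m^{sa}_{\mathbf r}$ (ties broken by the smallest $s\cdot a$) and moves one site along the axis $a$ so selected: if only one of $m^{+a}_{\mathbf r},m^{-a}_{\mathbf r}$ is nonzero, towards the origin of that message (i.e. along $-\hat{\mathbf a}$ for $m^{+a}$, along $+\hat{\mathbf a}$ for $m^{-a}$); if both are nonzero, towards the origin of the smaller one; it does not move if the two are equal or if it has received no message. All moves are simultaneous; $X$ is applied once to each link along which at least one anyon moves. *Diagnostics.* $p_{\sf log}^{(\mathcal E)}$ is the probability that the long-time state of the decoder run on $\mathsf N\sim\mathcal E$ is not $\rho_{\sf log}$. $T_{\sf dec}(\mathsf N)\in\{0,1,\dots\}\cup\{\infty\}$ is the first time at which there are no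 anyons, and $T^{(\mathcal E)}_{\sf dec}=\mathbb E_{\mathsf N\sim \mathcal E}[T_{\sf dec}(\mathsf N)]$. **Proposition (Gerrymandering).** Let $D\ge1$ and $0<p<1$. 1. There are a family of $p$-bounded noise models $\mathcal E_{\sf bad}=(\mathcal E_{{\sf bad},L})_{L\ge1}$ and a constant $C$ such that for every integer $v\ge 3$ there is an $L_0$ such that, for all $L\ge L_0$, $$p_{\sf log}^{(\mathcal E_{\sf bad})}\ \ge\ e^{-C\,L^{\log_6 5}},\qquad\text{i.e. } p_{\sf log}^{(\mathcal E_{\sf bad})}=e^{-O(L^{\log_6 5})}.$$ 2. There are a family of $p$-bounded noise models $\mathcal E'_{\sf bad}=(\mathcal E'_{{\sf bad},L})_{L\ge1}$ and a constant $c>0$ such that for every integer $v\ge3$ there is an $L_0$ such that, for all $L\ge L_0$, $$T_{\sf dec}^{(\mathcal E'_{\sf bad})}\ \ge\ c\,(\log L)^{1/\log_6 5},$$ and moreover $\mathsf P_{\mathsf N\sim\mathcal E'_{\sf bad}}\big(T_{\sf dec}(\mathsf N)<c\,(\log L)^{1/\log_6 5}\big)\to0$ as $L\to\infty$, for every $v\ge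 3$. -/

import Mathlib

open scoped ENNReal

namespace MessagePassing

/-- Sites of the `D`-dimensional torus of linear size `L`. -/
abbrev Site (D L : ℕ) : Type := Fin D → ZMod L

/-- Links of the torus, each carrying one qubit: `(r, a)` is the link joining `r` to `r + e_a`. -/
abbrev Link (D L : ℕ) : Type := Site D L × Fin D

/-- The `2 D` lattice directions: `(true, a)` is `+e_a`, and `(false, a)` is `-e_a`. -/
abbrev Dir (D : ℕ) : Type := Bool × Fin D

/-- Pauli-`X` patterns. The chain `c` stands for the product of the `X` operators on the links where
`c = 1`, applied to the reference logical state `ρ_log`, the simultaneous `+1` eigenstate of all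
stabilizers and of all logical `Z` operators. -/
abbrev Chain (D L : ℕ) : Type := Link D L → ZMod 2

/-- The unit vector `e_a`. -/
def unitVec {D : ℕ} (L : ℕ) (a : Fin D) : Site D L := Pi.single a 1

/-- The lattice vector of a direction. -/
def dirVec {D : ℕ} (L : ℕ) (d : Dir D) : Site D L :=
  if d.1 then unitVec L d.2 else -unitVec L d.2

/-! ### The code: vertex stabilizers, anyons, plaquettes -/

/-- The syndrome at `r`: the parity of the number of errors on the `2 D` links at `r`; this is the
exponent `s` in the eigenvalue `(-1) ^ s` of the vertex stabilizer (a product of `Z`'s) at `r`. -/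
def syndrome {D L : ℕ} (c : Chain D L) (r : Site D L) : ZMod 2 :=
  ∑ a : Fin D, (c (r, a) + c (r - unitVec L a, a))

/-- There is an anyon at `r`: the vertex stabilizer at `r` has eigenvalue `-1`. -/
def IsAnyon {D L : ℕ} (c : Chain D L) (r : Site D L) : Prop := syndrome c r = 1

/-- The four links around the elementary square at `r` in the plane spanned by `e_a` and `e_b`. -/
def plaquette {D : ℕ} (L : ℕ) (r : Site D L) (a b : Fin D) : Chain D L :=
  Pi.single (r, a) 1 + Pi.single (r + unitVec L b, a) 1 +
    Pi.single (r, b) 1 + Pi.single (r + unitVec L a, b) 1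

/-- The supports of products of plaquette (`X`-type) stabilizers. An operator `X^c` maps the
reference logical state to itself exactly when `c` lies in this space. For `D = 1` (the repetition
code) the space is zero; for `D = 2` the code is the toric code. -/
def trivialChains (D L : ℕ) : Submodule (ZMod 2) (Chain D L) :=
  Submodule.span (ZMod 2) {c | ∃ (r : Site D L) (a b : Fin D), a ≠ b ∧ c = plaquette L r a b}

/-! ### The message-passing automaton -/

/-- A message field `m^{± a}_r` for every direction and site; `0` means that there is no message.
The field `m^{+a}` travels in direction `+e_a`, the field `m^{-a}` in direction `-e_a`. -/
abbrev Messages (D L : ℕ) : Type := Dir D → Site D L → ℕ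

/-- The unit ball of the `∞`-norm around `r` in the `D - 1` dimensions normal to `e_a`. -/
def face {D L : ℕ} (a : Fin D) (r : Site D L) : Finset (Site D L) :=
  (Fintype.piFinset
    (fun b => if b = a then ({0} : Finset (ZMod L)) else {-1, 0, 1})).image (fun e => r + e)

open Classical in
/-- One update of the messages. The field `m^d` at `r` consults the face behind `r`: it becomes `1`
if there is an anyon there, `0` if there is neither an anyon nor a message there, and otherwise it
is the smallest value of a message there plus one. Messages take values in `{0, …, L}`: a message
whose value would exceed `L` disappears. -/
noncomputable def automaton {D L : ℕ} (c : Chain D L) (m : Messages D L) : Messages D L :=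
  fun d r =>
    if ∃ r' ∈ face d.2 (r - dirVec L d), IsAnyon c r' then 1
    else if ∀ r' ∈ face d.2 (r - dirVec L d), m d r' = 0 then 0
    else if L < sInf {k | k ≠ 0 ∧ ∃ r' ∈ face d.2 (r - dirVec L d), m d r' = k} + 1 then 0
    else sInf {k | k ≠ 0 ∧ ∃ r' ∈ face d.2 (r - dirVec L d), m d r' = k} + 1

/-- The label `s a` of the direction `s e_a` (axes numbered from `1`), used to break ties. -/
def dirLabel {D : ℕ} (d : Dir D) : ℤ := if d.1 then (d.2 : ℤ) + 1 else -((d.2 : ℤ) + 1)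

/-- `m^d` is the smallest message received at `r`; ties are resolved by the smallest label. -/
def IsNearest {D L : ℕ} (m : Messages D L) (r : Site D L) (d : Dir D) : Prop :=
  m d r ≠ 0 ∧ ∀ d' : Dir D, m d' r ≠ 0 →
    m d r < m d' r ∨ (m d r = m d' r ∧ dirLabel d ≤ dirLabel d')

/-- The sign of the motion along an axis when the messages on it are `mp = m^{+a}` (sent from the
negative side) and `mm = m^{-a}` (sent from the positive side): towards the only message, or towards
the origin of the smaller one; no motion if the two are equal. -/
def axisForce (mp mm : ℕ) : ℤ :=
  if mp = mm then 0
  else if mp = 0 then 1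
  else if mm = 0 then -1
  else if mm < mp then 1
  else -1

open Classical in
/-- The force `f^a_r`, nonzero only along the axis of the smallest message received at `r`. -/
noncomputable def force {D L : ℕ} (m : Messages D L) (r : Site D L) (a : Fin D) : ℤ :=
  if ∃ s : Bool, IsNearest m r (s, a) then axisForce (m (true, a) r) (m (false, a) r) else 0

open Classical in
/-- The feedback. An `X` is applied on the link from `r` to `r + e_a` if an anyon at `r` is pushed
along `+e_a` or an anyon at `r + e_a` is pushed along `-e_a`. -/
noncomputable def feedback {D L : ℕ} (c : Chain D L) (m : Messages D L) : Chain D L :=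
  fun l => c l +
    if (IsAnyon c l.1 ∧ force m l.1 l.2 = 1) ∨
        (IsAnyon c (l.1 + unitVec L l.2) ∧ force m (l.1 + unitVec L l.2) l.2 = -1)
    then 1 else 0

/-- One time step of the decoder with speed `v`: `v` message updates, then one feedback. -/
noncomputable def decoderStep {D L : ℕ} (v : ℕ) (x : Chain D L × Messages D L) :
    Chain D L × Messages D L :=
  (feedback x.1 ((automaton x.1)^[v] x.2), (automaton x.1)^[v] x.2)

open Classical in
/-- The error pattern after `t` steps of the decoder, started from the noise realization `N` (an `X`
on every link of `N`) and no messages. -/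
noncomputable def evolve {D L : ℕ} (v : ℕ) (N : Finset (Link D L)) (t : ℕ) : Chain D L :=
  ((decoderStep v)^[t] (fun l => if l ∈ N then 1 else 0, fun _ _ => 0)).1

/-! ### Noise models and decoding diagnostics -/

/-- A stochastic (`X`-type) noise model: the law of the random set of links hit by an error. -/
abbrev NoiseModel (D L : ℕ) : Type := PMF (Finset (Link D L))

/-- The probability of an event. -/
noncomputable def prob {D L : ℕ} (E : NoiseModel D L) (S : Set (Finset (Link D L))) : ℝ≥0∞ :=
  E.toOuterMeasure S

/-- `p`-boundedness: `P(A ⊆ N) ≤ p ^ |A|` for every set of links `A`. -/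
def IsPBounded {D L : ℕ} (p : ℝ) (E : NoiseModel D L) : Prop :=
  ∀ A : Finset (Link D L), prob E {N | A ⊆ N} ≤ ENNReal.ofReal (p ^ A.card)

/-- The logical failure rate: the probability that the long-time output of the decoder is not the
initial logical state (whether it is another logical state or still has anyons). -/
noncomputable def logicalFailureRate {D L : ℕ} (v : ℕ) (E : NoiseModel D L) : ℝ≥0∞ :=
  prob E {N | ¬ ∃ t₀ : ℕ, ∀ t ≥ t₀, evolve v N t ∈ trivialChains D L}

/-- The decoding time of a noise realization: the first time at which there are no anyons, and `∞`
if there is no such time. -/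
noncomputable def decodingTime {D L : ℕ} (v : ℕ) (N : Finset (Link D L)) : ℝ≥0∞ :=
  ⨅ (t : ℕ) (_ : ∀ r, ¬ IsAnyon (evolve v N t) r), (t : ℝ≥0∞)

/-- The expected decoding time. -/
noncomputable def expectedDecodingTime {D L : ℕ} (v : ℕ) (E : NoiseModel D L) : ℝ≥0∞ :=
  ∑' N, E N * decodingTime v N

end MessagePassing

namespace MessagePassing

/-! ### The decoder on the line of integers -/

/-! All errors are put on one line along an axis. During the first `L` message updates no message is
deleted, and as long as fewer than `L` updates have been made none has gone around the torus
transversally. The decoder then acts on that line as a decoder on `ℤ` (`isRun_lineHistory`): at time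
`t` the value `k` is seen exactly when an anyon stood `k` sites away at time `t - (k - 1) / v`. It
remains to find sparse sets of links which this one-dimensional decoder completes instead of
erasing.

The mechanism is the motion of a gap between two filled pieces. If the pieces contain gaps near
their ends, the two anyons at the ends of the large gap hear these subgaps before they hear each
other, so each walks into its own piece and the gap widens. Meanwhile the subgaps close. When their
last messages have passed, at a time `T`, the two ends attract each other, and a gap of initial
width `u` is filled at time `(u + 1) / 2 + 2 * T`. `isRun_filled` says that a system of gaps evolves
in this way once every end satisfies the one-sided condition `LeftGood`; right ends follow by
reflection. Three criteria supply the condition: `leftGood_of_small` and `leftGood_of_foam` start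
the hierarchy, `leftGood_of_subgaps` continues it.

The hierarchy has two kinds of pieces, short ones of the form long-short-long and long ones of the
form long-short-long-short-long. Both are palindromes and show the same two last gaps at their ends,
so every gap of a level sees the same surroundings. The nearer subgap guides the end first, the
farther one later, and `T` is the time at which the last message of the farther one has passed. The
required inequalities (`Scale.Valid`) depend on `v` essentially through `x = 1 / (v - 1)` in `(0,
1/2]`. They hold while the proportions of a level lie in the box `Balanced`, which the recursion
preserves (`Balanced.next`).

The numbers of filled links grow by a factor below 4.24 per level (the true rate is `2 + √5`), the
lengths by at least 5. Hence a pattern of length `ℓ` has `O(ℓ ^ (44 / 49))` links, and `44 / 49 <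
logb 6 5`. This slack absorbs all constants that depend on `v`, which is why the constants in both
claims do not depend on `v`.

Closed up to a ring, such a pattern fills the whole line, a nontrivial loop
(`exists_failing_pattern`). On a segment, finite speed of propagation makes anyons survive near its
middle whatever happens elsewhere on the line (`exists_persistent_pattern`). The noise must be
chosen before `v`. For the failure rate it is a mixture over all `v < L` of failing patterns. For
the decoding time, many disjoint blocks are reserved for each speed `v < t₀` and switched on
independently, so that with high probability some block for the actual speed is present. -/

/-- The anyons of a history `h` of sets of links of `ℤ` (the link `l` joins `l` to `l + 1`). -/
def LineAnyon (h : ℕ → ℤ → Prop) (t : ℕ) (p : ℤ) : Prop := ¬ (h t (p - 1) ↔ h t p)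

/-- At time `t`, a message of value `k` sent from the right arrives at `p`. -/
def SeesRight (v : ℕ) (h : ℕ → ℤ → Prop) (t : ℕ) (p : ℤ) (k : ℕ) : Prop :=
  1 ≤ k ∧ (k - 1) / v ≤ t ∧ LineAnyon h (t - (k - 1) / v) (p + k)

/-- At time `t`, a message of value `k` sent from the left arrives at `p`. -/
def SeesLeft (v : ℕ) (h : ℕ → ℤ → Prop) (t : ℕ) (p : ℤ) (k : ℕ) : Prop :=
  1 ≤ k ∧ (k - 1) / v ≤ t ∧ LineAnyon h (t - (k - 1) / v) (p - k)

/-- There is an anyon at `p` at time `t`, and its nearest message comes from the right. -/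
def MovesRight (v : ℕ) (h : ℕ → ℤ → Prop) (t : ℕ) (p : ℤ) : Prop :=
  LineAnyon h t p ∧ ∃ k, SeesRight v h t p k ∧ ∀ k' ≤ k, ¬ SeesLeft v h t p k'

/-- There is an anyon at `p` at time `t`, and its nearest message comes from the left. -/
def MovesLeft (v : ℕ) (h : ℕ → ℤ → Prop) (t : ℕ) (p : ℤ) : Prop :=
  LineAnyon h t p ∧ ∃ k, SeesLeft v h t p k ∧ ∀ k' ≤ k, ¬ SeesRight v h t p k'

/-- The history `h` follows the decoder of speed `v` up to time `τ`. -/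
def IsRun (v : ℕ) (h : ℕ → ℤ → Prop) (τ : ℕ) : Prop :=
  ∀ t < τ, ∀ l, h (t + 1) l ↔ Xor (h t l) (MovesRight v h t l ∨ MovesLeft v h t (l + 1))

theorem not_movesLeft_of_movesRight {v : ℕ} {h : ℕ → ℤ → Prop} {t : ℕ} {p : ℤ}
    (hr : MovesRight v h t p) : ¬ MovesLeft v h t p := by
  rintro ⟨-, k₂, hk₂, hn₂⟩
  obtain ⟨-, k₁, hk₁, hn₁⟩ := hr
  rcases le_total k₁ k₂ with hle | hle
  · exact hn₂ _ hle hk₁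
  · exact hn₁ _ hle hk₂

/-- Locality: two runs that agree on a window agree on a window that shrinks at speed `v + 2`. -/
theorem IsRun.eq_of_window {v τ : ℕ} (hv : 1 ≤ v) {h h' : ℕ → ℤ → Prop} (hh : IsRun v h τ)
    (hh' : IsRun v h' τ) {lo hi : ℤ} (h0 : ∀ l, lo ≤ l → l ≤ hi → (h 0 l ↔ h' 0 l)) :
    ∀ t ≤ τ, ∀ l, lo + (v + 2) * t ≤ l → l ≤ hi - (v + 2) * t → (h t l ↔ h' t l) := by
  intro t
  induction t using Nat.strong_induction_on with
  | _ t ih =>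
    intro ht l hl1 hl2
    rcases t with _ | t
    · exact h0 l (by simpa using hl1) (by simpa using hl2)
    have anyon : ∀ s ≤ t, ∀ q : ℤ, lo + (v + 2) * s + 1 ≤ q → q ≤ hi - (v + 2) * s →
        (LineAnyon h s q ↔ LineAnyon h' s q) := by
      intro s hs q hq1 hq2
      unfold LineAnyon
      rw [ih s (by omega) (by omega) (q - 1) (by linarith) (by linarith),
        ih s (by omega) (by omega) q (by linarith) (by linarith)]
    push_cast at hl1 hl2
    -- A message emitted `e` steps ago has travelled at most `v * e + v` sites, and the window of
    -- agreement was then wider by `(v + 2) * e` on each side. The excess over `v` leaves room for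
    -- the neighbouring links that enter the definition of an anyon and of a move.
    have hdist : ∀ k : ℕ, 1 ≤ k → (k - 1) / v ≤ t →
        (k : ℤ) + (v + 2) * ((t - (k - 1) / v : ℕ) : ℤ) ≤ (v + 2) * t + v := by
      intro k hk hkt
      have h1 : (k - 1) < v * ((k - 1) / v) + v := by
        have := Nat.lt_mul_div_succ (k - 1) (show 0 < v by omega)
        rwa [Nat.mul_add, Nat.mul_one] at this
      generalize (k - 1) / v = e at *
      have h2 : (k : ℤ) ≤ v * e + v := by
        have : k ≤ v * e + v := by omega
        exact_mod_cast this
      push_cast [Nat.cast_sub hkt]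
      nlinarith [Int.natCast_nonneg e]
    have seesR : ∀ q : ℤ, (q = l ∨ q = l + 1) → ∀ k,
        (SeesRight v h t q k ↔ SeesRight v h' t q k) := by
      intro q hq k
      unfold SeesRight
      refine and_congr_right fun hk => and_congr_right fun hkt => ?_
      have := hdist k hk hkt
      apply anyon _ (Nat.sub_le _ _) <;> rcases hq with rfl | rfl <;> nlinarith
    have seesL : ∀ q : ℤ, (q = l ∨ q = l + 1) → ∀ k,
        (SeesLeft v h t q k ↔ SeesLeft v h' t q k) := by
      intro q hq k
      unfold SeesLeft
      refine and_congr_right fun hk => and_congr_right fun hkt => ?_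
      have := hdist k hk hkt
      apply anyon _ (Nat.sub_le _ _) <;> rcases hq with rfl | rfl <;> nlinarith
    have an : ∀ q : ℤ, (q = l ∨ q = l + 1) → (LineAnyon h t q ↔ LineAnyon h' t q) := by
      intro q hq
      apply anyon t le_rfl <;> rcases hq with rfl | rfl <;> nlinarith
    rw [hh t (by omega) l, hh' t (by omega) l,
      ih t (by omega) (by omega) l (by nlinarith) (by nlinarith)]
    unfold MovesRight MovesLeft
    simp only [seesR l (Or.inl rfl), seesL l (Or.inl rfl), seesR (l + 1) (Or.inr rfl),
      seesL (l + 1) (Or.inr rfl), an l (Or.inl rfl), an (l + 1) (Or.inr rfl)]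

/-! ### Systems of gaps -/

/-- A gap between two filled pieces of the line: it initially occupies the links
`x, …, x + u - 1`; its two ends first recede until time `T` and then approach each other. -/
structure Gap where
  /-- the left end -/
  x : ℤ
  /-- the initial width -/
  u : ℕ
  /-- the time until which the ends recede -/
  T : ℕ

namespace Gap

/-- The displacement of the ends of a gap at time `t`. -/
def ext (g : Gap) (t : ℕ) : ℤ := min (t : ℤ) (2 * g.T - t)

/-- The left end at time `t`. -/
def left (g : Gap) (t : ℕ) : ℤ := g.x - g.ext t

/-- The right end at time `t`. -/
def right (g : Gap) (t : ℕ) : ℤ := g.x + g.u + g.ext t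

/-- The time at which the gap closes. -/
def life (g : Gap) : ℕ := (g.u + 1) / 2 + 2 * g.T

/-- The reflected gap. -/
def mirror (g : Gap) : Gap := ⟨-(g.x + g.u), g.u, g.T⟩

theorem ext_of_le {g : Gap} {t : ℕ} (h : t ≤ g.T) : g.ext t = t := by
  unfold ext; omega

theorem ext_of_ge {g : Gap} {t : ℕ} (h : g.T ≤ t) : g.ext t = 2 * g.T - t := by
  unfold ext; omega

/-- The width `u + 2 * ext` keeps its odd parity: it is one at the last step before `life`, and
would be negative at `life`. -/
theorem left_lt_right {g : Gap} (hu : Odd g.u) {t : ℕ} (ht : t < g.life) :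
    g.left t < g.right t := by
  obtain ⟨w, hw⟩ := hu
  unfold life at ht; unfold left right ext
  omega

end Gap

/-- The filled links at time `t`: those that lie in no gap. -/
def filled (S : Set Gap) (t : ℕ) (l : ℤ) : Prop :=
  ∀ g ∈ S, t < g.life → ¬ (g.left t ≤ l ∧ l < g.right t)

/-- The gaps of a system have odd widths and are so far apart that their ends do not meet. -/
structure Separated (S : Set Gap) : Prop where
  odd : ∀ g ∈ S, Odd g.u
  sep : ∀ g ∈ S, ∀ g' ∈ S, g = g' ∨ g.x + g.u + 2 * min (g.T : ℤ) g'.T < g'.x ∨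
    g'.x + g'.u + 2 * min (g.T : ℤ) g'.T < g.x

/-- Neighbouring ends of two gaps approach each other only while both recede, that is for `min T T'`
steps at relative speed two. Afterwards their distance never decreases. -/
theorem Separated.at_time {S : Set Gap} (hS : Separated S) {g g' : Gap} (hg : g ∈ S)
    (hg' : g' ∈ S) (t : ℕ) : g = g' ∨ g.right t < g'.left t ∨ g'.right t < g.left t := by
  rcases hS.sep g hg g' hg' with h | h | h
  · exact Or.inl h
  · refine Or.inr (Or.inl ?_)
    unfold Gap.left Gap.right Gap.ext
    omega
  · refine Or.inr (Or.inr ?_)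
    unfold Gap.left Gap.right Gap.ext
    omega

/-- The anyons of a system of gaps are the ends of the gaps. -/
theorem lineAnyon_filled {S : Set Gap} (hS : Separated S) {t : ℕ} {p : ℤ} :
    LineAnyon (filled S) t p ↔ ∃ g ∈ S, t < g.life ∧ (p = g.left t ∨ p = g.right t) := by
  unfold LineAnyon filled
  constructor
  · intro h
    by_contra hcon
    push Not at hcon
    apply h
    constructor
    · intro h1 g hg ht hin
      have := hcon g hg ht
      exact h1 g hg ht (by omega)
    · intro h1 g hg ht hin
      have := hcon g hg ht
      exact h1 g hg ht (by omega)
  · rintro ⟨g, hg, ht, hp⟩ hiff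
    have hlr := Gap.left_lt_right (hS.odd g hg) ht
    rcases hp with rfl | rfl
    · have h1 : ¬ ∀ g' ∈ S, t < g'.life → ¬ (g'.left t ≤ g.left t ∧ g.left t < g'.right t) :=
        fun h => h g hg ht ⟨le_rfl, hlr⟩
      apply h1
      rw [← hiff]
      intro g' hg' ht' hin
      have hlr' := Gap.left_lt_right (hS.odd g' hg') ht'
      rcases hS.at_time hg hg' t with rfl | h | h <;> omega
    · have h1 : ¬ ∀ g' ∈ S, t < g'.life →
          ¬ (g'.left t ≤ g.right t - 1 ∧ g.right t - 1 < g'.right t) :=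
        fun h => h g hg ht ⟨by omega, by omega⟩
      apply h1
      rw [hiff]
      intro g' hg' ht' hin
      have hlr' := Gap.left_lt_right (hS.odd g' hg') ht'
      rcases hS.at_time hg hg' t with rfl | h | h <;> omega

/-- The links along which the ends of `g` move at time `t`. -/
def Gap.Flips (g : Gap) (t : ℕ) (l : ℤ) : Prop :=
  t < g.life ∧ ((l = g.left t ∧ g.T ≤ t) ∨ (l = g.right t ∧ t < g.T) ∨
    (l + 1 = g.left t ∧ t < g.T) ∨ (l + 1 = g.right t ∧ g.T ≤ t))

/-- In the last step both ends move across the single remaining link. `Flips` is a disjunction and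
counts that link once, in agreement with the rule that `X` acts once on a link used by two anyons.
-/
theorem Gap.flips_step {g : Gap} (hu : Odd g.u) (t : ℕ) (l : ℤ) :
    (t + 1 < g.life ∧ g.left (t + 1) ≤ l ∧ l < g.right (t + 1)) ↔
      Xor (t < g.life ∧ g.left t ≤ l ∧ l < g.right t) (g.Flips t l) := by
  obtain ⟨w, hw⟩ := hu
  unfold Xor Gap.Flips
  by_cases hT : t < g.T
  · have h1 : g.ext t = t := Gap.ext_of_le hT.le
    have h2 : g.ext (t + 1) = (t + 1 : ℕ) := Gap.ext_of_le hT
    unfold Gap.left Gap.right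
    rw [h1, h2]
    have hl : t + 1 < g.life := by unfold Gap.life; omega
    push_cast
    omega
  · have h1 : g.ext t = 2 * g.T - t := Gap.ext_of_ge (by omega)
    have h2 : g.ext (t + 1) = 2 * g.T - (t + 1 : ℕ) := Gap.ext_of_ge (by omega)
    unfold Gap.left Gap.right
    rw [h1, h2]
    have hl : g.life = w + 1 + 2 * g.T := by unfold Gap.life; omega
    push_cast
    omega

/-- The link `l` lies in the gap `g` at time `t`. -/
def Gap.Covers (g : Gap) (t : ℕ) (l : ℤ) : Prop := t < g.life ∧ g.left t ≤ l ∧ l < g.right t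

theorem Gap.near_of_covers_or_flips {g : Gap} (hu : Odd g.u) {t : ℕ} {l : ℤ}
    (h : g.Covers t l ∨ g.Flips t l) : t < g.life ∧ g.left t - 1 ≤ l ∧ l ≤ g.right t := by
  rcases h with h | h
  · exact ⟨h.1, by linarith [h.2.1], h.2.2.le⟩
  · have := Gap.left_lt_right hu h.1
    refine ⟨h.1, ?_⟩
    rcases h.2 with h | h | h | h <;> omega

/-- A link touched by two different gaps must lie exactly between two receding ends. These would
then overlap one step later, against `Separated.at_time`. -/
theorem Separated.no_contact {S : Set Gap} (hS : Separated S) {g g' : Gap} (hg : g ∈ S)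
    (hg' : g' ∈ S) {t : ℕ} {l : ℤ} (h : g.Covers t l ∨ g.Flips t l)
    (h' : g'.Covers t l ∨ g'.Flips t l) (hlt : g.right t < g'.left t) : False := by
  have d := Gap.near_of_covers_or_flips (hS.odd g hg) h
  have d' := Gap.near_of_covers_or_flips (hS.odd g' hg') h'
  have hl : l = g.right t ∧ l + 1 = g'.left t := by omega
  have c1 := Gap.left_lt_right (hS.odd g hg) d.1
  have c2 := Gap.left_lt_right (hS.odd g' hg') d'.1
  have hT : t < g.T := by
    rcases h with h | h
    · have := h.2.2; omega
    · rcases h.2 with h | h | h | h <;> omega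
  have hT' : t < g'.T := by
    rcases h' with h | h
    · have := h.2.1; omega
    · rcases h.2 with h | h | h | h <;> omega
  have r1 : g.right (t + 1) = g.right t + 1 := by
    unfold Gap.right; rw [Gap.ext_of_le hT, Gap.ext_of_le hT.le]; push_cast; ring
  have r2 : g'.left (t + 1) = g'.left t - 1 := by
    unfold Gap.left; rw [Gap.ext_of_le hT', Gap.ext_of_le hT'.le]; push_cast; ring
  have e1 := Gap.left_lt_right (hS.odd g hg) (t := t + 1) (by unfold Gap.life; omega)
  have e2 := Gap.left_lt_right (hS.odd g' hg') (t := t + 1) (by unfold Gap.life; omega)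
  rcases hS.at_time hg hg' (t + 1) with h | h | h
  · subst h; omega
  · omega
  · omega

theorem Separated.unique {S : Set Gap} (hS : Separated S) {g g' : Gap} (hg : g ∈ S)
    (hg' : g' ∈ S) {t : ℕ} {l : ℤ} (h : g.Covers t l ∨ g.Flips t l)
    (h' : g'.Covers t l ∨ g'.Flips t l) : g = g' := by
  rcases hS.at_time hg hg' t with h1 | h1 | h1
  · exact h1
  · exact (hS.no_contact hg hg' h h' h1).elim
  · exact (hS.no_contact hg' hg h' h h1).elim

theorem filled_iff {S : Set Gap} {t : ℕ} {l : ℤ} :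
    filled S t l ↔ ¬ ∃ g ∈ S, g.Covers t l := by
  unfold filled Gap.Covers
  push Not
  rfl

/-- The history of a system of gaps changes on the links along which the ends move. -/
theorem filled_step {S : Set Gap} (hS : Separated S) (t : ℕ) (l : ℤ) :
    filled S (t + 1) l ↔ Xor (filled S t l) (∃ g ∈ S, g.Flips t l) := by
  have hstep : ∀ g ∈ S, (g.Covers (t + 1) l ↔ Xor (g.Covers t l) (g.Flips t l)) :=
    fun g hg => Gap.flips_step (hS.odd g hg) t l
  rw [filled_iff, filled_iff]
  by_cases hex : ∃ g ∈ S, g.Covers t l ∨ g.Flips t l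
  · obtain ⟨g, hg, h⟩ := hex
    have e1 : (∃ g' ∈ S, g'.Covers t l) ↔ g.Covers t l := by
      constructor
      · rintro ⟨g', hg', h'⟩
        rwa [hS.unique hg hg' h (Or.inl h')]
      · exact fun h' => ⟨g, hg, h'⟩
    have e2 : (∃ g' ∈ S, g'.Flips t l) ↔ g.Flips t l := by
      constructor
      · rintro ⟨g', hg', h'⟩
        rwa [hS.unique hg hg' h (Or.inr h')]
      · exact fun h' => ⟨g, hg, h'⟩
    have e3 : (∃ g' ∈ S, g'.Covers (t + 1) l) ↔ g.Covers (t + 1) l := by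
      constructor
      · rintro ⟨g', hg', h'⟩
        have h2 := (hstep g' hg').1 h'
        rwa [hS.unique hg hg' h (by unfold Xor at h2; tauto)]
      · exact fun h' => ⟨g, hg, h'⟩
    rw [e1, e2, e3, hstep g hg]
    unfold Xor
    tauto
  · have n1 : ¬ ∃ g ∈ S, g.Covers t l := fun ⟨g, hg, h⟩ => hex ⟨g, hg, Or.inl h⟩
    have n2 : ¬ ∃ g ∈ S, g.Flips t l := fun ⟨g, hg, h⟩ => hex ⟨g, hg, Or.inr h⟩
    have n3 : ¬ ∃ g ∈ S, g.Covers (t + 1) l := fun ⟨g, hg, h⟩ => by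
      have h2 := (hstep g hg).1 h
      exact hex ⟨g, hg, by unfold Xor at h2; tauto⟩
    exact ⟨fun _ => Or.inl ⟨n1, n2⟩, fun _ => n3⟩

/-! ### Motion of the gap ends, described by rays -/

/-- The left end of `g` behaves as prescribed: it sees a message from the left before any message
from the other end while it recedes, and no message from the left that could compete with the one
from the other end afterwards. -/
structure LeftGood (v : ℕ) (S : Set Gap) (g : Gap) : Prop where
  recede : ∀ t < g.T, ∃ k, SeesLeft v (filled S) t (g.left t) k ∧ k + (k - 1) / v < g.u + 2 * t
  close : ∃ k, k + (k - 1) / v = g.u + 2 * g.T ∧ (k - 1) / v ≤ g.T ∧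
    ∀ t, g.T ≤ t → t < g.life → ∀ k' ≤ k, ¬ SeesLeft v (filled S) t (g.left t) k'

/-- Follows a ray backwards from one message value to the next: the emission time is unchanged,
except at multiples of `v`, where it drops by one. -/
theorem natSucc_div_or (v j : ℕ) :
    (j + 1) / v = j / v ∨ ((j + 1) / v = j / v + 1 ∧ j + 1 = v * ((j + 1) / v)) := by
  have h := Nat.succ_div (a := j) (b := v)
  split_ifs at h with hd
  · exact Or.inr ⟨h, (Nat.mul_div_cancel' hd).symm⟩
  · exact Or.inl h

/-- A ray that leaves the left end of a closing gap hits its right end. -/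
theorem Gap.exists_hit {v : ℕ} (hv : 1 ≤ v) {g : Gap} (hu : Odd g.u) {k₀ : ℕ}
    (hk₀ : k₀ + (k₀ - 1) / v = g.u + 2 * g.T) {t : ℕ} (hk₀t : (k₀ - 1) / v ≤ t)
    (hT : g.T ≤ t) (ht : t < g.life) :
    ∃ k ≤ k₀, 1 ≤ k ∧ g.left t + k = g.right (t - (k - 1) / v) := by
  have hx : g.ext t = 2 * g.T - t := Gap.ext_of_ge hT
  have hpos : 0 < (g.u : ℤ) + 2 * g.ext t := by
    have := Gap.left_lt_right hu ht
    unfold Gap.left Gap.right at this; linarith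
  -- The search is for the first value at which the ray is at or beyond the right end. The value
  -- `k₀` qualifies because a displacement is at most the elapsed time.
  have hex : ∃ k : ℕ, k ≤ k₀ ∧ (g.u : ℤ) + g.ext (t - (k - 1) / v) + g.ext t ≤ k := by
    refine ⟨k₀, le_rfl, ?_⟩
    have : g.ext (t - (k₀ - 1) / v) ≤ (t - (k₀ - 1) / v : ℕ) := min_le_left _ _
    rw [hx]; omega
  classical
  obtain ⟨hle, hge⟩ := Nat.find_spec hex
  have hmin : ∀ m < Nat.find hex, _ := fun m => Nat.find_min hex (m := m)
  generalize Nat.find hex = k at *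
  have hkt : (k - 1) / v ≤ t :=
    le_trans (Nat.div_le_div_right (by omega)) hk₀t
  have hk1 : 1 ≤ k := by
    rcases Nat.eq_zero_or_pos k with h0 | h0
    · rw [h0] at hge
      simp only [Nat.zero_sub, Nat.zero_div, Nat.sub_zero, Nat.cast_zero] at hge
      omega
    · exact h0
  have hmin := hmin (k - 1) (by omega)
  rw [not_and] at hmin
  have hmin := hmin (by omega)
  refine ⟨k, hle, hk1, ?_⟩
  suffices h : (g.u : ℤ) + g.ext (t - (k - 1) / v) + g.ext t = k by
    unfold Gap.left Gap.right; linarith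
  have hstep : (k - 1) / v = (k - 1 - 1) / v ∨
      ((k - 1) / v = (k - 1 - 1) / v + 1 ∧ k - 1 = v * ((k - 1) / v) ∧ 2 ≤ k) := by
    rcases Nat.lt_or_ge k 2 with h2 | h2
    · left; have : k - 1 = 0 := by omega
      rw [this]
    · obtain ⟨j, rfl⟩ : ∃ j, k = j + 2 := ⟨k - 2, by omega⟩
      rcases natSucc_div_or v j with h | ⟨h, h'⟩
      · exact Or.inl h
      · exact Or.inr ⟨h, h', h2⟩
  have hn : ((k - 1 : ℕ) : ℤ) = (k : ℤ) - 1 := by push_cast [Nat.cast_sub hk1]; ring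
  rcases hstep with h | ⟨h1, h2, h3⟩
  · rw [← h] at hmin
    omega
  · have hs : (k - 1 - 1) / v = (k - 1) / v - 1 := (Nat.sub_eq_of_eq_add h1).symm
    have he1 : 1 ≤ (k - 1) / v := h1 ▸ Nat.le_add_left 1 _
    clear h1
    generalize (k - 1) / v = e at *
    rw [hs] at hmin
    by_cases hsT : t - e < g.T
    · have x1 : g.ext (t - e) = (t - e : ℕ) := Gap.ext_of_le hsT.le
      have x2 : g.ext (t - (e - 1)) = (t - (e - 1) : ℕ) := Gap.ext_of_le (by omega)
      rw [x2] at hmin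
      rw [x1] at hge ⊢
      by_contra hne
      -- Going back in time, a receding end comes towards the ray, so the ray can skip it at a
      -- multiple of `v`. This happens only if `u + 2 * T` is `(v + 1) * e`, a value that `k₀ + (k₀
      -- - 1) / v` never takes.
      have hbad : v * e + e = g.u + 2 * g.T := by omega
      rcases Nat.lt_or_ge (v * e) k₀ with hc | hc
      · have : e ≤ (k₀ - 1) / v := (Nat.le_div_iff_mul_le (by omega)).2 (by
          rw [Nat.mul_comm]; omega)
        omega
      · have : (k₀ - 1) / v ≤ e := by
          refine le_trans (Nat.div_le_div_right (show k₀ - 1 ≤ v * e by omega)) ?_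
          rw [Nat.mul_div_cancel_left _ (by omega)]
        omega
    · have x1 : g.ext (t - e) = 2 * g.T - (t - e : ℕ) := Gap.ext_of_ge (by omega)
      have x2 : g.ext (t - (e - 1)) = 2 * g.T - (t - (e - 1) : ℕ) := Gap.ext_of_ge (by omega)
      rw [x2] at hmin
      rw [x1] at hge ⊢
      omega

/-- The right end becomes visible only at values with `k + (k - 1) / v` at least `u + 2 * t`. Below
that bound a ray to the right is still inside the gap, where there is no anyon. -/
theorem LeftGood.movesLeft {v : ℕ} {S : Set Gap} (hS : Separated S) {g : Gap} (hg : g ∈ S)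
    (h : LeftGood v S g) {t : ℕ} (ht : t < g.T) : MovesLeft v (filled S) t (g.left t) := by
  have hlife : ∀ s ≤ t, s < g.life := fun s hs => by unfold Gap.life; omega
  refine ⟨(lineAnyon_filled hS).2 ⟨g, hg, hlife t le_rfl, Or.inl rfl⟩, ?_⟩
  obtain ⟨k, hk, hlt⟩ := h.recede t ht
  refine ⟨k, hk, ?_⟩
  rintro k' hk' ⟨h1, h2, h3⟩
  apply h3
  have hdiv : (k' - 1) / v ≤ (k - 1) / v := Nat.div_le_div_right (by omega)
  have hdiv2 : (k' - 1) / v ≤ k' - 1 := Nat.div_le_self _ _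
  generalize (k' - 1) / v = e at *
  generalize (k - 1) / v = e' at *
  have x1 : g.ext (t - e) = (t - e : ℕ) := Gap.ext_of_le (by omega)
  have x2 : g.ext t = t := Gap.ext_of_le (by omega)
  have hc : ∀ p : ℤ, (p = g.left t + k' - 1 ∨ p = g.left t + k') →
      ¬ filled S (t - e) p := by
    intro p hp hf
    apply hf g hg (hlife _ (Nat.sub_le _ _))
    unfold Gap.left Gap.right at *
    rw [x1]; rw [x2] at hp
    omega
  exact iff_of_false (hc _ (Or.inl rfl)) (hc _ (Or.inr rfl))

/-- While the message of the other end dates from its receding phase, its value satisfies `k + (k -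
1) / v = u + 2 * T` at every later time, since the left end has turned around. The solution `k₀`
thus bounds the relevant values uniformly in `t`. -/
theorem LeftGood.movesRight {v : ℕ} (hv : 1 ≤ v) {S : Set Gap} (hS : Separated S) {g : Gap}
    (hg : g ∈ S) (h : LeftGood v S g) {t : ℕ} (hT : g.T ≤ t) (ht : t < g.life) :
    MovesRight v (filled S) t (g.left t) := by
  refine ⟨(lineAnyon_filled hS).2 ⟨g, hg, ht, Or.inl rfl⟩, ?_⟩
  obtain ⟨k₀, h1, h2, h3⟩ := h.close
  obtain ⟨k, hk, hk1, hhit⟩ := Gap.exists_hit hv (hS.odd g hg) h1 (h2.trans hT) hT ht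
  have hkt : (k - 1) / v ≤ t := le_trans (Nat.div_le_div_right (by omega)) (h2.trans hT)
  refine ⟨k, ⟨hk1, hkt, ?_⟩, fun k' hk' => h3 t hT ht k' (hk'.trans hk)⟩
  exact (lineAnyon_filled hS).2 ⟨g, hg, lt_of_le_of_lt (Nat.sub_le _ _) ht, Or.inr hhit⟩

/-! ### Reflection -/

theorem Gap.ext_mirror (g : Gap) (t : ℕ) : g.mirror.ext t = g.ext t := rfl

theorem Gap.left_mirror (g : Gap) (t : ℕ) : g.mirror.left t = -g.right t := by
  unfold Gap.left Gap.right
  rw [g.ext_mirror]; simp only [Gap.mirror]; ring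

theorem Gap.right_mirror (g : Gap) (t : ℕ) : g.mirror.right t = -g.left t := by
  unfold Gap.left Gap.right
  rw [g.ext_mirror]; simp only [Gap.mirror]; ring

theorem Gap.life_mirror (g : Gap) : g.mirror.life = g.life := rfl

theorem Gap.mirror_mirror (g : Gap) : g.mirror.mirror = g := by
  obtain ⟨x, u, T⟩ := g
  simp [Gap.mirror]

theorem filled_mirror (S : Set Gap) (t : ℕ) (l : ℤ) :
    filled (Gap.mirror '' S) t l ↔ filled S t (-1 - l) := by
  unfold filled
  rw [Set.forall_mem_image]
  refine forall₂_congr fun g _ => ?_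
  rw [g.life_mirror, g.left_mirror, g.right_mirror]
  refine imp_congr_right fun _ => not_congr ?_
  constructor <;> (rintro ⟨h1, h2⟩; constructor <;> linarith)

theorem Separated.mirror {S : Set Gap} (hS : Separated S) : Separated (Gap.mirror '' S) := by
  constructor
  · rw [Set.forall_mem_image]
    exact hS.odd
  · rw [Set.forall_mem_image]
    intro g hg
    rw [Set.forall_mem_image]
    intro g' hg'
    rcases hS.sep g hg g' hg' with rfl | h | h
    · exact Or.inl rfl
    · right; right; simp only [Gap.mirror]; linarith
    · right; left; simp only [Gap.mirror]; linarith

theorem lineAnyon_mirror (S : Set Gap) (t : ℕ) (p : ℤ) :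
    LineAnyon (filled (Gap.mirror '' S)) t p ↔ LineAnyon (filled S) t (-p) := by
  unfold LineAnyon
  rw [filled_mirror, filled_mirror, show -1 - (p - 1) = -p by ring,
    show -1 - p = -p - 1 by ring]
  tauto

theorem seesLeft_mirror (v : ℕ) (S : Set Gap) (t : ℕ) (p : ℤ) (k : ℕ) :
    SeesLeft v (filled (Gap.mirror '' S)) t p k ↔ SeesRight v (filled S) t (-p) k := by
  unfold SeesLeft SeesRight
  rw [lineAnyon_mirror, show -(p - (k : ℤ)) = -p + k by ring]

theorem seesRight_mirror (v : ℕ) (S : Set Gap) (t : ℕ) (p : ℤ) (k : ℕ) :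
    SeesRight v (filled (Gap.mirror '' S)) t p k ↔ SeesLeft v (filled S) t (-p) k := by
  unfold SeesLeft SeesRight
  rw [lineAnyon_mirror, show -(p + (k : ℤ)) = -p - k by ring]

theorem movesLeft_mirror (v : ℕ) (S : Set Gap) (t : ℕ) (p : ℤ) :
    MovesLeft v (filled (Gap.mirror '' S)) t p ↔ MovesRight v (filled S) t (-p) := by
  unfold MovesLeft MovesRight
  simp only [lineAnyon_mirror, seesLeft_mirror, seesRight_mirror]

theorem movesRight_mirror (v : ℕ) (S : Set Gap) (t : ℕ) (p : ℤ) :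
    MovesRight v (filled (Gap.mirror '' S)) t p ↔ MovesLeft v (filled S) t (-p) := by
  unfold MovesLeft MovesRight
  simp only [lineAnyon_mirror, seesLeft_mirror, seesRight_mirror]

/-- A system of gaps all of whose ends behave as prescribed follows the decoder. -/
theorem isRun_filled {v : ℕ} (hv : 1 ≤ v) {S : Set Gap} (hS : Separated S)
    (hl : ∀ g ∈ S, LeftGood v S g)
    (hr : ∀ g ∈ S, LeftGood v (Gap.mirror '' S) g.mirror) (τ : ℕ) :
    IsRun v (filled S) τ := by
  intro t _ l
  rw [filled_step hS]
  have L1 : ∀ g ∈ S, t < g.T → MovesLeft v (filled S) t (g.left t) :=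
    fun g hg ht => (hl g hg).movesLeft hS hg ht
  have L2 : ∀ g ∈ S, g.T ≤ t → t < g.life → MovesRight v (filled S) t (g.left t) :=
    fun g hg hT ht => (hl g hg).movesRight hv hS hg hT ht
  have R1 : ∀ g ∈ S, t < g.T → MovesRight v (filled S) t (g.right t) := by
    intro g hg ht
    have := (hr g hg).movesLeft hS.mirror (Set.mem_image_of_mem _ hg) (t := t) ht
    rwa [movesLeft_mirror, Gap.left_mirror, neg_neg] at this
  have R2 : ∀ g ∈ S, g.T ≤ t → t < g.life → MovesLeft v (filled S) t (g.right t) := by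
    intro g hg hT ht
    have := (hr g hg).movesRight hv hS.mirror (Set.mem_image_of_mem _ hg) (t := t) hT ht
    rwa [movesRight_mirror, Gap.left_mirror, neg_neg] at this
  have hlife : ∀ g : Gap, t < g.T → t < g.life := fun g h => by unfold Gap.life; omega
  have key : (∃ g ∈ S, g.Flips t l) ↔
      (MovesRight v (filled S) t l ∨ MovesLeft v (filled S) t (l + 1)) := by
    constructor
    · rintro ⟨g, hg, ht, h | h | h | h⟩
      · left; rw [h.1]; exact L2 g hg h.2 ht
      · left; rw [h.1]; exact R1 g hg h.2
      · right; rw [h.1]; exact L1 g hg h.2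
      · right; rw [h.1]; exact R2 g hg h.2 ht
    · rintro (h | h)
      · obtain ⟨g, hg, ht, hp | hp⟩ := (lineAnyon_filled hS).1 h.1
        · refine ⟨g, hg, ht, Or.inl ⟨hp, ?_⟩⟩
          by_contra hT
          rw [hp] at h
          exact not_movesLeft_of_movesRight h (L1 g hg (by omega))
        · refine ⟨g, hg, ht, Or.inr (Or.inl ⟨hp, ?_⟩)⟩
          by_contra hT
          rw [hp] at h
          exact not_movesLeft_of_movesRight h (R2 g hg (by omega) ht)
      · obtain ⟨g, hg, ht, hp | hp⟩ := (lineAnyon_filled hS).1 h.1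
        · refine ⟨g, hg, ht, Or.inr (Or.inr (Or.inl ⟨hp, ?_⟩))⟩
          by_contra hT
          rw [hp] at h
          exact not_movesLeft_of_movesRight (L2 g hg (by omega) ht) h
        · refine ⟨g, hg, ht, Or.inr (Or.inr (Or.inr ⟨hp, ?_⟩))⟩
          by_contra hT
          rw [hp] at h
          exact not_movesLeft_of_movesRight (R1 g hg (by omega)) h
  rw [key]

/-! ### Local criteria for the end of a gap -/

/-- A ray of speed `v` between the two ends of a gap meets them. -/
def Gap.Closable (v : ℕ) (g : Gap) : Prop :=
  ∃ k, k + (k - 1) / v = g.u + 2 * g.T ∧ (k - 1) / v ≤ g.T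

theorem Separated.right_lt_left {S : Set Gap} (hS : Separated S) {j g : Gap} (hj : j ∈ S)
    (hg : g ∈ S) (hlt : j.x < g.x) (t : ℕ) : j.right t < g.left t := by
  rcases hS.sep j hj g hg with h | h | h
  · subst h; omega
  · unfold Gap.left Gap.right Gap.ext; omega
  · omega

theorem Gap.right_step (g : Gap) (s : ℕ) :
    (s < g.T ∧ g.right (s + 1) = g.right s + 1) ∨ (g.T ≤ s ∧ g.right (s + 1) = g.right s - 1) := by
  unfold Gap.right
  rcases Nat.lt_or_ge s g.T with h | h
  · left; rw [Gap.ext_of_le h, Gap.ext_of_le h.le]; push_cast; exact ⟨h, by ring⟩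
  · right; rw [Gap.ext_of_ge h, Gap.ext_of_ge (by omega)]; push_cast; exact ⟨h, by ring⟩

theorem Gap.left_step_le (g : Gap) (s : ℕ) : g.left (s + 1) ≤ g.left s + 1 := by
  unfold Gap.left Gap.ext; omega

/-- A ray to the left that crosses a gap sees one of its ends. -/
theorem exists_seesLeft {v : ℕ} (hv : 1 ≤ v) {S : Set Gap} (hS : Separated S) {j : Gap}
    (hj : j ∈ S) (hjc : j.Closable v) {t : ℕ} {p : ℤ} (hjp : t < j.life → j.right t < p)
    (hex : ∃ k, 1 ≤ k ∧ (k - 1) / v ≤ t ∧ t - (k - 1) / v < j.life ∧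
      j.left (t - (k - 1) / v) ≤ p - k ∧ p - k < j.right (t - (k - 1) / v)) :
    ∃ k, SeesLeft v (filled S) t p k ∧ (k : ℤ) + ((k - 1) / v : ℕ) ≤ p + t - j.x := by
  have bound : ∀ k, (k - 1) / v ≤ t → j.left (t - (k - 1) / v) ≤ p - k →
      (k : ℤ) + ((k - 1) / v : ℕ) ≤ p + t - j.x := by
    intro k hk h
    generalize (k - 1) / v = e at *
    unfold Gap.left Gap.ext at h
    omega
  have fin : ∀ k, 1 ≤ k → (k - 1) / v ≤ t → t - (k - 1) / v < j.life →
      (p - k = j.left (t - (k - 1) / v) ∨ p - k = j.right (t - (k - 1) / v)) →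
      ∃ k, SeesLeft v (filled S) t p k ∧ (k : ℤ) + ((k - 1) / v : ℕ) ≤ p + t - j.x := by
    intro k h1 h2 h3 h4
    refine ⟨k, ⟨h1, h2, (lineAnyon_filled hS).2 ⟨j, hj, h3, h4⟩⟩, bound k h2 ?_⟩
    have := Gap.left_lt_right (hS.odd j hj) h3
    omega
  classical
  -- By minimality the ray is outside the gap one value earlier, so it has just crossed the right
  -- end.
  obtain ⟨h1, h2, h3, h4, h5⟩ := Nat.find_spec hex
  have hmin : ∀ m < Nat.find hex, _ := fun m => Nat.find_min hex (m := m)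
  generalize Nat.find hex = k at *
  rcases Nat.lt_or_ge k 2 with hk | hk
  · have : k = 1 := by omega
    subst this
    simp only [Nat.sub_self, Nat.zero_div, Nat.sub_zero] at h3 h4 h5
    have := hjp h3
    push_cast at h4 h5
    omega
  obtain ⟨i, rfl⟩ : ∃ i, k = i + 2 := ⟨k - 2, by omega⟩
  have hm := hmin (i + 1) (by omega)
  simp only [Nat.add_sub_cancel] at hm
  have e1 : i + 2 - 1 = i + 1 := rfl
  rw [e1] at h2 h3 h4 h5
  -- If the emission time does not change, the ray moves one site and enters exactly through the
  -- right end. Otherwise the end has moved as well and may have been skipped.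
  rcases natSucc_div_or v i with h | ⟨h, h'⟩
  · rw [h] at h2 h3 h4 h5
    refine fin (i + 1) (by omega) h2 h3 (Or.inr ?_)
    simp only [Nat.add_sub_cancel]
    by_contra hne
    exact hm ⟨by omega, h2, h3, by push_cast at *; omega, by push_cast at *; omega⟩
  · have hle : i / v + 1 ≤ t := h ▸ h2
    obtain ⟨s, hs⟩ : ∃ s, t = s + (i / v + 1) := ⟨t - (i / v + 1), by omega⟩
    have hs1 : t - (i + 1) / v = s := by rw [h]; omega
    have hs2 : t - i / v = s + 1 := by omega
    rw [hs1] at h3 h4 h5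
    rw [hs2] at hm
    have hstep := j.right_step s
    have hlstep := j.left_step_le s
    rcases Nat.lt_or_ge (s + 1) j.life with hl | hl
    · have hlr := Gap.left_lt_right (hS.odd j hj) hl
      have hy : j.right (s + 1) ≤ p - (i + 1 : ℕ) := by
        by_contra hcon
        exact hm ⟨by omega, by omega, hl, by push_cast at *; omega, by push_cast at *; omega⟩
      rcases hstep with ⟨a, b⟩ | ⟨a, b⟩
      · push_cast at *; omega
      · by_cases hc : j.right (s + 1) = p - (i + 1 : ℕ)
        · refine fin (i + 1) (by omega) (by simp only [Nat.add_sub_cancel]; omega) ?_ (Or.inr ?_)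
          · simp only [Nat.add_sub_cancel]; rw [hs2]; exact hl
          · simp only [Nat.add_sub_cancel]; rw [hs2]; exact hc.symm
        -- The ray skipped the right end of a closing gap. Its position one value earlier is where
        -- the right end stood at the earlier time `s`, so the rest of the ray is a ray leaving that
        -- end, and `Gap.exists_hit` for the reflected gap gives a hit on the left end. The values
        -- add up because `i + 1` is a multiple of `v`.
        · obtain ⟨k₀, c1, c2⟩ := hjc
          obtain ⟨k', hk', hk1', hhit⟩ := Gap.exists_hit (g := j.mirror) (t := s) hv
            (hS.odd j hj) c1 (c2.trans a) a h3
          rw [Gap.left_mirror, Gap.right_mirror] at hhit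
          have hes : (k' - 1) / v ≤ s :=
            le_trans (Nat.div_le_div_right (by omega)) (c2.trans a)
          have hdiv : (v * ((i + 1) / v) + k' - 1) / v = (i + 1) / v + (k' - 1) / v := by
            rw [Nat.add_sub_assoc hk1', Nat.mul_add_div (by omega)]
          have hi : ((v * ((i + 1) / v) : ℕ) : ℤ) = i + 1 := by rw [← h']; push_cast; ring
          have htime : t - ((i + 1) / v + (k' - 1) / v) = s - (k' - 1) / v := by
            rw [← Nat.sub_sub, hs1]
          refine fin (v * ((i + 1) / v) + k') (by omega) (by rw [hdiv]; omega) ?_ (Or.inl ?_)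
          · rw [hdiv, htime]; exact lt_of_le_of_lt (Nat.sub_le _ _) h3
          · rw [hdiv, htime]
            push_cast at *
            omega
    -- The gap is gone at time `s + 1`, so at time `s` it is a single link by parity, and being
    -- inside it means standing at its left end.
    · refine fin (i + 2) (by omega) (by rw [e1]; exact h2) (by rw [e1, hs1]; exact h3) (Or.inl ?_)
      rw [e1, hs1]
      obtain ⟨w, hw⟩ := hS.odd j hj
      unfold Gap.life at hl h3
      unfold Gap.left Gap.right Gap.ext at *
      omega

/-- The ray is aimed at the middle link of `s`, which stays in `s` for its whole life; an integer
solution exists because `Y` is odd. `h2` says that the ray has had time to arrive, `h1` that it left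
before `s` closed. -/
theorem exists_seesLeft_of_center {v : ℕ} (hv : 1 ≤ v) {S : Set Gap} (hS : Separated S)
    {g s : Gap} (hg : g ∈ S) (hs : s ∈ S) (hsc : s.Closable v) (hlt : s.x < g.x) {t : ℕ}
    (ht : t ≤ g.T) {Y : ℕ} (hY : (Y : ℤ) = 2 * g.x - (2 * s.x + s.u))
    (h1 : 2 * (v + 1) * t + 2 * v < Y + 2 * v * s.life) (h2 : Y < 2 * (t + v * (t + 1)) + 1) :
    ∃ k, SeesLeft v (filled S) t (g.left t) k ∧ (k : ℤ) + ((k - 1) / v : ℕ) ≤ g.x - s.x := by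
  obtain ⟨w, hw⟩ := hS.odd s hs
  have hleft : g.left t = g.x - t := by unfold Gap.left; rw [Gap.ext_of_le ht]
  have hpos : 1 + 2 * t ≤ Y := by
    rcases Nat.lt_or_ge t s.life with hl | hl
    · have a := hS.right_lt_left hs hg hlt t
      have b := Gap.left_lt_right (hS.odd s hs) hl
      rw [hleft] at a
      unfold Gap.left Gap.right at *
      omega
    · have : v * s.life ≤ v * t := Nat.mul_le_mul_left _ hl
      nlinarith
  obtain ⟨k, hk⟩ : ∃ k : ℕ, 2 * k + 2 * t = Y + 1 := ⟨(Y + 1) / 2 - t, by omega⟩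
  have hk1 : 1 ≤ k := by omega
  have het : (k - 1) / v ≤ t := by
    have : (k - 1) / v < t + 1 := (Nat.div_lt_iff_lt_mul (by omega)).2 (by
      rw [Nat.mul_comm]; omega)
    omega
  have hlife : t - (k - 1) / v < s.life := by
    rcases Nat.lt_or_ge t s.life with hl | hl
    · exact lt_of_le_of_lt (Nat.sub_le _ _) hl
    · have : t - s.life + 1 ≤ (k - 1) / v := (Nat.le_div_iff_mul_le (by omega)).2 (by
        obtain ⟨d, rfl⟩ : ∃ d, t = s.life + d := ⟨t - s.life, by omega⟩
        rw [Nat.add_sub_cancel_left]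
        have : 2 * ((d + 1) * v) ≤ 2 * (k - 1) + 1 := by
          have e : 2 * (k - 1) + 1 = 2 * k - 1 := by omega
          rw [e]
          have e2 : 2 * (v + 1) * (s.life + d) + 2 * v =
            2 * (s.life + d) + 2 * v * s.life + 2 * ((d + 1) * v) := by ring
          omega
        omega)
      omega
  obtain ⟨k', hk', hle⟩ := exists_seesLeft hv hS hs hsc (t := t) (p := g.left t)
    (fun _ => hS.right_lt_left hs hg hlt t) ⟨k, hk1, het, hlife, by
      unfold Gap.life at hlife
      rw [hleft]
      unfold Gap.left Gap.ext
      omega, by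
      unfold Gap.life at hlife
      rw [hleft]
      unfold Gap.right Gap.ext
      omega⟩
  exact ⟨k', hk', by rw [hleft] at hle; omega⟩

/-- In other words `k - (k - 1) / v` is monotone: one more unit of value costs at most one unit of
time. -/
theorem add_div_le_add_div {v k k' : ℕ} (hv : 1 ≤ v) (h : k' ≤ k) :
    k' + (k - 1) / v ≤ k + (k' - 1) / v := by
  have h1 : (k - 1) / v ≤ (k' - 1 + v * (k - k')) / v := Nat.div_le_div_right (by
    have : k - k' ≤ v * (k - k') := Nat.le_mul_of_pos_left _ (by omega)
    omega)
  rw [Nat.add_mul_div_left _ _ (by omega)] at h1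
  omega

/-- The ends of the gaps to the right of `g` are not seen to the left of the left end of `g`. -/
theorem Separated.left_of_seesLeft {v : ℕ} {S : Set Gap} (hS : Separated S) {g : Gap}
    (hg : g ∈ S) {t k : ℕ} (ht : t < g.life) (h : SeesLeft v (filled S) t (g.left t) k) :
    ∃ j ∈ S, j.x < g.x ∧ t - (k - 1) / v < j.life ∧
      (g.left t - k = j.left (t - (k - 1) / v) ∨ g.left t - k = j.right (t - (k - 1) / v)) := by
  obtain ⟨h1, h2, h3⟩ := h
  obtain ⟨j, hj, hl, hp⟩ := (lineAnyon_filled hS).1 h3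
  refine ⟨j, hj, ?_, hl, hp⟩
  have hdiv : (k - 1) / v ≤ k - 1 := Nat.div_le_self _ _
  generalize (k - 1) / v = e at *
  have hlr := Gap.left_lt_right (hS.odd g hg) ht
  have hlr' := Gap.left_lt_right (hS.odd g hg) (t := t - e) (by omega)
  have hlrj := Gap.left_lt_right (hS.odd j hj) hl
  rcases hS.at_time hg hj (t - e) with h | h | h
  · subst h
    unfold Gap.left Gap.right Gap.ext at *
    omega
  · have c1 : ∀ s, g.left s + g.right s = 2 * g.x + g.u := fun s => by
      unfold Gap.left Gap.right; ring
    have := c1 t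
    have := c1 (t - e)
    omega
  · by_contra hcon
    rcases eq_or_lt_of_le (not_lt.1 hcon) with hx | hx
    · rcases hS.sep g hg j hj with hs | hs | hs
      · subst hs; omega
      · omega
      · omega
    · have := hS.right_lt_left hg hj hx (t - e)
      omega

/-- Until its middle phase ends, the distance to the right end of `j` shrinks at most as fast as the
ray goes back in time. By `add_div_le_add_div` it suffices to compare at the longest ray `k₀`. -/
theorem not_seesLeft_far {v : ℕ} {g j : Gap} {A k₀ e₀ t k : ℕ} (hv : 1 ≤ v)
    (he₀ : e₀ = (k₀ - 1) / v) (hA : 2 * g.T + k₀ < A + e₀) (hk : k ≤ k₀) (hT : g.T ≤ t)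
    (het : (k - 1) / v ≤ t) (hfar : j.x + j.u + A ≤ g.x)
    (hp : g.left t - k ≤ j.right (t - (k - 1) / v)) : False := by
  have := add_div_le_add_div hv hk
  rw [← he₀] at this
  generalize (k - 1) / v = e at *
  unfold Gap.left Gap.right Gap.ext at hp
  omega

/-- Every message of `j` leaves before time `D`. The bound `hTY` makes the last of them pass the
left end of `g` by time `g.T`, after which that end moves away from `j`. -/
theorem not_seesLeft_near {v : ℕ} (hv : 1 ≤ v) {g j : Gap} (hu : Odd j.u) {Y D t k : ℕ}
    (hk1 : 1 ≤ k) (hT : g.T ≤ t) (het : (k - 1) / v ≤ t) (hD : j.life ≤ D)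
    (hY : 2 * g.x - (2 * j.x + j.u) ≤ Y) (hTY : Y + 2 * v * D ≤ 2 * (v + 1) * g.T + 2 * v)
    (hl : t - (k - 1) / v < j.life)
    (hp : g.left t - k = j.left (t - (k - 1) / v) ∨ g.left t - k = j.right (t - (k - 1) / v)) :
    False := by
  have hmul : v * ((k - 1) / v) ≤ k - 1 := Nat.mul_div_le _ _
  have hlr := Gap.left_lt_right hu hl
  generalize (k - 1) / v = e at *
  obtain ⟨w, hw⟩ := hu
  obtain ⟨r, rfl⟩ : ∃ r, t = g.T + r := ⟨t - g.T, by omega⟩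
  obtain ⟨d, hd⟩ : ∃ d, D = g.T + r - e + 1 + d := ⟨D - (g.T + r - e) - 1, by omega⟩
  have hpos : (Y : ℤ) + 2 * (d + 1) ≥ 2 * g.T - 2 * r + 2 * k + 1 := by
    unfold Gap.life at hl hD
    unfold Gap.left Gap.right Gap.ext at *
    omega
  obtain ⟨f, hf⟩ : ∃ f, g.T + r = e + f := ⟨g.T + r - e, by omega⟩
  have hD2 : D = f + 1 + d := by omega
  subst hD2
  zify at *
  have hk2 : (v : ℤ) * e + 1 ≤ k := by
    have : ((k - 1 : ℕ) : ℤ) = k - 1 := by omega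
    linarith
  have hTe : (g.T : ℤ) = e + f - r := by linarith
  rw [hTe] at hTY hpos
  nlinarith [mul_nonneg (Int.natCast_nonneg v) (Int.natCast_nonneg r),
    mul_nonneg (Int.natCast_nonneg v) (Int.natCast_nonneg d),
    mul_nonneg (show (0 : ℤ) ≤ v - 1 by linarith) (Int.natCast_nonneg d),
    mul_nonneg (show (0 : ℤ) ≤ v - 1 by linarith) (Int.natCast_nonneg r)]

/-- The criterion for a gap whose left end is guided by two smaller gaps. -/
theorem leftGood_of_subgaps {v : ℕ} (hv : 3 ≤ v) {S : Set Gap} (hS : Separated S)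
    (hcl : ∀ g ∈ S, g.Closable v)
    (hdense : ∀ y : ℤ, ∃ j ∈ S, j.x ≤ y + 2 ∧ y < j.x + j.u) {g s₁ s₂ : Gap} (hg : g ∈ S)
    (hs₁ : s₁ ∈ S) (hs₂ : s₂ ∈ S) {k₀ e₀ D Y₁ Y₂ A : ℕ} (he₀ : e₀ = (k₀ - 1) / v)
    (hk₀ : k₀ + e₀ = g.u + 2 * g.T) (he₀T : e₀ ≤ g.T) (hx₁ : s₁.x < g.x) (hx₂ : s₂.x < g.x)
    (hY₁ : (Y₁ : ℤ) = 2 * g.x - (2 * s₁.x + s₁.u)) (hY₂ : (Y₂ : ℤ) = 2 * g.x - (2 * s₂.x + s₂.u))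
    (hD₁ : s₁.life = D) (hD₂ : s₂.life = D) (hT : Y₂ + 2 * v * D ≤ 2 * (v + 1) * g.T + 2 * v)
    (hT' : ∀ t < g.T, 2 * (v + 1) * t + 2 * v < Y₂ + 2 * v * D)
    (h1 : ∀ t < g.T, g.u ≤ (v - 1) * t + v →
      Y₁ < 2 * (t + v * (t + 1)) + 1 ∧ g.x - s₁.x < g.u + 2 * t)
    (h2 : ∀ t < g.T, Y₁ + 2 * v * D ≤ 2 * (v + 1) * t + 2 * v →
      Y₂ < 2 * (t + v * (t + 1)) + 1 ∧ g.x - s₂.x < g.u + 2 * t)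
    (hcls : ∀ j ∈ S, j.x < g.x → j.life + e₀ ≤ g.T ∨
      (j.life ≤ D ∧ 2 * g.x - (2 * j.x + j.u) ≤ Y₂) ∨ j.x + j.u + A ≤ g.x)
    (hA : 2 * g.T + k₀ < A + e₀) : LeftGood v S g := by
  constructor
  · intro t ht
    -- Three phases: while the opposite end cannot yet be heard, any message from the left will do;
    -- then `s₁` guides the end; once its last message has passed, `s₂` does.
    by_cases c1 : g.u ≤ (v - 1) * t + v
    · by_cases c2 : Y₁ + 2 * v * D ≤ 2 * (v + 1) * t + 2 * v
      · obtain ⟨a, b⟩ := h2 t ht c2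
        obtain ⟨k, hk, hle⟩ := exists_seesLeft_of_center (by omega) hS hg hs₂ (hcl _ hs₂) hx₂
          ht.le hY₂ (by rw [hD₂]; exact hT' t ht) a
        exact ⟨k, hk, by omega⟩
      · obtain ⟨a, b⟩ := h1 t ht c1
        obtain ⟨k, hk, hle⟩ := exists_seesLeft_of_center (by omega) hS hg hs₁ (hcl _ hs₁) hx₁
          ht.le hY₁ (by rw [hD₁]; omega) a
        exact ⟨k, hk, by omega⟩
    · have hleft : g.left t = g.x - t := by unfold Gap.left; rw [Gap.ext_of_le ht.le]
      obtain ⟨j, hj, hj1, hj2⟩ := hdense (g.left t - (v * t + 3 : ℕ))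
      obtain ⟨w, hw⟩ := hS.odd j hj
      have hjlt : j.x < g.x := by push_cast at hj1; nlinarith
      -- The values `v * t + 1 + i` with `i < 3` all look at time zero, because `v ≥ 3`. Three
      -- consecutive links of the initial state meet a gap.
      obtain ⟨i, hi, hi1, hi2⟩ : ∃ i : ℕ, i < 3 ∧ j.x ≤ g.left t - (v * t + 1 + i : ℕ) ∧
          g.left t - (v * t + 1 + i : ℕ) < j.x + j.u := by
        push_cast at *
        generalize (v : ℤ) * t = q at *
        rcases le_or_gt j.x (g.left t - (q + 1 + 2)) with c | c
        · exact ⟨2, by omega, by push_cast; omega, by push_cast; omega⟩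
        · rcases le_or_gt j.x (g.left t - (q + 1 + 1)) with c' | c'
          · exact ⟨1, by omega, by push_cast; omega, by push_cast; omega⟩
          · exact ⟨0, by omega, by push_cast; omega, by push_cast; omega⟩
      have hdiv : (v * t + 1 + i - 1) / v = t := by
        rw [show v * t + 1 + i - 1 = v * t + i by omega, Nat.mul_add_div (by omega),
          Nat.div_eq_of_lt (by omega), Nat.add_zero]
      obtain ⟨k, hk, -⟩ := exists_seesLeft (by omega) hS hj (hcl j hj) (t := t) (p := g.left t)
        (fun _ => hS.right_lt_left hj hg hjlt t) ⟨v * t + 1 + i, by omega, by rw [hdiv], by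
          rw [hdiv]; unfold Gap.life; omega, by
          rw [hdiv]; unfold Gap.left Gap.ext; omega, by
          rw [hdiv]; unfold Gap.right Gap.ext; omega⟩
      refine ⟨k, hk, ?_⟩
      have h3 : k ≤ v * (t + 1) := by
        have : k - 1 < v * (t + 1) := by
          have := (Nat.div_lt_iff_lt_mul (show 0 < v by omega)).1 (Nat.lt_succ_of_le hk.2.1)
          rwa [Nat.mul_comm] at this
        omega
      have h4 := hk.2.1
      obtain ⟨z, rfl⟩ : ∃ z, v = z + 1 := ⟨v - 1, by omega⟩
      simp only [Nat.add_sub_cancel] at c1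
      nlinarith
  · refine ⟨k₀, by omega, by omega, ?_⟩
    intro t hTt ht k hk hsee
    obtain ⟨j, hj, hjlt, hl, hp⟩ := hS.left_of_seesLeft hg ht hsee
    have het := hsee.2.1
    rcases hcls j hj hjlt with h | ⟨h, h'⟩ | h
    · have : (k - 1) / v ≤ e₀ := by rw [he₀]; exact Nat.div_le_div_right (by omega)
      omega
    · exact not_seesLeft_near (by omega) (hS.odd j hj) hsee.1 hTt het h h' hT hl hp
    · have := Gap.left_lt_right (hS.odd j hj) hl
      exact not_seesLeft_far (by omega) he₀ hA hk hTt het h (by omega)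

/-- The criterion for a gap whose left end is next to a row of gaps of width one. -/
theorem leftGood_of_foam {v : ℕ} (hv : 3 ≤ v) {S : Set Gap} (hS : Separated S) {g : Gap}
    (hg : g ∈ S) (hu : g.u = (v - 1) * g.T + 1) (h3 : 3 ∣ g.T) {A : ℕ}
    (hfoam : ∀ i : ℕ, 3 * i + 3 ≤ A → (⟨g.x - (3 * i + 3), 1, 0⟩ : Gap) ∈ S)
    (hcls : ∀ j ∈ S, j.x < g.x → (j.u = 1 ∧ j.T = 0 ∧ (3 : ℤ) ∣ g.x - j.x) ∨
      j.x + j.u + A ≤ g.x)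
    (hA : (v + 1) * g.T + 1 < A) : LeftGood v S g := by
  obtain ⟨z, rfl⟩ : ∃ z, v = z + 1 := ⟨v - 1, by omega⟩
  simp only [Nat.add_sub_cancel] at hu
  constructor
  · intro t ht
    have hleft : g.left t = g.x - t := by unfold Gap.left; rw [Gap.ext_of_le ht.le]
    -- The initial anyons of the foam are at distances congruent to 0 or 2 modulo 3 from `g.x`. One
    -- of two consecutive distances is therefore occupied.
    obtain ⟨i, hi1, hi2, n, hn⟩ : ∃ i, 1 ≤ i ∧ i ≤ 2 ∧ ∃ n, (z + 2) * t + i = 3 * n + 2 ∨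
        (z + 2) * t + i = 3 * n + 3 := by
      generalize (z + 2) * t = q
      rcases (show q % 3 = 0 ∨ q % 3 = 1 ∨ q % 3 = 2 by omega) with h | h | h
      · exact ⟨2, by omega, by omega, q / 3, by omega⟩
      · exact ⟨1, by omega, by omega, q / 3, by omega⟩
      · exact ⟨1, by omega, by omega, q / 3, by omega⟩
    have hle : (z + 2) * t + (z + 2) ≤ (z + 2) * g.T := by
      rw [← Nat.mul_succ]; exact Nat.mul_le_mul_left _ ht
    have hmem := hfoam n (by
      have : (z + 1 + 1) * g.T = (z + 2) * g.T := rfl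
      omega)
    have hdiv : ((z + 1) * t + i - 1) / (z + 1) = t := by
      rw [Nat.add_sub_assoc hi1, Nat.mul_add_div (by omega),
        Nat.div_eq_of_lt (by omega), Nat.add_zero]
    refine ⟨(z + 1) * t + i, ⟨by omega, by rw [hdiv], ?_⟩, ?_⟩
    · rw [hdiv, lineAnyon_filled hS]
      refine ⟨_, hmem, by unfold Gap.life; simp, ?_⟩
      have hq : ((z + 2) * t : ℤ) + i = 3 * n + 2 ∨ ((z + 2) * t : ℤ) + i = 3 * n + 3 := by
        exact_mod_cast hn
      have hq2 : (((z + 1) * t + i : ℕ) : ℤ) = (z + 2) * t + i - t := by push_cast; ring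
      rw [hleft, hq2]
      unfold Gap.left Gap.right Gap.ext
      simp only [Nat.sub_self, Nat.cast_zero, Nat.cast_one]
      rcases hq with hq | hq
      · right; simp; linarith
      · left; simp; linarith
    · rw [hdiv, hu]
      have : z * t + z ≤ z * g.T := by
        rw [← Nat.mul_succ]; exact Nat.mul_le_mul_left _ ht
      have e : (z + 1) * t = z * t + t := by ring
      omega
  · have hdiv : ((z + 1) * g.T + 1 - 1) / (z + 1) = g.T := by
      rw [Nat.add_sub_cancel, Nat.mul_div_cancel_left _ (by omega)]
    -- This ray reaches back exactly to time zero when it leaves at time `g.T`. Since the foam lives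
    -- for one step only, it is the only ray that could still meet it.
    refine ⟨(z + 1) * g.T + 1, by rw [hdiv, hu]; ring, by rw [hdiv], ?_⟩
    intro t hTt ht k hk hsee
    obtain ⟨j, hj, hjlt, hl, hp⟩ := hS.left_of_seesLeft hg ht hsee
    have het := hsee.2.1
    rcases hcls j hj hjlt with ⟨h1, h2, h4⟩ | h
    · have hle : (k - 1) / (z + 1) ≤ g.T := by
        rw [← hdiv]; exact Nat.div_le_div_right (by omega)
      have hlife : j.life = 1 := by unfold Gap.life; rw [h1, h2]
      rw [hlife] at hl
      have htT : t = g.T := by omega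
      have hkT : (k - 1) / (z + 1) = g.T := by omega
      have hk2 : k = (z + 1) * g.T + 1 := by
        have := Nat.mul_div_le (k - 1) (z + 1)
        rw [hkT] at this
        have := hsee.1
        omega
      rw [htT, hkT, Nat.sub_self] at hp
      have hleft : g.left g.T = g.x - g.T := by unfold Gap.left; rw [Gap.ext_of_le le_rfl]
      have hj0 : j.ext 0 = 0 := Gap.ext_of_le (by omega)
      unfold Gap.right at hp
      unfold Gap.left at hp hleft
      rw [hleft, hj0, h1, hk2] at hp
      obtain ⟨m, hm⟩ := h3
      obtain ⟨n, hn⟩ := h4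
      rw [hm] at hp
      push_cast at hp
      -- At the critical time the ray has length congruent to 1 modulo 3 from `g.x`, since `3 ∣
      -- g.T`: precisely the residue that carries no anyon.
      have : (3 : ℤ) ∣ 1 ∨ (3 : ℤ) ∣ 2 := by
        rcases hp with hp | hp
        · left; exact ⟨n - m - (z + 1) * m, by linarith⟩
        · right; exact ⟨n - m - (z + 1) * m, by linarith⟩
      omega
    · have := Gap.left_lt_right (hS.odd j hj) hl
      refine not_seesLeft_far (by omega) hdiv.symm ?_ hk hTt het h (by omega)
      have : (z + 1 + 1) * g.T = (z + 1) * g.T + g.T := by ring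
      omega

/-- Such a gap lives for one step and sees its other end with value one, so only an anyon on the
adjacent site could compete. -/
theorem leftGood_of_small {v : ℕ} {S : Set Gap} (hS : Separated S) {g : Gap}
    (hg : g ∈ S) (hu : g.u = 1) (hT : g.T = 0) (hsep : ∀ j ∈ S, j.x < g.x → j.x + j.u + 2 ≤ g.x) :
    LeftGood v S g := by
  constructor
  · intro t ht; omega
  · refine ⟨1, by simp [hu, hT], by simp, ?_⟩
    intro t _ ht k hk hsee
    obtain ⟨j, hj, hjlt, hl, hp⟩ := hS.left_of_seesLeft hg ht hsee
    have := hsep j hj hjlt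
    have hk1 := hsee.1
    have hkk : k = 1 := by omega
    subst hkk
    have ht0 : t = 0 := by unfold Gap.life at ht; omega
    subst ht0
    unfold Gap.left Gap.right Gap.ext at hp
    simp at hp
    omega

/-! ### Hierarchical patterns -/

/-- The dimensions of a hierarchical pattern: at level `n` there are short pieces of length `a n`
and long pieces of length `b n`, and the gaps between the pieces of level `n` inside a piece of
level `n + 1` have width `u n` and recede until time `T n`. -/
structure Scale where
  /-- lengths of the short pieces -/
  a : ℕ → ℕ
  /-- lengths of the long pieces -/
  b : ℕ → ℕ
  /-- widths of the gaps -/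
  u : ℕ → ℕ
  /-- times until which the ends of the gaps recede -/
  T : ℕ → ℕ

namespace Scale

/-- The length of a piece. -/
def len (c : Scale) (τ : Bool) (n : ℕ) : ℕ := if τ then c.b n else c.a n

@[simp] theorem len_true (c : Scale) (n : ℕ) : c.len true n = c.b n := rfl
@[simp] theorem len_false (c : Scale) (n : ℕ) : c.len false n = c.a n := rfl

/-- The piece of level `n` and type `τ` starting at `y` occurs in the pattern with short pieces of
level `N` starting at the sites `s i`. A short piece is `long, short, long`, and a long piece is
`long, short, long, short, long`. -/
inductive Piece (c : Scale) (N : ℕ) (s : ℤ → ℤ) : ℕ → Bool → ℤ → Prop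
  | top (i : ℤ) : Piece c N s N false (s i)
  | a₁ {n : ℕ} {y : ℤ} (hn : 1 ≤ n) (h : Piece c N s (n + 1) false y) : Piece c N s n true y
  | a₂ {n : ℕ} {y : ℤ} (hn : 1 ≤ n) (h : Piece c N s (n + 1) false y) :
      Piece c N s n false (y + c.b n + c.u n)
  | a₃ {n : ℕ} {y : ℤ} (hn : 1 ≤ n) (h : Piece c N s (n + 1) false y) :
      Piece c N s n true (y + c.b n + c.u n + c.a n + c.u n)
  | b₁ {n : ℕ} {y : ℤ} (hn : 1 ≤ n) (h : Piece c N s (n + 1) true y) : Piece c N s n true y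
  | b₂ {n : ℕ} {y : ℤ} (hn : 1 ≤ n) (h : Piece c N s (n + 1) true y) :
      Piece c N s n false (y + c.b n + c.u n)
  | b₃ {n : ℕ} {y : ℤ} (hn : 1 ≤ n) (h : Piece c N s (n + 1) true y) :
      Piece c N s n true (y + c.b n + c.u n + c.a n + c.u n)
  | b₄ {n : ℕ} {y : ℤ} (hn : 1 ≤ n) (h : Piece c N s (n + 1) true y) :
      Piece c N s n false (y + c.b n + c.u n + c.a n + c.u n + c.b n + c.u n)
  | b₅ {n : ℕ} {y : ℤ} (hn : 1 ≤ n) (h : Piece c N s (n + 1) true y) :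
      Piece c N s n true
        (y + c.b n + c.u n + c.a n + c.u n + c.b n + c.u n + c.a n + c.u n)

/-- The gaps of the pattern, by level. The pieces of level one consist of blocks of two filled
links separated by gaps of width one. -/
inductive GapAt (c : Scale) (N : ℕ) (s : ℤ → ℤ) : ℕ → Gap → Prop
  | top (i : ℤ) : GapAt c N s N ⟨s i + c.a N, (s (i + 1) - s i - c.a N).toNat, c.T N⟩
  | inner₁ {n : ℕ} {τ : Bool} {y : ℤ} (hn : 1 ≤ n) (h : c.Piece N s (n + 1) τ y) :
      GapAt c N s n ⟨y + c.b n, c.u n, c.T n⟩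
  | inner₂ {n : ℕ} {τ : Bool} {y : ℤ} (hn : 1 ≤ n) (h : c.Piece N s (n + 1) τ y) :
      GapAt c N s n ⟨y + c.b n + c.u n + c.a n, c.u n, c.T n⟩
  | inner₃ {n : ℕ} {y : ℤ} (hn : 1 ≤ n) (h : c.Piece N s (n + 1) true y) :
      GapAt c N s n ⟨y + c.b n + c.u n + c.a n + c.u n + c.b n, c.u n, c.T n⟩
  | inner₄ {n : ℕ} {y : ℤ} (hn : 1 ≤ n) (h : c.Piece N s (n + 1) true y) :
      GapAt c N s n
        ⟨y + c.b n + c.u n + c.a n + c.u n + c.b n + c.u n + c.a n, c.u n, c.T n⟩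
  | foam {τ : Bool} {y : ℤ} (i : ℕ) (hi : 3 * i + 3 ≤ c.len τ 1) (h : c.Piece N s 1 τ y) :
      GapAt c N s 0 ⟨y + 3 * i + 2, 1, 0⟩

/-- The set of all gaps of the pattern. -/
def gaps (c : Scale) (N : ℕ) (s : ℤ → ℤ) : Set Gap := {g | ∃ n, c.GapAt N s n g}

/-- The recursion for the lengths. -/
structure Recursive (c : Scale) : Prop where
  a_succ : ∀ n, 1 ≤ n → c.a (n + 1) = 2 * c.b n + c.a n + 2 * c.u n
  b_succ : ∀ n, 1 ≤ n → c.b (n + 1) = 3 * c.b n + 2 * c.a n + 4 * c.u n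
  a_le_b : ∀ n, 1 ≤ n → c.a n ≤ c.b n
  u_mono : ∀ n, 1 ≤ n → c.u n ≤ c.u (n + 1)
  u_pos : ∀ n, 1 ≤ n → 1 ≤ c.u n

/-- The pieces at the top are separated by gaps of width at least `u N`. -/
def Spaced (c : Scale) (N : ℕ) (s : ℤ → ℤ) : Prop := ∀ i, s i + c.a N + c.u N ≤ s (i + 1)

/-! ### Geometry of pieces and gaps -/

variable {c : Scale} {N : ℕ} {s : ℤ → ℤ}

theorem Piece.level {n : ℕ} {τ : Bool} {y : ℤ} (h : c.Piece N s n τ y) : n ≤ N := by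
  induction h <;> omega

theorem Recursive.a_le_len (hc : c.Recursive) {n : ℕ} (hn : 1 ≤ n) (τ : Bool) :
    c.a n ≤ c.len τ n := by
  cases τ
  · simp
  · simpa using hc.a_le_b n hn

theorem Piece.cases_parent (hc : c.Recursive) {n : ℕ} {τ : Bool} {y : ℤ}
    (h : c.Piece N s n τ y) : (n = N ∧ τ = false ∧ ∃ i, y = s i) ∨
      (1 ≤ n ∧ ∃ σ z, c.Piece N s (n + 1) σ z ∧ z ≤ y ∧ y + c.len τ n ≤ z + c.len σ (n + 1)) := by
  have h1 := hc.a_succ n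
  have h2 := hc.b_succ n
  cases h with
  | top i => exact Or.inl ⟨rfl, rfl, i, rfl⟩
  | a₁ hn h | a₂ hn h | a₃ hn h =>
    have h1 := hc.a_succ _ hn
    refine Or.inr ⟨hn, _, _, h, ?_⟩
    simp only [len_true, len_false]
    omega
  | b₁ hn h | b₂ hn h | b₃ hn h | b₄ hn h | b₅ hn h =>
    have h2 := hc.b_succ _ hn
    refine Or.inr ⟨hn, _, _, h, ?_⟩
    simp only [len_true, len_false]
    omega

theorem Spaced.lt (hs : c.Spaced N s) {i j : ℤ} (h : i < j) : s i + c.a N + c.u N ≤ s j := by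
  have h' : i + 1 ≤ j := h
  induction j, h' using Int.leInduction with
  | base => exact hs i
  | succ j hj ih =>
    have := ih (by omega)
    have := hs j
    omega

/-- Two pieces of the same level are equal or separated by at least one gap. -/
theorem Piece.disjoint (hc : c.Recursive) (hs : c.Spaced N s) {n : ℕ} (hn : 1 ≤ n) {τ τ' : Bool}
    {y y' : ℤ} (h : c.Piece N s n τ y) (h' : c.Piece N s n τ' y') :
    (y = y' ∧ τ = τ') ∨ y + c.len τ n + c.u n ≤ y' ∨ y' + c.len τ' n + c.u n ≤ y := by
  -- The induction descends from the top level, where disjointness is the spacing of the starting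
  -- points.
  obtain ⟨k, hk⟩ : ∃ k, N = n + k := ⟨N - n, by have := h.level; omega⟩
  induction k generalizing n τ τ' y y' with
  | zero =>
    have top : ∀ {τ y}, c.Piece N s n τ y → τ = false ∧ ∃ i, y = s i := by
      intro τ y h
      rcases h.cases_parent hc with h | ⟨-, σ, z, h, -⟩
      · exact h.2
      · have := h.level; omega
    obtain ⟨rfl, i, rfl⟩ := top h
    obtain ⟨rfl, j, rfl⟩ := top h'
    have : n = N := by omega
    subst this
    rcases lt_trichotomy i j with hij | rfl | hij
    · exact Or.inr (Or.inl (hs.lt hij))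
    · exact Or.inl ⟨rfl, rfl⟩
    · exact Or.inr (Or.inr (hs.lt hij))
  | succ k ih =>
    have hne : n ≠ N := by omega
    have hu := hc.u_mono n hn
    rcases h.cases_parent hc with ⟨e, -⟩ | ⟨-, σ, z, p, l1, l2⟩
    · exact absurd e hne
    rcases h'.cases_parent hc with ⟨e, -⟩ | ⟨-, σ', z', p', l1', l2'⟩
    · exact absurd e hne
    have h1 := hc.a_succ n hn
    have h2 := hc.b_succ n hn
    have key : ∀ {σ σ' z z'}, c.Piece N s (n + 1) σ z → c.Piece N s (n + 1) σ' z' →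
      (z = z' ∧ σ = σ') ∨ z + c.len σ (n + 1) + c.u (n + 1) ≤ z' ∨
        z' + c.len σ' (n + 1) + c.u (n + 1) ≤ z := fun p p' => ih (by omega) p p' (by omega)
    clear ih p p' l1 l2 l1' l2'
    -- What remains is linear arithmetic for each pair of children: either they share the parent, or
    -- their parents are separated by a gap that is at least as wide.
    cases h with
    | top i => exact absurd rfl hne
    | a₁ _ p | a₂ _ p | a₃ _ p | b₁ _ p | b₂ _ p | b₃ _ p | b₄ _ p | b₅ _ p =>
      cases h' with
      | top i => exact absurd rfl hne
      | a₁ _ p' | a₂ _ p' | a₃ _ p' | b₁ _ p' | b₂ _ p' | b₃ _ p' | b₄ _ p' | b₅ _ p' =>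
        have := key p p'
        simp only [len_true, len_false, reduceCtorEq, and_false, and_true, false_or] at *
        omega

end Scale

namespace Scale

variable {c : Scale} {N : ℕ} {s : ℤ → ℤ}

theorem Spaced.le (hs : c.Spaced N s) {i j : ℤ} (h : i ≤ j) : s i ≤ s j := by
  rcases eq_or_lt_of_le h with rfl | h
  · rfl
  · have := hs.lt h; omega

theorem Spaced.toNat (hs : c.Spaced N s) (i : ℤ) :
    ((s (i + 1) - s i - c.a N).toNat : ℤ) = s (i + 1) - s i - c.a N :=
  Int.toNat_of_nonneg (by have := hs i; omega)

/-- A piece contains no gap of its own level or above. -/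
theorem GapAt.off_piece (hc : c.Recursive) (hs : c.Spaced N s) {n n' : ℕ} (hn : 1 ≤ n)
    (hnn' : n ≤ n') {τ : Bool} {y : ℤ} {g : Gap} (h : c.Piece N s n τ y) (hg : c.GapAt N s n' g) :
    g.x + g.u ≤ y ∨ y + c.len τ n ≤ g.x := by
  obtain ⟨k, hk⟩ : ∃ k, N = n + k := ⟨N - n, by have := h.level; omega⟩
  induction k generalizing n τ y with
  | zero =>
    rcases h.cases_parent hc with ⟨-, rfl, i, rfl⟩ | ⟨-, σ, z, h, -⟩
    · cases hg with
      | top j =>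
        have := hs.toNat j
        have : n = N := by omega
        subst this
        rcases lt_trichotomy i j with hij | rfl | hij
        · have := hs.lt hij
          right; simp only [len_false]; omega
        · right; simp only [len_false]; omega
        · have := hs.le (show j + 1 ≤ i by omega)
          left; simp only; omega
      | inner₁ hn p | inner₂ hn p | inner₃ hn p | inner₄ hn p => have := p.level; omega
      | foam => omega
    · have := h.level; omega
  | succ k ih =>
    have hne : n ≠ N := by omega
    rcases Nat.eq_or_lt_of_le hnn' with rfl | hlt
    · have h1 := hc.a_succ n hn
      have h2 := hc.b_succ n hn
      have hd : ∀ {σ σ' z z'}, c.Piece N s (n + 1) σ z → c.Piece N s (n + 1) σ' z' →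
        (z = z' ∧ σ = σ') ∨ z + c.len σ (n + 1) + c.u (n + 1) ≤ z' ∨
          z' + c.len σ' (n + 1) + c.u (n + 1) ≤ z := fun p p' => p.disjoint hc hs (by omega) p'
      clear ih
      cases h with
      | top i => exact absurd rfl hne
      | a₁ _ p | a₂ _ p | a₃ _ p | b₁ _ p | b₂ _ p | b₃ _ p | b₄ _ p | b₅ _ p =>
        cases hg with
        | top i => exact absurd rfl hne
        | @inner₁ _ τ _ _ p' | @inner₂ _ τ _ _ p' =>
          have := hd p p'
          cases τ <;>
          · simp only [len_true, len_false, reduceCtorEq, and_false, and_true, false_or] at *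
            omega
        | inner₃ _ p' | inner₄ _ p' =>
          have := hd p p'
          simp only [len_true, len_false, reduceCtorEq, and_false, and_true, false_or] at *
          omega
        | foam => omega
    · rcases h.cases_parent hc with ⟨e, -⟩ | ⟨-, σ, z, p, l1, l2⟩
      · exact absurd e hne
      · rcases ih (by omega) (show n + 1 ≤ n' from hlt) p (by omega) with h | h <;> omega

theorem GapAt.level {n : ℕ} {g : Gap} (h : c.GapAt N s n g) : n ≤ N := by
  cases h with
  | top => exact le_rfl
  | inner₁ _ p | inner₂ _ p | inner₃ _ p | inner₄ _ p => have := p.level; omega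
  | foam => exact Nat.zero_le _

theorem GapAt.width {n : ℕ} {g : Gap} (hn : 1 ≤ n) (h : c.GapAt N s n g) :
    g.T = c.T n ∧ ((n < N ∧ g.u = c.u n) ∨
      (n = N ∧ ∃ i, g.u = (s (i + 1) - s i - c.a N).toNat)) := by
  cases h with
  | top i => exact ⟨rfl, Or.inr ⟨rfl, i, rfl⟩⟩
  | inner₁ _ p | inner₂ _ p | inner₃ _ p | inner₄ _ p =>
    have := p.level; exact ⟨rfl, Or.inl ⟨by omega, rfl⟩⟩
  | foam => omega

theorem GapAt.u_le (hs : c.Spaced N s) {n : ℕ} {g : Gap} (hn : 1 ≤ n) (h : c.GapAt N s n g) :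
    c.u n ≤ g.u := by
  rcases (h.width hn).2 with ⟨-, h⟩ | ⟨rfl, i, h⟩
  · exact h.ge
  · have := hs.toNat i; have := hs i; omega

theorem GapAt.left_piece {n : ℕ} {g : Gap} (hn : 1 ≤ n) (h : c.GapAt N s n g) :
    ∃ τ y, c.Piece N s n τ y ∧ y + c.len τ n = g.x := by
  cases h with
  | top i => exact ⟨_, _, Piece.top i, rfl⟩
  | @inner₁ _ τ _ _ p =>
    cases τ
    · exact ⟨_, _, Piece.a₁ hn p, rfl⟩
    · exact ⟨_, _, Piece.b₁ hn p, rfl⟩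
  | @inner₂ _ τ _ _ p =>
    cases τ
    · exact ⟨_, _, Piece.a₂ hn p, rfl⟩
    · exact ⟨_, _, Piece.b₂ hn p, rfl⟩
  | inner₃ _ p => exact ⟨_, _, Piece.b₃ hn p, rfl⟩
  | inner₄ _ p => exact ⟨_, _, Piece.b₄ hn p, rfl⟩
  | foam => omega

theorem GapAt.right_piece (hs : c.Spaced N s) {n : ℕ} {g : Gap} (hn : 1 ≤ n)
    (h : c.GapAt N s n g) : ∃ τ, c.Piece N s n τ (g.x + g.u) := by
  cases h with
  | top i =>
    have := hs.toNat i
    refine ⟨false, ?_⟩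
    convert Piece.top (i + 1) using 1
    simp only; omega
  | @inner₁ _ τ _ _ p =>
    cases τ
    · exact ⟨_, Piece.a₂ hn p⟩
    · exact ⟨_, Piece.b₂ hn p⟩
  | @inner₂ _ τ _ _ p =>
    cases τ
    · exact ⟨_, Piece.a₃ hn p⟩
    · exact ⟨_, Piece.b₃ hn p⟩
  | inner₃ _ p => exact ⟨_, Piece.b₄ hn p⟩
  | inner₄ _ p => exact ⟨_, Piece.b₅ hn p⟩
  | foam => omega

/-- Every piece is followed by a gap. -/
theorem Piece.next_gap (hc : c.Recursive) {n : ℕ} {τ : Bool} {y : ℤ} (hn : 1 ≤ n)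
    (h : c.Piece N s n τ y) : ∃ m, n ≤ m ∧ ∃ g, c.GapAt N s m g ∧ g.x = y + c.len τ n := by
  induction h with
  | top i => exact ⟨N, le_rfl, _, GapAt.top i, rfl⟩
  | a₁ hn p _ => exact ⟨_, le_rfl, _, GapAt.inner₁ hn p, rfl⟩
  | a₂ hn p _ => exact ⟨_, le_rfl, _, GapAt.inner₂ hn p, rfl⟩
  | b₁ hn p _ => exact ⟨_, le_rfl, _, GapAt.inner₁ hn p, rfl⟩
  | b₂ hn p _ => exact ⟨_, le_rfl, _, GapAt.inner₂ hn p, rfl⟩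
  | b₃ hn p _ => exact ⟨_, le_rfl, _, GapAt.inner₃ hn p, rfl⟩
  | b₄ hn p _ => exact ⟨_, le_rfl, _, GapAt.inner₄ hn p, rfl⟩
  | a₃ hn p ih | b₅ hn p ih =>
    obtain ⟨m, hm, g, hg, hx⟩ := ih (by omega)
    have h1 := hc.a_succ _ hn
    have h2 := hc.b_succ _ hn
    refine ⟨m, by omega, g, hg, ?_⟩
    simp only [len_true, len_false] at *
    omega

/-- The last two gaps in a piece. -/
theorem Piece.last_gaps (hc : c.Recursive) {n : ℕ} {τ : Bool} {y x : ℤ} (hn : 1 ≤ n)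
    (h : c.Piece N s (n + 1) τ y) (hx : y + c.len τ (n + 1) = x) :
    c.GapAt N s n ⟨x - c.b n - c.u n, c.u n, c.T n⟩ ∧
      c.GapAt N s n ⟨x - c.b n - c.u n - c.a n - c.u n, c.u n, c.T n⟩ := by
  have h1 := hc.a_succ _ hn
  have h2 := hc.b_succ _ hn
  cases τ
  · rw [len_false] at hx
    constructor
    · convert GapAt.inner₂ hn h using 2; omega
    · convert GapAt.inner₁ hn h using 2; omega
  · rw [len_true] at hx
    constructor
    · convert GapAt.inner₄ hn h using 2; omega
    · convert GapAt.inner₃ hn h using 2; omega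

/-- The gaps one level below a piece and to the left of its end. -/
theorem GapAt.below (hc : c.Recursive) (hs : c.Spaced N s) {n : ℕ} {τ : Bool} {y x : ℤ}
    (hn : 1 ≤ n) (h : c.Piece N s (n + 1) τ y) (hx : y + c.len τ (n + 1) = x) {j : Gap}
    (hj : c.GapAt N s n j) (hlt : j.x < x) : j.x = x - c.b n - c.u n ∨
      j.x = x - c.b n - c.u n - c.a n - c.u n ∨ j.x + j.u + c.a (n + 1) ≤ x := by
  have h1 := hc.a_succ _ hn
  have h2 := hc.b_succ _ hn
  have hl := h.level
  cases hj with
  | top i => omega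
  | foam => omega
  | @inner₁ _ σ z _ p | @inner₂ _ σ z _ p =>
    have := h.disjoint hc hs (by omega) p
    cases τ <;> cases σ <;>
    · simp only [len_true, len_false, reduceCtorEq, and_false, and_true, false_or] at *
      omega
  | inner₃ _ p | inner₄ _ p =>
    have := h.disjoint hc hs (by omega) p
    cases τ <;>
    · simp only [len_true, len_false, reduceCtorEq, and_false, and_true, false_or] at *
      omega

/-- Distinct gaps are separated by a piece of the lower of their levels. -/
theorem GapAt.separated (hc : c.Recursive) (hs : c.Spaced N s) {n n' : ℕ} (hn : 1 ≤ n)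
    (hnn' : n ≤ n') {g g' : Gap} (hg : c.GapAt N s n g) (hg' : c.GapAt N s n' g') :
    g = g' ∨ g.x + g.u + c.a n ≤ g'.x ∨ g'.x + g'.u + c.a n ≤ g.x := by
  -- The gap `g'` avoids the two pieces of level `n` adjacent to `g`. So it is beyond one of them or
  -- inside `g`. For a higher level the second case is impossible, since `g'` also avoids the parent
  -- piece around `g`.
  have nested : ∀ {n n'} {g g' : Gap}, 1 ≤ n → n ≤ n' → c.GapAt N s n g → c.GapAt N s n' g' →
      (g.x + g.u + c.a n ≤ g'.x ∨ g'.x + g'.u + c.a n ≤ g.x) ∨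
        (g.x ≤ g'.x ∧ g'.x + g'.u ≤ g.x + g.u) := by
    intro n n' g g' hn hnn' hg hg'
    obtain ⟨τ, y, p, hy⟩ := hg.left_piece hn
    obtain ⟨τ', p'⟩ := hg.right_piece hs hn
    have l1 := hc.a_le_len hn τ
    have l2 := hc.a_le_len hn τ'
    have o1 := GapAt.off_piece hc hs hn hnn' p hg'
    have o2 := GapAt.off_piece hc hs hn hnn' p' hg'
    omega
  rcases Nat.eq_or_lt_of_le hnn' with rfl | hlt
  · have a1 := nested hn le_rfl hg hg'
    have a2 := nested hn le_rfl hg' hg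
    by_cases hx : g.x = g'.x ∧ g.u = g'.u
    · left
      have t1 := (hg.width hn).1
      have t2 := (hg'.width hn).1
      obtain ⟨x, u, T⟩ := g
      obtain ⟨x', u', T'⟩ := g'
      simp only at *
      rw [hx.1, hx.2, t1, t2]
    · right; omega
  · rcases nested hn hnn' hg hg' with h | h
    · exact Or.inr h
    · exfalso
      have hu' := hg'.u_le hs (by omega)
      have hpos := hc.u_pos n' (by omega)
      have hl' := hg'.level
      have h1 := hc.a_succ _ hn
      have h2 := hc.b_succ _ hn
      cases hg with
      | top i => omega
      | foam => omega
      | @inner₁ _ σ z _ p | @inner₂ _ σ z _ p =>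
        have := GapAt.off_piece hc hs (by omega) (show n + 1 ≤ n' from hlt) p hg'
        cases σ <;>
        · simp only [len_true, len_false] at *
          omega
      | inner₃ _ p | inner₄ _ p =>
        have := GapAt.off_piece hc hs (by omega) (show n + 1 ≤ n' from hlt) p hg'
        simp only [len_true] at *
        omega

/-- The gaps of width one are at distance at least two from all other gaps. -/
theorem GapAt.separated_foam (hc : c.Recursive) (hs : c.Spaced N s) {n' : ℕ} {g g' : Gap}
    (hlen : ∀ τ, c.len τ 1 % 3 = 2)
    (hg : c.GapAt N s 0 g) (hg' : c.GapAt N s n' g') (hN : 1 ≤ N) :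
    g = g' ∨ g.x + g.u + 2 ≤ g'.x ∨ g'.x + g'.u + 2 ≤ g.x := by
  cases hg with
  | top => omega
  | inner₁ hn | inner₂ hn | inner₃ hn | inner₄ hn => omega
  | @foam τ y i hi p =>
    have l1 := hlen τ
    rcases Nat.eq_zero_or_pos n' with rfl | hn'
    · cases hg' with
      | top => omega
      | inner₁ hn | inner₂ hn | inner₃ hn | inner₄ hn => omega
      | @foam τ' y' i' hi' p' =>
        have l2 := hlen τ'
        have := p.disjoint hc hs le_rfl p'
        rcases this with ⟨rfl, rfl⟩ | h | h
        · rcases lt_trichotomy i i' with h | rfl | h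
          · right; left; simp only; push_cast; omega
          · left; rfl
          · right; right; simp only; push_cast; omega
        · right; left; simp only; push_cast; omega
        · right; right; simp only; push_cast; omega
    · have := GapAt.off_piece hc hs le_rfl hn' p hg'
      simp only; push_cast; omega

end Scale

namespace Scale

variable {c : Scale} {N : ℕ} {s : ℤ → ℤ}

/-! ### Reflection of a pattern -/

/-- The starting points of the top pieces in the reflected pattern. -/
def mirror (c : Scale) (N : ℕ) (s : ℤ → ℤ) (i : ℤ) : ℤ := -(s (-i) + c.a N)

theorem mirror_mirror (c : Scale) (N : ℕ) (s : ℤ → ℤ) : c.mirror N (c.mirror N s) = s := by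
  funext i
  simp [mirror]

theorem mirror_width (c : Scale) (N : ℕ) (s : ℤ → ℤ) (i : ℤ) :
    c.mirror N s (i + 1) - c.mirror N s i - c.a N = s (-(i + 1) + 1) - s (-(i + 1)) - c.a N := by
  unfold mirror
  rw [show -(i + 1) + 1 = -i by ring]
  ring

theorem Spaced.mirror (hs : c.Spaced N s) : c.Spaced N (c.mirror N s) := by
  intro i
  have := hs (-(i + 1))
  have := mirror_width c N s i
  omega

/-- Both subdivision rules are palindromic, so reflection only reverses the order of the children.
-/
theorem Piece.mirror (hc : c.Recursive) {n : ℕ} {τ : Bool} {y : ℤ} (h : c.Piece N s n τ y) :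
    c.Piece N (c.mirror N s) n τ (-(y + c.len τ n)) := by
  induction h with
  | top i =>
    convert Piece.top (-i) using 1
    simp [Scale.mirror]
  | a₁ hn p ih =>
    have h1 := hc.a_succ _ hn
    convert Piece.a₃ hn ih using 1
    simp only [len_true, len_false]; omega
  | a₂ hn p ih =>
    have h1 := hc.a_succ _ hn
    convert Piece.a₂ hn ih using 1
    simp only [len_false]; omega
  | a₃ hn p ih =>
    have h1 := hc.a_succ _ hn
    convert Piece.a₁ hn ih using 1
    simp only [len_true, len_false]; omega
  | b₁ hn p ih =>
    have h1 := hc.b_succ _ hn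
    convert Piece.b₅ hn ih using 1
    simp only [len_true]; omega
  | b₂ hn p ih =>
    have h1 := hc.b_succ _ hn
    convert Piece.b₄ hn ih using 1
    simp only [len_true, len_false]; omega
  | b₃ hn p ih =>
    have h1 := hc.b_succ _ hn
    convert Piece.b₃ hn ih using 1
    simp only [len_true]; omega
  | b₄ hn p ih =>
    have h1 := hc.b_succ _ hn
    convert Piece.b₂ hn ih using 1
    simp only [len_true, len_false]; omega
  | b₅ hn p ih =>
    have h1 := hc.b_succ _ hn
    convert Piece.b₁ hn ih using 1
    simp only [len_true]; omega

/-- At level one the symmetry of the foam uses lengths congruent to 2 modulo 3: a piece then begins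
and ends with a block of two filled links. -/
theorem GapAt.mirror (hc : c.Recursive) (hs : c.Spaced N s) (hl : ∀ τ, c.len τ 1 % 3 = 2) {n : ℕ}
    {g : Gap} (h : c.GapAt N s n g) : c.GapAt N (c.mirror N s) n g.mirror := by
  cases h with
  | top i =>
    have h1 := hs.toNat i
    have h2 := mirror_width c N s (-(i + 1))
    rw [show -(-(i + 1) + 1) = i by ring] at h2
    convert GapAt.top (-(i + 1)) using 1
    rw [h2]
    unfold Gap.mirror
    rw [h1]
    congr 1
    unfold Scale.mirror
    rw [neg_neg]
    ring
  | @inner₁ _ τ y hn p =>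
    have h1 := hc.a_succ _ hn
    have h2 := hc.b_succ _ hn
    have pm := p.mirror hc
    cases τ
    · convert GapAt.inner₂ hn pm using 1
      simp only [Gap.mirror, len_false]; congr 1; omega
    · convert GapAt.inner₄ hn pm using 1
      simp only [Gap.mirror, len_true]; congr 1; omega
  | @inner₂ _ τ y hn p =>
    have h1 := hc.a_succ _ hn
    have h2 := hc.b_succ _ hn
    have pm := p.mirror hc
    cases τ
    · convert GapAt.inner₁ hn pm using 1
      simp only [Gap.mirror, len_false]; congr 1; omega
    · convert GapAt.inner₃ hn pm using 1
      simp only [Gap.mirror, len_true]; congr 1; omega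
  | inner₃ hn p =>
    have h2 := hc.b_succ _ hn
    convert GapAt.inner₂ hn (p.mirror hc) using 1
    simp only [Gap.mirror, len_true]; congr 1; omega
  | inner₄ hn p =>
    have h2 := hc.b_succ _ hn
    convert GapAt.inner₁ hn (p.mirror hc) using 1
    simp only [Gap.mirror, len_true]; congr 1; omega
  | @foam τ y i hi p =>
    have h1 := hl τ
    obtain ⟨m, hm⟩ : ∃ m, c.len τ 1 = 3 * i + 3 * m + 5 := ⟨(c.len τ 1 - 3 * i - 5) / 3, by omega⟩
    convert GapAt.foam m (by omega) (p.mirror hc) using 1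
    simp only [Gap.mirror]; congr 1; push_cast [hm]; ring

theorem image_mirror_gaps (hc : c.Recursive) (hs : c.Spaced N s) (hl : ∀ τ, c.len τ 1 % 3 = 2) :
    Gap.mirror '' c.gaps N s = c.gaps N (c.mirror N s) := by
  apply Set.Subset.antisymm
  · rintro _ ⟨g, ⟨n, h⟩, rfl⟩
    exact ⟨n, h.mirror hc hs hl⟩
  · rintro g ⟨n, h⟩
    refine ⟨g.mirror, ⟨n, ?_⟩, g.mirror_mirror⟩
    have := h.mirror hc hs.mirror hl
    rwa [mirror_mirror] at this

/-! ### Density -/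

theorem Piece.exists_covering (hc : c.Recursive) (hs : c.Spaced N s) (hN : 1 ≤ N) (y : ℤ) (k : ℕ)
    {n : ℕ} (hn : 1 ≤ n) (hk : N = n + k) :
    (∃ m g, c.GapAt N s m g ∧ g.x ≤ y ∧ y < g.x + g.u) ∨
      ∃ τ z, c.Piece N s n τ z ∧ z ≤ y ∧ y < z + c.len τ n := by
  induction k generalizing n with
  | zero =>
    obtain rfl : N = n := by omega
    have hpos := hc.u_pos N hN
    -- The starting points are unbounded in both directions, which gives a last one not beyond `y`.
    have hlin : ∀ i : ℕ, s 0 + i ≤ s i ∧ s (-i) ≤ s 0 - i := by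
      intro i
      induction i with
      | zero => simp
      | succ i ih =>
        have h1 := hs i
        have h2 := hs (-(i + 1))
        rw [show -((i : ℤ) + 1) + 1 = -i by ring] at h2
        push_cast
        omega
    obtain ⟨i, hi, hmax⟩ := Int.exists_greatest_of_bdd (P := fun i => s i ≤ y)
      ⟨(y - s 0).toNat, fun z hz => by
        by_contra hcon
        obtain ⟨m, rfl⟩ : ∃ m : ℕ, z = m := ⟨z.toNat, by omega⟩
        have := (hlin m).1
        omega⟩ ⟨-((s 0 - y).toNat : ℤ), by
        have := (hlin (s 0 - y).toNat).2
        omega⟩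
    have hlt : y < s (i + 1) := by
      by_contra hcon
      have := hmax (i + 1) (by omega)
      omega
    rcases lt_or_ge y (s i + c.a N) with h | h
    · exact Or.inr ⟨false, s i, Piece.top i, hi, h⟩
    · refine Or.inl ⟨N, _, GapAt.top i, h, ?_⟩
      have := hs.toNat i
      simp only; omega
  | succ k ih =>
    rcases ih (n := n + 1) (by omega) (by omega) with h | ⟨σ, z, p, h1, h2⟩
    · exact Or.inl h
    have e1 := hc.a_succ n hn
    have e2 := hc.b_succ n hn
    cases σ
    · rw [len_false] at h2
      rcases lt_or_ge y (z + c.b n) with c1 | c1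
      · exact Or.inr ⟨_, _, Piece.a₁ hn p, h1, c1⟩
      rcases lt_or_ge y (z + c.b n + c.u n) with c2 | c2
      · exact Or.inl ⟨_, _, GapAt.inner₁ hn p, c1, c2⟩
      rcases lt_or_ge y (z + c.b n + c.u n + c.a n) with c3 | c3
      · exact Or.inr ⟨_, _, Piece.a₂ hn p, c2, c3⟩
      rcases lt_or_ge y (z + c.b n + c.u n + c.a n + c.u n) with c4 | c4
      · exact Or.inl ⟨_, _, GapAt.inner₂ hn p, c3, c4⟩
      exact Or.inr ⟨_, _, Piece.a₃ hn p, c4, by rw [len_true]; omega⟩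
    · rw [len_true] at h2
      rcases lt_or_ge y (z + c.b n) with c1 | c1
      · exact Or.inr ⟨_, _, Piece.b₁ hn p, h1, c1⟩
      rcases lt_or_ge y (z + c.b n + c.u n) with c2 | c2
      · exact Or.inl ⟨_, _, GapAt.inner₁ hn p, c1, c2⟩
      rcases lt_or_ge y (z + c.b n + c.u n + c.a n) with c3 | c3
      · exact Or.inr ⟨_, _, Piece.b₂ hn p, c2, c3⟩
      rcases lt_or_ge y (z + c.b n + c.u n + c.a n + c.u n) with c4 | c4
      · exact Or.inl ⟨_, _, GapAt.inner₂ hn p, c3, c4⟩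
      rcases lt_or_ge y (z + c.b n + c.u n + c.a n + c.u n + c.b n) with c5 | c5
      · exact Or.inr ⟨_, _, Piece.b₃ hn p, c4, c5⟩
      rcases lt_or_ge y (z + c.b n + c.u n + c.a n + c.u n + c.b n + c.u n) with c6 | c6
      · exact Or.inl ⟨_, _, GapAt.inner₃ hn p, c5, c6⟩
      rcases lt_or_ge y (z + c.b n + c.u n + c.a n + c.u n + c.b n + c.u n + c.a n) with c7 | c7
      · exact Or.inr ⟨_, _, Piece.b₄ hn p, c6, c7⟩
      rcases lt_or_ge y (z + c.b n + c.u n + c.a n + c.u n + c.b n + c.u n + c.a n + c.u n)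
        with c8 | c8
      · exact Or.inl ⟨_, _, GapAt.inner₄ hn p, c7, c8⟩
      exact Or.inr ⟨_, _, Piece.b₅ hn p, c8, by rw [len_true]; omega⟩

/-- Any three consecutive links meet a gap. -/
theorem gaps_dense (hc : c.Recursive) (hs : c.Spaced N s) (hN : 1 ≤ N)
    (hl : ∀ τ, c.len τ 1 % 3 = 2) (y : ℤ) :
    ∃ j ∈ c.gaps N s, j.x ≤ y + 2 ∧ y < j.x + j.u := by
  rcases Piece.exists_covering hc hs hN y (N - 1) le_rfl (by omega) with
    ⟨m, g, hg, h1, h2⟩ | ⟨τ, z, p, h1, h2⟩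
  · exact ⟨g, ⟨m, hg⟩, by omega, h2⟩
  · have h3 := hl τ
    obtain ⟨o, ho⟩ : ∃ o : ℕ, y = z + o := ⟨(y - z).toNat, by omega⟩
    -- Either the block containing `y` is followed by a foam gap, or it is the last block of its
    -- piece and the gap after the piece serves.
    by_cases hi : 3 * (o / 3) + 3 ≤ c.len τ 1
    · refine ⟨_, ⟨_, GapAt.foam (o / 3) hi p⟩, ?_, ?_⟩ <;> simp only <;> push_cast <;> omega
    · obtain ⟨m, hm, g, hg, hx⟩ := p.next_gap hc le_rfl
      have := hg.u_le hs (by omega)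
      have := hc.u_pos m hm
      exact ⟨g, ⟨m, hg⟩, by omega, by omega⟩

/-! ### Validity -/

/-- The time at which a gap of level `n` closes. -/
def life (c : Scale) (n : ℕ) : ℕ := (c.u n + 1) / 2 + 2 * c.T n

/-- Twice the distance from the end of a piece of level `n + 1` to the center of the last gap. -/
def near (c : Scale) (n : ℕ) : ℕ := 2 * c.b n + c.u n

/-- Twice the distance from the end of a piece of level `n + 1` to the center of the last gap
but one. -/
def far (c : Scale) (n : ℕ) : ℕ := 2 * c.b n + 2 * c.a n + 3 * c.u n

/-- The width `w` is admissible for gaps of level `n`. -/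
structure Wide (v : ℕ) (c : Scale) (n w : ℕ) : Prop where
  odd : Odd w
  le : c.u n ≤ w
  ray : ∃ k, k + (k - 1) / v = w + 2 * c.T n ∧ c.life (n - 2) + (k - 1) / v ≤ c.T n ∧
    2 * c.T n + k < c.a n + (k - 1) / v

/-- The numerical conditions under which hierarchical patterns evolve as prescribed. -/
structure Valid (v : ℕ) (c : Scale) : Prop where
  recursive : c.Recursive
  u_zero : c.u 0 = 1
  T_zero : c.T 0 = 0
  u_one : c.u 1 = (v - 1) * c.T 1 + 1
  odd_one : Odd (c.u 1)
  dvd : 3 ∣ c.T 1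
  a_one : c.a 1 % 3 = 2
  b_one : c.b 1 % 3 = 2
  lt_one : (v + 1) * c.T 1 + 1 < c.a 1
  life_mono : Monotone c.life
  T_ge : ∀ n, 1 ≤ n → c.far n + 2 * v * c.life n ≤ 2 * (v + 1) * c.T (n + 1) + 2 * v
  T_min : ∀ n, 1 ≤ n → ∀ t < c.T (n + 1), 2 * (v + 1) * t + 2 * v < c.far n + 2 * v * c.life n
  wide : ∀ n, 2 ≤ n → c.Wide v n (c.u n)
  near : ∀ n, 1 ≤ n → ∀ t < c.T (n + 1), c.u (n + 1) ≤ (v - 1) * t + v →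
    c.near n < 2 * (t + v * (t + 1)) + 1 ∧ c.b n + c.u n < c.u (n + 1) + 2 * t
  far : ∀ n, 1 ≤ n → ∀ t < c.T (n + 1), c.near n + 2 * v * c.life n ≤ 2 * (v + 1) * t + 2 * v →
    c.far n < 2 * (t + v * (t + 1)) + 1 ∧ c.b n + c.u n + c.a n + c.u n < c.u (n + 1) + 2 * t

variable {v : ℕ}

theorem Wide.two_mul_T_lt {n w : ℕ} (h : c.Wide v n w) : 2 * c.T n < c.a n := by
  obtain ⟨k, -, -, h⟩ := h.ray
  have : (k - 1) / v ≤ k - 1 := Nat.div_le_self _ _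
  omega

theorem Valid.len_mod (h : c.Valid v) (τ : Bool) : c.len τ 1 % 3 = 2 := by
  cases τ
  · exact h.a_one
  · exact h.b_one

theorem Valid.two_mul_T_lt (hv : 3 ≤ v) (h : c.Valid v) {n : ℕ} (hn : 1 ≤ n) :
    2 * c.T n < c.a n := by
  rcases Nat.eq_or_lt_of_le hn with rfl | hn
  · have := h.lt_one
    nlinarith
  · exact (h.wide n hn).two_mul_T_lt

/-- The top gaps have admissible widths. -/
def TopWide (v : ℕ) (c : Scale) (N : ℕ) (s : ℤ → ℤ) : Prop :=
  ∀ i, c.Wide v N (s (i + 1) - s i - c.a N).toNat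

theorem TopWide.mirror (ht : c.TopWide v N s) : c.TopWide v N (c.mirror N s) := by
  intro i
  rw [mirror_width]
  exact ht _

theorem GapAt.foam_eq {g : Gap} (h : c.GapAt N s 0 g) (hN : 1 ≤ N) : g.u = 1 ∧ g.T = 0 := by
  cases h with
  | top => omega
  | inner₁ hn | inner₂ hn | inner₃ hn | inner₄ hn => omega
  | foam => exact ⟨rfl, rfl⟩

theorem GapAt.wide (hc : c.Valid v) (ht : c.TopWide v N s) {n : ℕ} {g : Gap} (hn : 2 ≤ n)
    (h : c.GapAt N s n g) : c.Wide v n g.u := by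
  rcases (h.width (by omega)).2 with ⟨-, e⟩ | ⟨rfl, i, e⟩
  · rw [e]; exact hc.wide n hn
  · rw [e]; exact ht i

theorem GapAt.life_eq (hc : c.Valid v) {n : ℕ} {g : Gap} (h : c.GapAt N s n g) (hn : n < N) :
    g.life = c.life n := by
  unfold Gap.life life
  rcases Nat.eq_zero_or_pos n with rfl | hn1
  · rw [(h.foam_eq (by omega)).1, (h.foam_eq (by omega)).2, hc.u_zero, hc.T_zero]
  · obtain ⟨e1, ⟨-, e2⟩ | ⟨e2, -⟩⟩ := h.width hn1
    · rw [e1, e2]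
    · omega

/-- Between two gaps lies a piece of the lower of their levels, longer than `2 * T` at that level.
For gaps of width one `T` vanishes and a distance of two suffices. -/
theorem separated_gaps (hv : 3 ≤ v) (hc : c.Valid v) (hN : 2 ≤ N) (hs : c.Spaced N s)
    (ht : c.TopWide v N s) : Separated (c.gaps N s) := by
  constructor
  · rintro g ⟨n, hg⟩
    rcases Nat.lt_or_ge n 2 with h | h
    · rcases Nat.eq_zero_or_pos n with rfl | h0
      · rw [(hg.foam_eq (by omega)).1]; exact odd_one
      · obtain rfl : n = 1 := by omega
        rcases (hg.width le_rfl).2 with ⟨-, e⟩ | ⟨e, -⟩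
        · rw [e]; exact hc.odd_one
        · omega
    · exact (hg.wide hc ht h).odd
  · have main : ∀ {n n' g g'}, n ≤ n' → c.GapAt N s n g → c.GapAt N s n' g' →
        g = g' ∨ g.x + g.u + 2 * min (g.T : ℤ) g'.T < g'.x ∨
          g'.x + g'.u + 2 * min (g.T : ℤ) g'.T < g.x := by
      intro n n' g g' hnn' hg hg'
      rcases Nat.eq_zero_or_pos n with rfl | hn
      · have e := (hg.foam_eq (by omega)).2
        rcases hg.separated_foam hc.recursive hs hc.len_mod hg' (by omega) with h | h | h
        · exact Or.inl h
        · right; left; omega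
        · right; right; omega
      · have e := (hg.width hn).1
        have := hc.two_mul_T_lt hv hn
        rcases hg.separated hc.recursive hs hn hnn' hg' with h | h | h
        · exact Or.inl h
        · right; left; omega
        · right; right; omega
    rintro g ⟨n, hg⟩ g' ⟨n', hg'⟩
    rcases le_total n n' with h | h
    · exact main h hg hg'
    · rcases main h hg' hg with h | h | h
      · exact Or.inl h.symm
      · right; right; rwa [min_comm]
      · right; left; rwa [min_comm]

theorem closable_gaps (hv : 3 ≤ v) (hc : c.Valid v) (hN : 2 ≤ N)
    (ht : c.TopWide v N s) : ∀ g ∈ c.gaps N s, g.Closable v := by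
  rintro g ⟨n, hg⟩
  rcases Nat.lt_or_ge n 2 with h | h
  · rcases Nat.eq_zero_or_pos n with rfl | h0
    · obtain ⟨e1, e2⟩ := hg.foam_eq (by omega)
      exact ⟨1, by simp [e1, e2], by simp⟩
    · obtain rfl : n = 1 := by omega
      obtain ⟨e1, ⟨-, e2⟩ | ⟨e2, -⟩⟩ := hg.width le_rfl
      · have hdiv : (v * c.T 1 + 1 - 1) / v = c.T 1 := by
          rw [Nat.add_sub_cancel, Nat.mul_div_cancel_left _ (by omega)]
        refine ⟨v * c.T 1 + 1, ?_, ?_⟩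
        · rw [hdiv, e1, e2, hc.u_one]
          obtain ⟨z, rfl⟩ : ∃ z, v = z + 1 := ⟨v - 1, by omega⟩
          simp only [Nat.add_sub_cancel]; ring
        · rw [hdiv, e1]
      · omega
  · obtain ⟨k, h1, h2, -⟩ := (hg.wide hc ht h).ray
    rw [← (hg.width (by omega)).1] at h1 h2
    exact ⟨k, h1, by omega⟩

theorem GapAt.leftGood_zero (hc : c.Valid v) (hN : 2 ≤ N) (hs : c.Spaced N s)
    (hS : Separated (c.gaps N s)) {g : Gap} (hg : c.GapAt N s 0 g) :
    LeftGood v (c.gaps N s) g := by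
  obtain ⟨e1, e2⟩ := hg.foam_eq (by omega)
  refine leftGood_of_small hS ⟨0, hg⟩ e1 e2 ?_
  rintro j ⟨m, hj⟩ hlt
  rcases hg.separated_foam hc.recursive hs hc.len_mod hj (by omega) with rfl | h | h
  · omega
  · omega
  · exact h

theorem GapAt.leftGood_one (hv : 3 ≤ v) (hc : c.Valid v) (hN : 2 ≤ N) (hs : c.Spaced N s)
    (hS : Separated (c.gaps N s)) {g : Gap} (hg : c.GapAt N s 1 g) :
    LeftGood v (c.gaps N s) g := by
  obtain ⟨e1, ⟨-, e2⟩ | ⟨e2, -⟩⟩ := hg.width le_rfl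
  swap
  · omega
  obtain ⟨τ, y, p, hy⟩ := hg.left_piece le_rfl
  have hmod := hc.len_mod τ
  have hlen := hc.recursive.a_le_len le_rfl τ
  refine leftGood_of_foam hv hS ⟨1, hg⟩ (by rw [e1, e2, hc.u_one]) (e1 ▸ hc.dvd) (A := c.a 1)
    ?_ ?_ (by rw [e1]; exact hc.lt_one)
  · intro i hi
    obtain ⟨m, hm⟩ : ∃ m, c.len τ 1 = 3 * i + 3 * m + 5 := ⟨(c.len τ 1 - 3 * i - 5) / 3, by omega⟩
    refine ⟨0, ?_⟩
    convert GapAt.foam m (by omega) p using 2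
    rw [← hy, hm]; push_cast; ring
  · rintro j ⟨m, hj⟩ hlt
    rcases Nat.eq_zero_or_pos m with rfl | hm
    · obtain ⟨f1, f2⟩ := hj.foam_eq (by omega)
      cases hj with
      | top => omega
      | inner₁ hn | inner₂ hn | inner₃ hn | inner₄ hn => omega
      | @foam τ' y' i hi p' =>
        have hu := hc.recursive.u_pos 1 le_rfl
        simp only at hlt ⊢
        rcases p.disjoint hc.recursive hs le_rfl p' with ⟨rfl, rfl⟩ | h | h
        · left
          refine ⟨trivial, trivial, ?_⟩
          omega
        · omega
        · right
          push_cast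
          omega
    · right
      rcases hg.separated hc.recursive hs le_rfl hm hj with rfl | h | h
      · omega
      · omega
      · exact h

/-- The gaps on the left are sorted by level. Those below level `n` have closed before any relevant
ray leaves them. At level `n` only the last two gaps of the adjacent piece are within reach, and
they are the guides. Everything else is at distance at least `c.a (n + 1)`. -/
theorem GapAt.leftGood_succ (hv : 3 ≤ v) (hc : c.Valid v) (hN : 2 ≤ N) (hs : c.Spaced N s)
    (ht : c.TopWide v N s) (hS : Separated (c.gaps N s)) {n : ℕ} (hn : 1 ≤ n) {g : Gap}
    (hg : c.GapAt N s (n + 1) g) : LeftGood v (c.gaps N s) g := by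
  have hw := hg.wide hc ht (by omega)
  have hl := hg.level
  have e1 := (hg.width (by omega)).1
  obtain ⟨τ, y, p, hy⟩ := hg.left_piece (by omega)
  obtain ⟨k, h1, h2, h3⟩ := hw.ray
  obtain ⟨g1, g2⟩ := p.last_gaps hc.recursive hn hy
  have hupos := hc.recursive.u_pos n hn
  have hule := hw.le
  refine leftGood_of_subgaps hv hS (closable_gaps hv hc hN ht)
    (gaps_dense hc.recursive hs (by omega) hc.len_mod) ⟨_, hg⟩ ⟨_, g1⟩ ⟨_, g2⟩ (k₀ := k)
    (D := c.life n) (Y₁ := c.near n) (Y₂ := c.far n) (A := c.a (n + 1)) rfl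
    (by rw [e1, h1]) (by rw [e1]; omega) (by simp only; omega) (by simp only; omega)
    (by simp only [Scale.near]; push_cast; ring) (by simp only [Scale.far]; push_cast; ring)
    rfl rfl (by rw [e1]; exact hc.T_ge n hn) (by rw [e1]; exact hc.T_min n hn) ?_ ?_ ?_
    (by rw [e1]; exact h3)
  · intro t ht' hle
    have := hc.near n hn t (e1 ▸ ht') (by omega)
    refine ⟨this.1, ?_⟩
    simp only; omega
  · intro t ht' hle
    have := hc.far n hn t (e1 ▸ ht') hle
    refine ⟨this.1, ?_⟩
    simp only; omega
  · rintro j ⟨m, hj⟩ hlt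
    rcases lt_trichotomy m n with hm | rfl | hm
    · left
      have := hc.life_mono (show m ≤ n + 1 - 2 by omega)
      rw [hj.life_eq hc (by omega), e1]
      omega
    · have hu : j.u = c.u m := by
        rcases (hj.width hn).2 with ⟨-, e⟩ | ⟨e, -⟩
        · exact e
        · omega
      have hlife := hj.life_eq hc (by omega)
      rcases hj.below hc.recursive hs hn p hy hlt with h | h | h
      · right; left
        refine ⟨hlife.le, ?_⟩
        rw [h, hu]
        unfold Scale.far
        push_cast; omega
      · right; left
        refine ⟨hlife.le, ?_⟩
        rw [h, hu]
        unfold Scale.far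
        push_cast; omega
      · exact Or.inr (Or.inr h)
    · right; right
      rcases hg.separated hc.recursive hs (by omega) (show n + 1 ≤ m from hm) hj with rfl | h | h
      · omega
      · omega
      · exact h

theorem leftGood_gaps (hv : 3 ≤ v) (hc : c.Valid v) (hN : 2 ≤ N) (hs : c.Spaced N s)
    (ht : c.TopWide v N s) : ∀ g ∈ c.gaps N s, LeftGood v (c.gaps N s) g := by
  have hS := separated_gaps hv hc hN hs ht
  rintro g ⟨n, hg⟩
  match n, hg with
  | 0, hg => exact hg.leftGood_zero hc hN hs hS
  | 1, hg => exact hg.leftGood_one hv hc hN hs hS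
  | n + 2, hg => exact hg.leftGood_succ hv hc hN hs ht hS (by omega)

theorem spaced_of_topWide (hc : c.Valid v) (hN : 1 ≤ N) (ht : c.TopWide v N s) :
    c.Spaced N s := by
  intro i
  have := (ht i).le
  have := hc.recursive.u_pos N hN
  omega

/-- Hierarchical patterns evolve as prescribed. -/
theorem isRun_gaps (hv : 3 ≤ v) (hc : c.Valid v) (hN : 2 ≤ N)
    (ht : c.TopWide v N s) (τ : ℕ) : IsRun v (filled (c.gaps N s)) τ := by
  have hs := spaced_of_topWide hc (by omega) ht
  refine isRun_filled (by omega) (separated_gaps hv hc hN hs ht) (leftGood_gaps hv hc hN hs ht)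
    ?_ τ
  intro g hg
  rw [image_mirror_gaps hc.recursive hs hc.len_mod]
  refine leftGood_gaps hv hc hN hs.mirror ht.mirror _ ?_
  rw [← image_mirror_gaps hc.recursive hs hc.len_mod]
  exact Set.mem_image_of_mem _ hg

end Scale

/-! ### Proportions -/

/-- The proportions of one level of a pattern for a decoder of speed `v = 1 + 1 / x`: `a` and `b`
are the lengths of the pieces, `u` is the width of the gaps and `T` their receding time. -/
structure Balanced (x a b u T : ℝ) : Prop where
  x_pos : 0 < x
  x_le : x ≤ 1 / 2
  u_ge : 2000000 ≤ u
  a_ge : 0.585 * b ≤ a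
  a_le : a ≤ 0.601 * b
  b_le : b ≤ (2.8 + 4.2 * x) * u
  b_ge : (2.8 + 4.2 * x) * u ≤ 1.001 * b
  T_ge : x * (u - 1) ≤ T
  T_le : T ≤ (0.142 + 1.5 * x - 0.45 * x ^ 2) * u

/-- The proportions of the next level. -/
structure NextLevel (x a b u T D a' b' u' T' : ℝ) : Prop where
  a_eq : a' = 2 * b + a + 2 * u
  b_eq : b' = 3 * b + 2 * a + 4 * u
  u_ge : b' ≤ (2.8 + 4.2 * x) * u'
  u_le : (2.8 + 4.2 * x) * (u' - 4) ≤ b'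
  D_ge : u / 2 + 2 * T ≤ D
  D_le : D ≤ u / 2 + 2 * T + 1 / 2
  T_ge : x * (b + a + 1.5 * u) + (1 + x) * (D - 1) ≤ (1 + 2 * x) * T'
  T_le : (1 + 2 * x) * (T' - 1) ≤ x * (b + a + 1.5 * u) + (1 + x) * (D - 1)

namespace Balanced

variable {x a b u T D a' b' u' T' : ℝ}

theorem b_pos (h : Balanced x a b u T) : 2 * u ≤ b := by
  have := mul_nonneg h.x_pos.le (show 0 ≤ u by linarith [h.u_ge])
  linarith [h.b_ge, h.u_ge]

theorem u_le_b (h : Balanced x a b u T) : u ≤ 0.3575 * b := by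
  have := mul_nonneg h.x_pos.le (show 0 ≤ u by linarith [h.u_ge])
  linarith [h.b_ge, h.u_ge]

theorem b_le_u (h : Balanced x a b u T) : b ≤ 4.9 * u := by
  have := mul_nonneg (sub_nonneg.2 h.x_le) (show 0 ≤ u by linarith [h.u_ge])
  linarith [h.b_le, h.u_ge]

/-- Used in `Scale.Dims.near`: by the time the opposite end could be heard, the nearer subgap is
heard already, with a smaller value. -/
theorem near (h : Balanced x a b u T) (n : NextLevel x a b u T D a' b' u' T') :
    b + u + 10 ≤ (1 + 2 * x) * u' := by
  have hx := h.x_pos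
  have hq : 0 < 2.8 + 4.2 * x := by linarith
  have hu := h.u_ge
  have hb := h.b_pos
  refine le_of_mul_le_mul_left ?_ hq
  have e1 := mul_le_mul_of_nonneg_left n.u_ge (show 0 ≤ 1 + 2 * x by linarith)
  rw [n.b_eq] at e1
  have e2 := mul_nonneg (show 0 ≤ 1 + 2 * x by linarith) (sub_nonneg.2 h.a_ge)
  have e3 := mul_nonneg hx.le (show 0 ≤ b by linarith)
  have e4 := mul_nonneg hx.le (show 0 ≤ u - 1000000 by linarith)
  linarith

/-- With `x = 1 / (v - 1)` this reads `a + u ≤ v * D`: the messages of the farther subgap arrive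
before those of the nearer one stop. -/
theorem far_left (h : Balanced x a b u T) (n : NextLevel x a b u T D a' b' u' T') :
    x * (a + u) ≤ (1 + x) * D := by
  have hx := h.x_pos
  have hu := h.u_ge
  have e1 := mul_le_mul_of_nonneg_left n.D_ge (show 0 ≤ 1 + x by linarith)
  have e2 := mul_le_mul_of_nonneg_left h.T_ge (show 0 ≤ 2 * (1 + x) by linarith)
  have e3 := mul_nonneg hx.le (sub_nonneg.2 h.a_le)
  have e4 := mul_nonneg hx.le (sub_nonneg.2 h.b_le)
  have e5 : 0 ≤ (0.3 - 0.1828 * x - 0.5242 * x ^ 2) * u := by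
    refine mul_nonneg ?_ (by linarith)
    nlinarith [h.x_le]
  have e6 : x * (1 + x) ≤ 1 := by nlinarith [h.x_le]
  linarith

/-- At the moment when the farther subgap takes over as guide, its message must still beat the one
from the opposite end, which would have `k + (k - 1) / v = u' + 2 * t`. -/
theorem far_right (h : Balanced x a b u T) (n : NextLevel x a b u T D a' b' u' T') {t : ℝ}
    (ht : x * (2 * b + u) + 2 * (1 + x) * D ≤ 2 * (1 + 2 * x) * t + 2 * (1 + x)) :
    b + 2 * u + a < u' + 2 * t := by
  have hx := h.x_pos
  have hx2 := h.x_le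
  have hu := h.u_ge
  have hq : 0 < 2.8 + 4.2 * x := by linarith
  have hq2 : 0 < (2.8 + 4.2 * x) * (1 + 2 * x) := by positivity
  refine lt_of_mul_lt_mul_left ?_ hq2.le
  have e1 := mul_le_mul_of_nonneg_left n.u_ge (show 0 ≤ 1 + 2 * x by linarith)
  rw [n.b_eq] at e1
  have e2 := mul_le_mul_of_nonneg_left ht hq.le
  have e3 := mul_le_mul_of_nonneg_left n.D_ge (show 0 ≤ 2 * (1 + x) * (2.8 + 4.2 * x) by positivity)
  have e4 := mul_le_mul_of_nonneg_left h.T_ge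
    (show 0 ≤ 4 * (1 + x) * (2.8 + 4.2 * x) by positivity)
  have e5 := mul_nonneg (show 0 ≤ 0.8 + 5.8 * x + 8.4 * x ^ 2 by positivity) (sub_nonneg.2 h.a_le)
  have e6 := mul_nonneg (show 0 ≤ 0.2808 + 1.6858 * x + 5.0484 * x ^ 2 by positivity)
    (sub_nonneg.2 h.b_le)
  have e7 : 0 ≤ (0.35 + 3.4 * x - 1.7 * x ^ 2 - 4.5 * x ^ 3) * (u - 1000000) := by
    refine mul_nonneg ?_ (by linarith)
    nlinarith [mul_nonneg hx.le (sub_nonneg.2 hx2), mul_nonneg (sq_nonneg x) (sub_nonneg.2 hx2)]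
  have e8 : 0.35 ≤ 0.35 + 3.4 * x - 1.7 * x ^ 2 - 4.5 * x ^ 3 := by
    nlinarith [mul_nonneg hx.le (sub_nonneg.2 hx2), mul_nonneg (sq_nonneg x) (sub_nonneg.2 hx2)]
  have e9 : x ^ 2 ≤ 1 := by nlinarith
  have e10 : x ^ 3 ≤ 1 := by nlinarith
  have e11 := mul_nonneg hx.le (show 0 ≤ u by linarith)
  have e12 := mul_nonneg (sq_nonneg x) (show 0 ≤ u by linarith)
  have e13 := mul_nonneg (pow_nonneg hx.le 3) (show 0 ≤ u by linarith)
  nlinarith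

end Balanced

namespace Balanced

variable {x a b u T D a' b' u' T' : ℝ}

/-- On `[0, 1/2]` the difference of the two sides is a nonnegative combination of the Bernstein
products `x ^ i * (1/2 - x) ^ j`; the next lemmas are of the same kind. The positive margin,
multiplied by the very large `u`, pays for all rounding errors. -/
theorem early_aux {x : ℝ} (hx : 0 ≤ x) (hy : 0 ≤ 1 / 2 - x) :
    0.01 ≤ (2.8 + 4.2 * x) * (1.5 * x + (1 + x) * (0.5 + 2 * x)) - 4.04 * x * (1 + 2 * x) + x * (0.2263 * 0.999 - 1.7664 * x) * (2.8 + 4.2 * x) - (2.8 + 4.2 * x) * (1 + 2 * x) ^ 2 * (0.15 + 0.56 * x) := by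
  linarith [mul_nonneg (pow_nonneg hx 0) (pow_nonneg hy 4),
    mul_nonneg (pow_nonneg hx 1) (pow_nonneg hy 3),
    mul_nonneg (pow_nonneg hx 2) (pow_nonneg hy 2),
    mul_nonneg (pow_nonneg hx 3) (pow_nonneg hy 1),
    mul_nonneg (pow_nonneg hx 4) (pow_nonneg hy 0)]

theorem late_aux {x : ℝ} (hx : 0 ≤ x) (hy : 0 ≤ 1 / 2 - x) :
    0.01 ≤ 0.999 * (2.8 + 4.2 * x) * ((2.8 + 4.2 * x) * (2.585 + 4 * x + 4 * x ^ 2) - 4.2117 - 8.4234 * x) + 2 * (1 + 2 * x) ^ 2 * (2.8 + 4.2 * x) - 4 * (1 + x) * (2.8 + 4.2 * x) * (1.5 * x + (1 + x) * (0.5 + 2 * (0.142 + 1.5 * x - 0.45 * x ^ 2))) - 4.04 * (1 + 2 * x) := by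
  linarith [mul_nonneg (pow_nonneg hx 0) (pow_nonneg hy 6),
    mul_nonneg (pow_nonneg hx 1) (pow_nonneg hy 5),
    mul_nonneg (pow_nonneg hx 2) (pow_nonneg hy 4),
    mul_nonneg (pow_nonneg hx 3) (pow_nonneg hy 3),
    mul_nonneg (pow_nonneg hx 4) (pow_nonneg hy 2),
    mul_nonneg (pow_nonneg hx 5) (pow_nonneg hy 1),
    mul_nonneg (pow_nonneg hx 6) (pow_nonneg hy 0)]

theorem T_next_aux {x : ℝ} (hx : 0 ≤ x) (hy : 0 ≤ 1 / 2 - x) :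
    0.001 ≤ 0.999 * (2.8 + 4.2 * x) * (4.17 * (1 + 2 * x) * (0.142 + 1.5 * x - 0.45 * x ^ 2) - 1.585 * x * (2.8 + 4.2 * x)) + 4 * (1 + 2 * x) * (0.142 + 1.5 * x - 0.45 * x ^ 2) - (2.8 + 4.2 * x) * (1.5 * x + (1 + x) * (0.5 + 2 * (0.142 + 1.5 * x - 0.45 * x ^ 2))) := by
  linarith [mul_nonneg (pow_nonneg hx 0) (pow_nonneg hy 4),
    mul_nonneg (pow_nonneg hx 1) (pow_nonneg hy 3),
    mul_nonneg (pow_nonneg hx 2) (pow_nonneg hy 2),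
    mul_nonneg (pow_nonneg hx 3) (pow_nonneg hy 1),
    mul_nonneg (pow_nonneg hx 4) (pow_nonneg hy 0)]

theorem D_aux {x : ℝ} (hx : 0 ≤ x) (hy : 0 ≤ 1 / 2 - x) :
    0.001 ≤ 0.999 * 4.17 * (0.15 + 0.56 * x) * (2.8 + 4.2 * x) + 4 * (0.15 + 0.56 * x) - (2.8 + 4.2 * x) * (0.5 + 2 * (0.142 + 1.5 * x - 0.45 * x ^ 2)) := by
  linarith [mul_nonneg (pow_nonneg hx 0) (pow_nonneg hy 3),
    mul_nonneg (pow_nonneg hx 1) (pow_nonneg hy 2),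
    mul_nonneg (pow_nonneg hx 2) (pow_nonneg hy 1),
    mul_nonneg (pow_nonneg hx 3) (pow_nonneg hy 0)]

theorem T_next_aux₁ {x : ℝ} (hx : 0 ≤ x) (hy : 0 ≤ 1 / 2 - x) :
    0 ≤ 0.284 + 0.768 * x + 0.9 * x ^ 2 - 1.8 * x ^ 3 := by
  linarith [mul_nonneg (pow_nonneg hx 0) (pow_nonneg hy 3),
    mul_nonneg (pow_nonneg hx 1) (pow_nonneg hy 2),
    mul_nonneg (pow_nonneg hx 2) (pow_nonneg hy 1),
    mul_nonneg (pow_nonneg hx 3) (pow_nonneg hy 0)]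

theorem T_next_aux₂ {x : ℝ} (hx : 0 ≤ x) (hy : 0 ≤ 1 / 2 - x) :
    0 ≤ 0.999 * (4.17 * (1 + 2 * x) * (0.142 + 1.5 * x - 0.45 * x ^ 2) -
      1.585 * x * (2.8 + 4.2 * x)) := by
  linarith [mul_nonneg (pow_nonneg hx 0) (pow_nonneg hy 3),
    mul_nonneg (pow_nonneg hx 1) (pow_nonneg hy 2),
    mul_nonneg (pow_nonneg hx 2) (pow_nonneg hy 1),
    mul_nonneg (pow_nonneg hx 3) (pow_nonneg hy 0)]

theorem late_aux₁ {x : ℝ} (hx : 0 ≤ x) :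
    0 ≤ 0.999 * ((2.8 + 4.2 * x) * (2.585 + 4 * x + 4 * x ^ 2) - 4.2117 - 8.4234 * x) := by
  linarith [pow_nonneg hx 2, pow_nonneg hx 3]

theorem pow_aux {x : ℝ} (hx : 0 ≤ x) (hx2 : x ≤ 1 / 2) : x ^ 2 ≤ 1 ∧ x ^ 3 ≤ 1 ∧ x ^ 4 ≤ 1 :=
  ⟨pow_le_one₀ hx (by linarith), pow_le_one₀ hx (by linarith), pow_le_one₀ hx (by linarith)⟩

/-- Makes the longest ray across a gap of width `w` start so late that the gaps two levels below
have closed. The bracket `0.15 + 0.56 * x` is the bound on lifetimes from `D_le`. The one percent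
tolerance for `w` is needed to fit rings of every length. -/
theorem early (h : Balanced x a b u T) (n : NextLevel x a b u T D a' b' u' T') {w : ℝ}
    (hw : 100 * w ≤ 101 * u') : (1 + 2 * x) * ((0.15 + 0.56 * x) * u) ≤ T' - x * w := by
  have hx := h.x_pos
  have hx2 := h.x_le
  have hu := h.u_ge
  have hq : 0 < 2.8 + 4.2 * x := by linarith
  have hq2 : 0 < (2.8 + 4.2 * x) * (1 + 2 * x) := by positivity
  refine le_of_mul_le_mul_left ?_ hq2
  have e0 := mul_le_mul_of_nonneg_left n.u_le (show 0 ≤ 1.01 * x * (1 + 2 * x) by positivity)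
  rw [n.b_eq] at e0
  have e1 := mul_le_mul_of_nonneg_left hw
    (show 0 ≤ 0.01 * x * (1 + 2 * x) * (2.8 + 4.2 * x) by positivity)
  have e2 := mul_le_mul_of_nonneg_left n.T_ge hq.le
  have e3 := mul_le_mul_of_nonneg_left n.D_ge (show 0 ≤ (1 + x) * (2.8 + 4.2 * x) by positivity)
  have e4 := mul_le_mul_of_nonneg_left h.T_ge
    (show 0 ≤ 2 * (1 + x) * (2.8 + 4.2 * x) by positivity)
  have e5 := mul_nonneg (show 0 ≤ x * (0.78 + 0.16 * x) by positivity) (sub_nonneg.2 h.a_ge)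
  have e6 := mul_nonneg (show 0 ≤ 1.7664 * x ^ 2 by positivity) (sub_nonneg.2 h.b_le)
  have e7 := mul_nonneg (show 0 ≤ 0.2263 * 0.999 * x by positivity) (sub_nonneg.2 h.b_ge)
  have e8 := early_aux hx.le (sub_nonneg.2 hx2)
  have e9 := mul_le_mul_of_nonneg_right e8 (show 0 ≤ u by linarith)
  obtain ⟨p2, p3, p4⟩ := pow_aux hx.le hx2
  have q1 := mul_nonneg hx.le (show 0 ≤ b by linarith [h.b_pos])
  have q2 := mul_nonneg (sq_nonneg x) (show 0 ≤ b by linarith [h.b_pos])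
  linarith

/-- Makes the same ray too short to reach anything at distance `a'`, that is anything beyond the two
guiding subgaps. -/
theorem late (h : Balanced x a b u T) (n : NextLevel x a b u T D a' b' u' T') {w : ℝ}
    (hw : 100 * w ≤ 101 * u') : 4 * (1 + x) * T' + w + 2 * (1 + x) < (1 + 2 * x) * a' := by
  have hx := h.x_pos
  have hx2 := h.x_le
  have hu := h.u_ge
  have hq : 0 < 2.8 + 4.2 * x := by linarith
  have hq2 : 0 < (2.8 + 4.2 * x) * (1 + 2 * x) := by positivity
  refine lt_of_mul_lt_mul_left ?_ hq2.le
  rw [n.a_eq]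
  have e0 := mul_le_mul_of_nonneg_left n.u_le (show 0 ≤ 1.01 * (1 + 2 * x) by positivity)
  rw [n.b_eq] at e0
  have e1 := mul_le_mul_of_nonneg_left hw
    (show 0 ≤ 0.01 * (1 + 2 * x) * (2.8 + 4.2 * x) by positivity)
  have e2 := mul_le_mul_of_nonneg_left n.T_le
    (show 0 ≤ 4 * (1 + x) * (2.8 + 4.2 * x) by positivity)
  have e3 := mul_le_mul_of_nonneg_left n.D_le
    (show 0 ≤ 4 * (1 + x) * (1 + x) * (2.8 + 4.2 * x) by positivity)
  have e4 := mul_le_mul_of_nonneg_left h.T_le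
    (show 0 ≤ 8 * (1 + x) * (1 + x) * (2.8 + 4.2 * x) by positivity)
  have e5 := mul_nonneg (show 0 ≤ 0.78 + 0.16 * x by positivity) (sub_nonneg.2 h.a_ge)
  have e7 := mul_nonneg (late_aux₁ hx.le) (sub_nonneg.2 h.b_ge)
  have e8 := late_aux hx.le (sub_nonneg.2 hx2)
  have e9 := mul_le_mul_of_nonneg_right e8 (show 0 ≤ u by linarith)
  obtain ⟨p2, p3, p4⟩ := pow_aux hx.le hx2
  have q1 := mul_nonneg (late_aux₁ hx.le) (show 0 ≤ b by linarith [h.b_pos])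
  linarith

theorem T_next_le (h : Balanced x a b u T) (n : NextLevel x a b u T D a' b' u' T') :
    T' ≤ (0.142 + 1.5 * x - 0.45 * x ^ 2) * u' := by
  have hx := h.x_pos
  have hx2 := h.x_le
  have hu := h.u_ge
  have hq : 0 < 2.8 + 4.2 * x := by linarith
  have hq2 : 0 < (2.8 + 4.2 * x) * (1 + 2 * x) := by positivity
  have hth : 0 ≤ 0.142 + 1.5 * x - 0.45 * x ^ 2 := by
    linarith [mul_nonneg hx.le (sub_nonneg.2 hx2)]
  refine le_of_mul_le_mul_left ?_ hq2
  have e0 := mul_le_mul_of_nonneg_left n.u_ge (mul_nonneg (show 0 ≤ 1 + 2 * x by positivity) hth)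
  rw [n.b_eq] at e0
  have e2 := mul_le_mul_of_nonneg_left n.T_le (show 0 ≤ 2.8 + 4.2 * x by positivity)
  have e3 := mul_le_mul_of_nonneg_left n.D_le (show 0 ≤ (1 + x) * (2.8 + 4.2 * x) by positivity)
  have e4 := mul_le_mul_of_nonneg_left h.T_le (show 0 ≤ 2 * (1 + x) * (2.8 + 4.2 * x) by positivity)
  have e5 := mul_nonneg (T_next_aux₁ hx.le (sub_nonneg.2 hx2)) (sub_nonneg.2 h.a_ge)
  have e7 := mul_nonneg (T_next_aux₂ hx.le (sub_nonneg.2 hx2)) (sub_nonneg.2 h.b_ge)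
  have e8 := T_next_aux hx.le (sub_nonneg.2 hx2)
  have e9 := mul_le_mul_of_nonneg_right e8 (show 0 ≤ u by linarith)
  obtain ⟨p2, p3, p4⟩ := pow_aux hx.le hx2
  have q1 := mul_nonneg (T_next_aux₂ hx.le (sub_nonneg.2 hx2)) (show 0 ≤ b by linarith [h.b_pos])
  linarith

theorem D_le (h : Balanced x a b u T) (n : NextLevel x a b u T D a' b' u' T') :
    D ≤ (0.15 + 0.56 * x) * u' := by
  have hx := h.x_pos
  have hx2 := h.x_le
  have hu := h.u_ge
  have hq : 0 < 2.8 + 4.2 * x := by linarith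
  refine le_of_mul_le_mul_left ?_ hq
  have e0 := mul_le_mul_of_nonneg_left n.u_ge (show 0 ≤ 0.15 + 0.56 * x by positivity)
  rw [n.b_eq] at e0
  have e3 := mul_le_mul_of_nonneg_left n.D_le hq.le
  have e4 := mul_le_mul_of_nonneg_left h.T_le (show 0 ≤ 2 * (2.8 + 4.2 * x) by positivity)
  have e5 := mul_nonneg (show 0 ≤ 2 * (0.15 + 0.56 * x) by positivity) (sub_nonneg.2 h.a_ge)
  have e7 := mul_nonneg (show 0 ≤ 0.999 * 4.17 * (0.15 + 0.56 * x) by positivity)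
    (sub_nonneg.2 h.b_ge)
  have e8 := D_aux hx.le (sub_nonneg.2 hx2)
  have e9 := mul_le_mul_of_nonneg_right e8 (show 0 ≤ u by linarith)
  have q1 : 0 ≤ b := by linarith [h.b_pos]
  have q2 := mul_nonneg hx.le q1
  linarith

theorem u_next_ge (h : Balanced x a b u T) (n : NextLevel x a b u T D a' b' u' T') :
    u + 4 ≤ u' ∧ 4000000 ≤ u' := by
  have hx := h.x_pos
  have hx2 := h.x_le
  have hu := h.u_ge
  have hq : 0 < 2.8 + 4.2 * x := by linarith
  have hb := h.b_ge
  have ha := h.a_ge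
  have e0 := n.u_ge
  rw [n.b_eq] at e0
  have e1 := mul_nonneg hx.le (show 0 ≤ u - 1000000 by linarith)
  constructor <;> refine le_of_mul_le_mul_left ?_ hq <;> nlinarith

/-- The proportions are preserved. -/
theorem next (h : Balanced x a b u T) (n : NextLevel x a b u T D a' b' u' T') :
    Balanced x a' b' u' T' := by
  have hx := h.x_pos
  have hx2 := h.x_le
  have hu := h.u_ge
  have hun := h.u_next_ge n
  refine ⟨hx, hx2, by linarith, ?_, ?_, n.u_ge, ?_, ?_, h.T_next_le n⟩
  · rw [n.a_eq, n.b_eq]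
    linarith [h.a_le, h.u_le_b, h.b_pos]
  · rw [n.a_eq, n.b_eq]
    linarith [h.a_ge, h.b_le_u, h.b_pos]
  · have := n.u_le
    have h1 : 16800 ≤ 0.001 * b' := by
      rw [n.b_eq]; linarith [h.a_ge, h.b_pos]
    linarith
  · have := h.early n (w := u') (by linarith)
    have : 0 ≤ (1 + 2 * x) * ((0.15 + 0.56 * x) * u) := by positivity
    linarith

end Balanced

/-! ### Integer dimensions with the required proportions -/

namespace Scale

variable {v : ℕ}

/-- The dimensions of one level. -/
structure Dims where
  /-- length of the short pieces -/
  a : ℕ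
  /-- length of the long pieces -/
  b : ℕ
  /-- width of the gaps -/
  u : ℕ
  /-- receding time of the gaps -/
  T : ℕ

/-- The proportions of one level are as required. -/
structure Dims.Ok (v : ℕ) (d : Dims) : Prop where
  balanced : Balanced (1 / ((v : ℝ) - 1)) d.a d.b d.u d.T
  odd : Odd d.u
  even : Even d.a

/-- `d'` are the dimensions of the level after the one with the dimensions `d`. -/
structure Dims.Next (v : ℕ) (d d' : Dims) : Prop where
  a_eq : d'.a = 2 * d.b + d.a + 2 * d.u
  b_eq : d'.b = 3 * d.b + 2 * d.a + 4 * d.u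
  T_eq : d'.T = (2 * d.b + 2 * d.a + 3 * d.u + 2 * v * ((d.u + 1) / 2 + 2 * d.T) + 1) / (2 * (v + 1))
  u_ge : (d'.b : ℝ) ≤ (2.8 + 4.2 * (1 / ((v : ℝ) - 1))) * d'.u
  u_le : (2.8 + 4.2 * (1 / ((v : ℝ) - 1))) * ((d'.u : ℝ) - 4) ≤ d'.b
  odd : Odd d'.u
  not_dvd : ¬ (v + 1) ∣ d'.u + 2 * d'.T

/-- Two consecutive odd numbers differ by 2, which is less than `v + 1`, so one of them is
admissible. -/
theorem exists_odd_not_dvd (hv : 3 ≤ v) (m s : ℕ) :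
    ∃ w, m ≤ w ∧ w ≤ m + 3 ∧ Odd w ∧ ¬ (v + 1) ∣ w + s := by
  obtain ⟨w, h1, h2, h3⟩ : ∃ w, m ≤ w ∧ w ≤ m + 1 ∧ Odd w := by
    rcases Nat.even_or_odd m with h | h
    · exact ⟨m + 1, by omega, le_rfl, h.add_one⟩
    · exact ⟨m, le_rfl, by omega, h⟩
  by_cases hd : (v + 1) ∣ w + s
  · refine ⟨w + 2, by omega, by omega, by
      obtain ⟨r, hr⟩ := h3; exact ⟨r + 1, by omega⟩, fun hd' => ?_⟩
    have := (Nat.dvd_add_right hd).1 (show (v + 1) ∣ (w + s) + 2 by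
      rwa [show w + s + 2 = w + 2 + s by ring])
    exact absurd (Nat.le_of_dvd (by omega) this) (by omega)
  · exact ⟨w, h1, by omega, h3, hd⟩

theorem Dims.exists_next (hv : 3 ≤ v) (d : Dims) : ∃ d', d.Next v d' := by
  have hv' : (3 : ℝ) ≤ v := by exact_mod_cast hv
  have hx : 0 < 1 / ((v : ℝ) - 1) := by apply one_div_pos.2; linarith
  have hq : 0 < 2.8 + 4.2 * (1 / ((v : ℝ) - 1)) := by linarith
  set q := 2.8 + 4.2 * (1 / ((v : ℝ) - 1)) with hqdef
  obtain ⟨w, h1, h2, h3, h4⟩ := exists_odd_not_dvd hv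
    ⌈((3 * d.b + 2 * d.a + 4 * d.u : ℕ) : ℝ) / q⌉₊
    (2 * ((2 * d.b + 2 * d.a + 3 * d.u + 2 * v * ((d.u + 1) / 2 + 2 * d.T) + 1) / (2 * (v + 1))))
  have c1 := Nat.le_ceil (((3 * d.b + 2 * d.a + 4 * d.u : ℕ) : ℝ) / q)
  have c2 := Nat.ceil_lt_add_one (a := ((3 * d.b + 2 * d.a + 4 * d.u : ℕ) : ℝ) / q) (by positivity)
  have h1' : (⌈((3 * d.b + 2 * d.a + 4 * d.u : ℕ) : ℝ) / q⌉₊ : ℝ) ≤ w := by exact_mod_cast h1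
  have h2' : (w : ℝ) ≤ (⌈((3 * d.b + 2 * d.a + 4 * d.u : ℕ) : ℝ) / q⌉₊ : ℝ) + 3 := by
    exact_mod_cast h2
  refine ⟨⟨_, _, w, _⟩, rfl, rfl, rfl, ?_, ?_, h3, h4⟩
  · exact ((div_le_iff₀ hq).1 (c1.trans h1')).trans (mul_comm _ _).le
  · exact (mul_comm _ _).le.trans ((le_div_iff₀ hq).1 (show (w : ℝ) - 4 ≤ _ by linarith))

/-- Multiplication by `x = 1 / (v - 1)` turns `v` into `1 + x` and `v + 1` into `1 + 2 * x`, so the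
real inequalities involve `x` alone. -/
theorem x_facts (hv : 3 ≤ v) : (1 / ((v : ℝ) - 1)) * v = 1 + 1 / ((v : ℝ) - 1) ∧
    0 < 1 / ((v : ℝ) - 1) ∧ 1 / ((v : ℝ) - 1) ≤ 1 / 2 := by
  have hv' : (3 : ℝ) ≤ v := by exact_mod_cast hv
  refine ⟨?_, one_div_pos.2 (by linarith), one_div_le_one_div_of_le (by norm_num) (by linarith)⟩
  have : (v : ℝ) - 1 ≠ 0 := by linarith
  field_simp
  ring

theorem life_cast {u T : ℕ} (h : Odd u) :
    (((u + 1) / 2 + 2 * T : ℕ) : ℝ) = (u : ℝ) / 2 + 1 / 2 + 2 * T := by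
  obtain ⟨r, rfl⟩ := h
  rw [show (2 * r + 1 + 1) / 2 = r + 1 by omega]
  push_cast; ring

/-- The quotient in `T_eq` is the least time at which the last message of the farther subgap has
passed. The bounds on the remainder give the two sides of the estimate for `T'`. -/
theorem Dims.Next.nextLevel (hv : 3 ≤ v) {d d' : Dims} (ho : Odd d.u) (h : d.Next v d') :
    NextLevel (1 / ((v : ℝ) - 1)) d.a d.b d.u d.T ((d.u + 1) / 2 + 2 * d.T : ℕ)
      d'.a d'.b d'.u d'.T := by
  obtain ⟨hx, hx0, -⟩ := x_facts hv
  have hD := life_cast (T := d.T) ho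
  have hu1 := h.u_ge
  have hu2 := h.u_le
  have t1 := Nat.div_add_mod
    (2 * d.b + 2 * d.a + 3 * d.u + 2 * v * ((d.u + 1) / 2 + 2 * d.T) + 1) (2 * (v + 1))
  have t2 := Nat.mod_lt
    (2 * d.b + 2 * d.a + 3 * d.u + 2 * v * ((d.u + 1) / 2 + 2 * d.T) + 1)
    (show 0 < 2 * (v + 1) by omega)
  rw [← h.T_eq] at t1
  generalize (2 * d.b + 2 * d.a + 3 * d.u + 2 * v * ((d.u + 1) / 2 + 2 * d.T) + 1) % (2 * (v + 1))
    = r at *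
  generalize (d.u + 1) / 2 + 2 * d.T = D at *
  generalize 1 / ((v : ℝ) - 1) = x at *
  have t1' : (2 * ((v : ℝ) + 1)) * d'.T + r = 2 * d.b + 2 * d.a + 3 * d.u + 2 * v * D + 1 := by
    exact_mod_cast t1
  have t2' : (r : ℝ) + 1 ≤ 2 * (v + 1) := by exact_mod_cast t2
  have t3 := congrArg (fun z => x / 2 * z) t1'
  have t4 := mul_le_mul_of_nonneg_left t2' hx0.le
  have t5 : 0 ≤ x * r := by positivity
  have e1 : x * v * d'.T = (1 + x) * d'.T := by rw [hx]
  have e2 : x * v * D = (1 + x) * D := by rw [hx]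
  constructor
  · rw [h.a_eq]; push_cast; ring
  · rw [h.b_eq]; push_cast; ring
  · exact hu1
  · exact hu2
  · rw [hD]; linarith
  · rw [hD]; linarith
  · nlinarith
  · nlinarith

theorem Dims.Ok.next (hv : 3 ≤ v) {d d' : Dims} (hd : d.Ok v) (h : d.Next v d') : d'.Ok v := by
  refine ⟨hd.balanced.next (h.nextLevel hv hd.odd), h.odd, ?_⟩
  rw [h.a_eq]
  obtain ⟨r, hr⟩ := hd.even
  exact ⟨d.b + r + d.u, by omega⟩

/-- Dimensions for the first level. -/
theorem exists_first (hv : 3 ≤ v) : ∃ d : Dims, d.Ok v ∧ d.u = (v - 1) * d.T + 1 ∧ 3 ∣ d.T ∧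
    d.a % 3 = 2 ∧ d.b % 3 = 2 ∧ (v + 1) * d.T + 1 < d.a := by
  obtain ⟨hx, hx0, hx2⟩ := x_facts hv
  have hx1 : 1 / ((v : ℝ) - 1) * (v - 1) = 1 := by linarith
  set x := 1 / ((v : ℝ) - 1) with hxdef
  -- The foam criterion forces `u = (v - 1) * T + 1` at level one. The time 6000000 is divisible by
  -- 3, even (so that `u` is odd), and large enough for the bound on `u`.
  obtain ⟨u, hu⟩ : ∃ u, u = (v - 1) * 6000000 + 1 := ⟨_, rfl⟩
  have hu' : (u : ℝ) = (v - 1) * 6000000 + 1 := by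
    rw [hu]; push_cast [Nat.cast_sub (show 1 ≤ v by omega)]; ring
  have hubig : (12000001 : ℝ) ≤ u := by
    have hv' : (3 : ℝ) ≤ v := by exact_mod_cast hv
    linarith
  have hxu : x * (u - 1) = 6000000 := by rw [hu']; linarith
  obtain ⟨f, hf⟩ : ∃ f, f = ⌊(2.8 + 4.2 * x) * u⌋₊ := ⟨_, rfl⟩
  have hqu : 2.8 * u ≤ (2.8 + 4.2 * x) * u := by nlinarith
  have f1 : (f : ℝ) ≤ (2.8 + 4.2 * x) * u := by rw [hf]; exact Nat.floor_le (by positivity)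
  have f2 : (2.8 + 4.2 * x) * u < f + 1 := by rw [hf]; exact Nat.lt_floor_add_one _
  have hfbig : 30000000 ≤ f := by
    have : (30000000 : ℝ) ≤ f := by linarith
    exact_mod_cast this
  -- The largest `b` congruent to 2 modulo 3 below the maximal proportion; next, `a` is about `0.6 *
  -- b`, even and congruent to 2 modulo 3.
  obtain ⟨b, hb⟩ : ∃ b, b + 1 = 3 * (f / 3) := ⟨3 * (f / 3) - 1, by omega⟩
  have b1 : (b : ℝ) ≤ f := by exact_mod_cast (show b ≤ f by omega)
  have b2 : (f : ℝ) ≤ b + 3 := by exact_mod_cast (show f ≤ b + 3 by omega)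
  obtain ⟨a, ha⟩ : ∃ a, a = 6 * (b / 10) + 2 := ⟨_, rfl⟩
  have a1 : (10 : ℝ) * a ≤ 6 * b + 20 := by exact_mod_cast (show 10 * a ≤ 6 * b + 20 by omega)
  have a2 : (6 : ℝ) * b ≤ 10 * a + 60 := by exact_mod_cast (show 6 * b ≤ 10 * a + 60 by omega)
  refine ⟨⟨a, b, u, 6000000⟩, ⟨⟨hx0, hx2, ?_, ?_, ?_, ?_, ?_, ?_, ?_⟩, ?_, ?_⟩, hu, by norm_num,
    ?_, ?_, ?_⟩
  · simp only; linarith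
  · simp only; linarith
  · simp only; linarith
  · simp only; linarith
  · simp only; linarith
  · simp only; rw [← hxdef, hxu]; norm_num
  · simp only
    rw [← hxdef]
    have : 0 ≤ (0.142 + 0.5 * x - 0.45 * x ^ 2) * u := by
      refine mul_nonneg ?_ (by linarith)
      nlinarith
    norm_num
    nlinarith
  · exact ⟨(v - 1) * 3000000, by simp only; omega⟩
  · exact ⟨3 * (b / 10) + 1, by simp only; omega⟩
  · simp only; omega
  · simp only; omega
  · simp only
    have : ((v : ℝ) + 1) * 6000000 + 1 < a := by
      have : (v : ℝ) * 6000000 = u - 1 + 6000000 := by rw [hu']; ring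
      nlinarith
    exact_mod_cast this

/-- Write `M = (v + 1) * e + r`. A nonzero remainder lies between 1 and `v`, so `k = v * e + r` has
emission delay exactly `e`. -/
theorem exists_ray {M : ℕ} (h : ¬ (v + 1) ∣ M) :
    ∃ k e, (k - 1) / v = e ∧ k + e = M ∧ (v + 1) * e + 1 ≤ M ∧ M ≤ (v + 1) * e + v := by
  have h1 := Nat.div_add_mod M (v + 1)
  have h2 := Nat.mod_lt M (show 0 < v + 1 by omega)
  have h3 : M % (v + 1) ≠ 0 := fun h0 => h (Nat.dvd_of_mod_eq_zero h0)
  generalize M / (v + 1) = e at *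
  generalize M % (v + 1) = r at *
  refine ⟨v * e + r, e, ?_, by rw [← h1]; ring, by omega, by omega⟩
  rw [Nat.add_sub_assoc (by omega), Nat.mul_add_div (by omega), Nat.div_eq_of_lt (by omega),
    Nat.add_zero]

/-- Admissible widths. -/
theorem Dims.ray (hv : 3 ≤ v) {d d' : Dims} (hd : d.Ok v) (h : d.Next v d') {w D : ℕ}
    (hw : 100 * w ≤ 101 * d'.u) (hdvd : ¬ (v + 1) ∣ w + 2 * d'.T)
    (hD : (D : ℝ) ≤ (0.15 + 0.56 * (1 / ((v : ℝ) - 1))) * d.u) :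
    ∃ k, k + (k - 1) / v = w + 2 * d'.T ∧ D + (k - 1) / v ≤ d'.T ∧
      2 * d'.T + k < d'.a + (k - 1) / v := by
  obtain ⟨hx, hx0, hx2⟩ := x_facts hv
  have hn := h.nextLevel hv hd.odd
  have hw' : (100 : ℝ) * w ≤ 101 * d'.u := by exact_mod_cast hw
  have h1 := hd.balanced.early hn hw'
  have h2 := hd.balanced.late hn hw'
  obtain ⟨k, e, hk, h3, h4, h5⟩ := exists_ray hdvd
  generalize 1 / ((v : ℝ) - 1) = x at *
  have h3' : (k : ℝ) + e = w + 2 * d'.T := by exact_mod_cast h3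
  have h4' : ((v : ℝ) + 1) * e + 1 ≤ w + 2 * d'.T := by exact_mod_cast h4
  have h5' : (w : ℝ) + 2 * d'.T ≤ (v + 1) * e + v := by exact_mod_cast h5
  have m1 := mul_le_mul_of_nonneg_left h4' hx0.le
  have m2 := mul_le_mul_of_nonneg_left h5' hx0.le
  have e1 : x * v * e = (1 + x) * e := by rw [hx]
  have m3 := mul_le_mul_of_nonneg_left hD (show 0 ≤ 1 + 2 * x by linarith)
  refine ⟨k, by rw [hk, h3], ?_, ?_⟩ <;> rw [hk]
  · have : (D : ℝ) + e ≤ d'.T := by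
      refine le_of_mul_le_mul_left ?_ (show 0 < 1 + 2 * x by linarith)
      linarith
    exact_mod_cast this
  · have : 2 * (d'.T : ℝ) + k < d'.a + e := by
      refine lt_of_mul_lt_mul_left ?_ (show 0 ≤ 1 + 2 * x by linarith)
      have : (1 + 2 * x) * k = (1 + 2 * x) * (w + 2 * d'.T - e) := by rw [← h3']; ring
      linarith
    exact_mod_cast this

theorem Dims.near (hv : 3 ≤ v) {d d' : Dims} (hd : d.Ok v) (h : d.Next v d') {t : ℕ}
    (ht : d'.u ≤ (v - 1) * t + v) :
    2 * d.b + d.u < 2 * (t + v * (t + 1)) + 1 ∧ d.b + d.u < d'.u + 2 * t := by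
  obtain ⟨hx, hx0, hx2⟩ := x_facts hv
  have h1 := hd.balanced.near (h.nextLevel hv hd.odd)
  have ht' : (d'.u : ℝ) ≤ (v - 1) * t + v := by
    have : (d'.u : ℝ) ≤ ((v - 1 : ℕ) : ℝ) * t + v := by exact_mod_cast ht
    rwa [Nat.cast_sub (by omega), Nat.cast_one] at this
  generalize 1 / ((v : ℝ) - 1) = x at *
  have m1 := mul_le_mul_of_nonneg_left ht' hx0.le
  have e1 : x * v * t = (1 + x) * t := by rw [hx]
  have m2 : x * d'.u ≤ t + 1 + x := by nlinarith
  constructor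
  · have : 2 * (d.b : ℝ) + d.u < 2 * (t + v * (t + 1)) + 1 := by
      have e2 : 2 * x * ((v - 1) * t + v) = 2 * t + 2 + 2 * x := by nlinarith
      have e3 : (0 : ℝ) ≤ d.u := by positivity
      nlinarith
    exact_mod_cast this
  · have : (d.b : ℝ) + d.u < d'.u + 2 * t := by nlinarith
    exact_mod_cast this

theorem Dims.far (hv : 3 ≤ v) {d d' : Dims} (hd : d.Ok v) (h : d.Next v d') {t : ℕ}
    (ht : 2 * d.b + d.u + 2 * v * ((d.u + 1) / 2 + 2 * d.T) ≤ 2 * (v + 1) * t + 2 * v) :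
    2 * d.b + 2 * d.a + 3 * d.u < 2 * (t + v * (t + 1)) + 1 ∧
      d.b + d.u + d.a + d.u < d'.u + 2 * t := by
  obtain ⟨hx, hx0, hx2⟩ := x_facts hv
  have hn := h.nextLevel hv hd.odd
  have h1 := hd.balanced.far_left hn
  have h2 := fun t => hd.balanced.far_right hn (t := t)
  generalize (d.u + 1) / 2 + 2 * d.T = D at *
  have ht' : 2 * (d.b : ℝ) + d.u + 2 * v * D ≤ 2 * (v + 1) * t + 2 * v := by exact_mod_cast ht
  generalize 1 / ((v : ℝ) - 1) = x at *
  have m1 := mul_le_mul_of_nonneg_left ht' hx0.le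
  have e1 : x * v * t = (1 + x) * t := by rw [hx]
  have e2 : x * v * D = (1 + x) * D := by rw [hx]
  constructor
  · have h3 : (d.a : ℝ) + d.u ≤ v * D := by
      refine le_of_mul_le_mul_left ?_ hx0
      linarith
    have h4 : d.a + d.u ≤ v * D := by exact_mod_cast h3
    have : 2 * (v + 1) * t + 2 * v = 2 * (t + v * (t + 1)) := by ring
    have : 2 * v * D = 2 * (v * D) := by ring
    omega
  · have := h2 t (by nlinarith)
    have h4 : (d.b : ℝ) + d.u + d.a + d.u < d'.u + 2 * t := by linarith
    exact_mod_cast h4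

end Scale

/-! ### Existence of a valid scale -/

namespace Scale

variable {v : ℕ}

/-- A valid scale whose proportions are controlled. -/
structure Good (v : ℕ) (c : Scale) : Prop where
  valid : c.Valid v
  wide : ∀ n, 2 ≤ n → ∀ w, Odd w → c.u n ≤ w → 100 * w ≤ 101 * c.u n →
    ¬ (v + 1) ∣ w + 2 * c.T n → c.Wide v n w
  not_dvd : ∀ n, 2 ≤ n → ¬ (v + 1) ∣ c.u n + 2 * c.T n
  odd : ∀ n, 1 ≤ n → Odd (c.u n)
  even : ∀ n, 1 ≤ n → Even (c.a n)
  u_le : ∀ n, 1 ≤ n → c.u n ≤ c.b n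
  b_le : ∀ n, 1 ≤ n → c.b n ≤ 5 * c.u n
  b_le_a : ∀ n, 1 ≤ n → c.b n ≤ 2 * c.a n
  life_le : ∀ n, 1 ≤ n → c.life n ≤ 3 * c.u n
  u_ge : ∀ n, 1 ≤ n → 2000000 ≤ c.u n

theorem Dims.Ok.facts (hv : 3 ≤ v) {d : Dims} (h : d.Ok v) : d.a ≤ d.b ∧ d.u ≤ d.b ∧
    d.b ≤ 5 * d.u ∧ d.b ≤ 2 * d.a ∧ (d.u + 1) / 2 + 2 * d.T ≤ 3 * d.u ∧ 2000000 ≤ d.u := by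
  obtain ⟨hx, hx0, hx2⟩ := x_facts hv
  have hD := life_cast (T := d.T) h.odd
  have hb := h.balanced
  have h1 := hb.b_pos
  have h2 := hb.u_le_b
  have h3 := hb.b_le_u
  have h4 := hb.a_ge
  have h5 := hb.a_le
  have h6 := hb.T_le
  have h7 := hb.u_ge
  generalize (d.u + 1) / 2 + 2 * d.T = D at *
  generalize 1 / ((v : ℝ) - 1) = x at *
  have h8 : (0.142 + 1.5 * x - 0.45 * x ^ 2) * d.u ≤ 0.9 * d.u := by
    refine mul_le_mul_of_nonneg_right ?_ (by linarith)
    nlinarith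
  refine ⟨?_, ?_, ?_, ?_, ?_, ?_⟩
  · have : (d.a : ℝ) ≤ d.b := by linarith
    exact_mod_cast this
  · have : (d.u : ℝ) ≤ d.b := by linarith
    exact_mod_cast this
  · have : (d.b : ℝ) ≤ 5 * d.u := by linarith
    exact_mod_cast this
  · have : (d.b : ℝ) ≤ 2 * d.a := by linarith
    exact_mod_cast this
  · have : (D : ℝ) ≤ 3 * d.u := by linarith
    exact_mod_cast this
  · exact_mod_cast h7

theorem Dims.Next.facts (hv : 3 ≤ v) {d d' : Dims} (hd : d.Ok v) (h : d.Next v d') :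
    d.u ≤ d'.u ∧ (((d.u + 1) / 2 + 2 * d.T : ℕ) : ℝ) ≤
      (0.15 + 0.56 * (1 / ((v : ℝ) - 1))) * d'.u ∧
      (d.u + 1) / 2 + 2 * d.T ≤ (d'.u + 1) / 2 + 2 * d'.T := by
  obtain ⟨hx, hx0, hx2⟩ := x_facts hv
  have hn := h.nextLevel hv hd.odd
  have h1 := hd.balanced.D_le hn
  have h2 := (hd.balanced.u_next_ge hn).1
  have hD := life_cast (T := d'.T) h.odd
  refine ⟨?_, h1, ?_⟩
  · have : (d.u : ℝ) ≤ d'.u := by linarith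
    exact_mod_cast this
  · generalize (d.u + 1) / 2 + 2 * d.T = D at *
    generalize (d'.u + 1) / 2 + 2 * d'.T = D' at *
    generalize 1 / ((v : ℝ) - 1) = x at *
    have h3 : (0.15 + 0.56 * x) * d'.u ≤ 0.5 * d'.u :=
      mul_le_mul_of_nonneg_right (by linarith) (by positivity)
    have h4 : (0 : ℝ) ≤ d'.T := by positivity
    have : (D : ℝ) ≤ D' := by linarith
    exact_mod_cast this

/-- The scale given by a sequence of dimensions. -/
def ofDims (f : ℕ → Dims) : Scale where
  a n := match n with | 0 => 0 | n + 1 => (f n).a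
  b n := match n with | 0 => 0 | n + 1 => (f n).b
  u n := match n with | 0 => 1 | n + 1 => (f n).u
  T n := match n with | 0 => 0 | n + 1 => (f n).T

theorem exists_dims (hv : 3 ≤ v) : ∃ f : ℕ → Dims, (∀ n, (f n).Ok v) ∧
    (∀ n, (f n).Next v (f (n + 1))) ∧ (f 0).u = (v - 1) * (f 0).T + 1 ∧ 3 ∣ (f 0).T ∧
    (f 0).a % 3 = 2 ∧ (f 0).b % 3 = 2 ∧ (v + 1) * (f 0).T + 1 < (f 0).a := by
  obtain ⟨d, hd, h⟩ := exists_first hv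
  choose g hg using Dims.exists_next (v := v) hv
  refine ⟨fun n => g^[n] d, ?_, ?_, h⟩
  · intro n
    induction n with
    | zero => exact hd
    | succ n ih =>
      simp only [Function.iterate_succ_apply']
      exact ih.next hv (hg _)
  · intro n
    simp only [Function.iterate_succ_apply']
    exact hg _

theorem exists_good (hv : 3 ≤ v) : ∃ c : Scale, c.Good v := by
  obtain ⟨f, hok, hnext, f1, f2, f3, f4, f5⟩ := exists_dims hv
  obtain ⟨hx, hx0, hx2⟩ := x_facts hv
  have facts := fun n => (hok n).facts hv
  have nfacts := fun n => (hnext n).facts hv (hok n)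
  have lifep : ∀ n, ((ofDims f).life n : ℝ) ≤
      (0.15 + 0.56 * (1 / ((v : ℝ) - 1))) * (f n).u := by
    intro n
    cases n with
    | zero =>
      have := (hok 0).balanced.u_ge
      have h1 : ((ofDims f).life 0 : ℝ) = 1 := by simp [life, ofDims]
      rw [h1]
      nlinarith
    | succ n => exact (nfacts n).2.1
  have hwide : ∀ n, 2 ≤ n → ∀ w, Odd w → (ofDims f).u n ≤ w → 100 * w ≤ 101 * (ofDims f).u n →
      ¬ (v + 1) ∣ w + 2 * (ofDims f).T n → (ofDims f).Wide v n w := by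
    intro n hn w h1 h2 h3 h4
    obtain ⟨n, rfl⟩ : ∃ k, n = k + 2 := ⟨n - 2, by omega⟩
    exact ⟨h1, h2, Dims.ray hv (hok n) (hnext n) h3 h4 (lifep n)⟩
  have hndvd : ∀ n, 2 ≤ n → ¬ (v + 1) ∣ (ofDims f).u n + 2 * (ofDims f).T n := by
    intro n hn
    obtain ⟨n, rfl⟩ : ∃ k, n = k + 2 := ⟨n - 2, by omega⟩
    exact (hnext n).not_dvd
  have shift : ∀ {p : ℕ → Prop}, (∀ n, p (n + 1)) → ∀ n, 1 ≤ n → p n := by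
    intro p h n hn
    obtain ⟨n, rfl⟩ : ∃ k, n = k + 1 := ⟨n - 1, by omega⟩
    exact h n
  have hodd : ∀ n, 1 ≤ n → Odd ((ofDims f).u n) := shift fun n => (hok n).odd
  have Tdiv : ∀ n, _ := fun n => Nat.div_add_mod
    (2 * (f n).b + 2 * (f n).a + 3 * (f n).u + 2 * v * (((f n).u + 1) / 2 + 2 * (f n).T) + 1)
    (2 * (v + 1))
  have Tmod : ∀ n, _ := fun n => Nat.mod_lt
    (2 * (f n).b + 2 * (f n).a + 3 * (f n).u + 2 * v * (((f n).u + 1) / 2 + 2 * (f n).T) + 1)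
    (show 0 < 2 * (v + 1) by omega)
  refine ⟨ofDims f, ⟨⟨shift ?_, shift ?_, shift ?_, shift ?_, shift ?_⟩, rfl, rfl, f1,
    (hok 0).odd, f2, f3, f4, f5, ?_, shift ?_, shift ?_, ?_, shift ?_, shift ?_⟩, hwide, hndvd,
    hodd, shift ?_, shift ?_, shift ?_, shift ?_, shift ?_, shift ?_⟩
  · intro n; exact (hnext n).a_eq.trans (by rfl)
  · intro n; exact (hnext n).b_eq.trans (by rfl)
  · intro n; exact (facts n).1
  · intro n; exact (nfacts n).1
  · intro n
    have := (facts n).2.2.2.2.2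
    show 1 ≤ (f n).u
    omega
  · refine monotone_nat_of_le_succ fun n => ?_
    cases n with
    | zero =>
      have := (facts 0).2.2.2.2.2
      show (1 + 1) / 2 + 2 * 0 ≤ ((f 0).u + 1) / 2 + 2 * (f 0).T
      omega
    | succ n => exact (nfacts n).2.2
  · intro n
    have h1 := Tdiv n
    have h2 := Tmod n
    rw [← (hnext n).T_eq] at h1
    show 2 * (f n).b + 2 * (f n).a + 3 * (f n).u + 2 * v * (((f n).u + 1) / 2 + 2 * (f n).T) ≤
      2 * (v + 1) * (f (n + 1)).T + 2 * v
    omega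
  · intro n t ht
    have h1 := Tdiv n
    rw [← (hnext n).T_eq] at h1
    -- Minimality of `T`: one step earlier, the last message of the farther subgap has not yet
    -- passed.
    have h2 : 2 * (v + 1) * t + 2 * (v + 1) ≤ 2 * (v + 1) * (f (n + 1)).T := by
      rw [← Nat.mul_succ]; exact Nat.mul_le_mul_left _ ht
    show 2 * (v + 1) * t + 2 * v <
      2 * (f n).b + 2 * (f n).a + 3 * (f n).u + 2 * v * (((f n).u + 1) / 2 + 2 * (f n).T)
    omega
  · exact fun n hn => hwide n hn _ (hodd n (by omega)) le_rfl (by omega) (hndvd n hn)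
  · intro n t _ ht
    exact Dims.near hv (hok n) (hnext n) ht
  · intro n t _ ht
    exact Dims.far hv (hok n) (hnext n) ht
  · exact fun n => (hok n).even
  · exact fun n => (facts n).2.1
  · exact fun n => (facts n).2.2.1
  · exact fun n => (facts n).2.2.2.1
  · exact fun n => (facts n).2.2.2.2.1
  · exact fun n => (facts n).2.2.2.2.2

end Scale

/-! ### Number of filled links and its growth exponent -/

namespace Scale

variable {c : Scale} {N : ℕ} {s : ℤ → ℤ} {v : ℕ}

open Classical in
/-- The number of initially filled links in an interval. -/
noncomputable def count (S : Set Gap) (x y : ℤ) : ℕ :=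
  ((Finset.Ico x y).filter fun l => filled S 0 l).card

theorem count_le_add (S : Set Gap) (x y z : ℤ) : count S x z ≤ count S x y + count S y z := by
  unfold count
  rw [← Finset.card_union_add_card_inter]
  refine le_trans (Finset.card_le_card ?_) (Nat.le_add_right _ _)
  intro l hl
  simp only [Finset.mem_filter, Finset.mem_Ico, Finset.mem_union] at *
  rcases lt_or_ge l y with h | h
  · exact Or.inl ⟨⟨hl.1.1, h⟩, hl.2⟩
  · exact Or.inr ⟨⟨h, hl.1.2⟩, hl.2⟩

theorem count_le (S : Set Gap) (x : ℤ) (k : ℕ) : count S x (x + k) ≤ k := by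
  classical
  unfold count
  refine (Finset.card_filter_le _ _).trans ?_
  simp

theorem count_gap {S : Set Gap} {g : Gap} (hg : g ∈ S) :
    count S g.x (g.x + g.u) = 0 := by
  classical
  unfold count
  rw [Finset.card_eq_zero, Finset.filter_eq_empty_iff]
  intro l hl h
  rw [Finset.mem_Ico] at hl
  refine h g hg (by unfold Gap.life; omega) ?_
  unfold Gap.left Gap.right
  rw [Gap.ext_of_le (Nat.zero_le _)]
  push_cast
  omega

/-- An upper bound for the numbers of filled links in the pieces, for short and for long pieces. -/
def weight (K : ℕ) : ℕ → ℕ × ℕ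
  | 0 => (0, 0)
  | 1 => (K, K)
  | n + 2 => (2 * (weight K (n + 1)).2 + (weight K (n + 1)).1,
      3 * (weight K (n + 1)).2 + 2 * (weight K (n + 1)).1)

theorem Piece.count_le (hc : c.Recursive) {n : ℕ} (hn : 1 ≤ n) {τ : Bool} {y : ℤ}
    (h : c.Piece N s n τ y) : count (c.gaps N s) y (y + c.len τ n) ≤
      if τ then (weight (c.b 1) n).2 else (weight (c.b 1) n).1 := by
  induction n, hn using Nat.le_induction generalizing τ y with
  | base =>
    refine (Scale.count_le _ _ _).trans ?_
    have := hc.a_le_b 1 le_rfl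
    cases τ <;> simp [weight, this]
  | succ n hn ih =>
    have h1 := hc.a_succ n hn
    have h2 := hc.b_succ n hn
    obtain ⟨m, rfl⟩ : ∃ m, n = m + 1 := ⟨n - 1, by omega⟩
    have step : ∀ {x z z' : ℤ} {σ : Bool} {g : Gap}, c.Piece N s (m + 1) σ x →
        c.GapAt N s (m + 1) g → g.x = x + c.len σ (m + 1) → g.x + g.u = z →
        count (c.gaps N s) x z' ≤ (if σ then (weight (c.b 1) (m + 1)).2
          else (weight (c.b 1) (m + 1)).1) + count (c.gaps N s) z z' := by
      intro x z z' σ g p hg hx hz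
      have a1 := ih p
      have a2 := count_gap (S := c.gaps N s) ⟨_, hg⟩
      have a3 := count_le_add (c.gaps N s) x (x + c.len σ (m + 1)) z'
      have a4 := count_le_add (c.gaps N s) (x + c.len σ (m + 1)) z z'
      rw [hz, hx] at a2
      omega
    cases τ
    · have s1 := step (z' := y + c.len false (m + 1 + 1)) (Piece.a₁ hn h) (GapAt.inner₁ hn h) rfl
        rfl
      have s2 := step (z' := y + c.len false (m + 1 + 1)) (Piece.a₂ hn h) (GapAt.inner₂ hn h) rfl
        rfl
      have s3 := ih (Piece.a₃ hn h)
      have e : y + c.len false (m + 1 + 1) =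
          y + c.b (m + 1) + c.u (m + 1) + c.a (m + 1) + c.u (m + 1) + c.len true (m + 1) := by
        simp only [len_true, len_false]; omega
      rw [← e] at s3
      simp only [if_true, Bool.false_eq_true, if_false] at *
      simp only [weight]
      omega
    · have s1 := step (z' := y + c.len true (m + 1 + 1)) (Piece.b₁ hn h) (GapAt.inner₁ hn h) rfl
        rfl
      have s2 := step (z' := y + c.len true (m + 1 + 1)) (Piece.b₂ hn h) (GapAt.inner₂ hn h) rfl
        rfl
      have s3 := step (z' := y + c.len true (m + 1 + 1)) (Piece.b₃ hn h) (GapAt.inner₃ hn h) rfl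
        rfl
      have s4 := step (z' := y + c.len true (m + 1 + 1)) (Piece.b₄ hn h) (GapAt.inner₄ hn h) rfl
        rfl
      have s5 := ih (Piece.b₅ hn h)
      have e : y + c.len true (m + 1 + 1) =
          y + c.b (m + 1) + c.u (m + 1) + c.a (m + 1) + c.u (m + 1) + c.b (m + 1) + c.u (m + 1) +
            c.a (m + 1) + c.u (m + 1) + c.len true (m + 1) := by
        simp only [len_true]; omega
      rw [← e] at s5
      simp only [if_true, Bool.false_eq_true, if_false] at *
      simp only [weight]
      omega

/-- The number of filled links in a row of top pieces. -/
theorem count_top_le (hc : c.Recursive) (hs : c.Spaced N s) (hN : 1 ≤ N) (i : ℤ) (k : ℕ) :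
    count (c.gaps N s) (s i) (s (i + k)) ≤ k * (weight (c.b 1) N).1 := by
  induction k with
  | zero => simp [count]
  | succ k ih =>
    have a1 := (Piece.top (c := c) (N := N) (s := s) (i + k)).count_le hc hN
    have hu := hc.u_pos N hN
    have hw := hs.toNat (i + k)
    have := hs (i + k)
    have a2 := count_gap (S := c.gaps N s) ⟨_, GapAt.top (i + k)⟩
    simp only at a2
    rw [hw, show s (i + k) + c.a N + (s (i + k + 1) - s (i + k) - c.a N) = s (i + k + 1) by ring]
      at a2
    have a3 := count_le_add (c.gaps N s) (s i) (s (i + k)) (s (i + (k + 1 : ℕ)))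
    have a4 := count_le_add (c.gaps N s) (s (i + k)) (s (i + k) + c.a N) (s (i + (k + 1 : ℕ)))
    rw [show i + ((k + 1 : ℕ) : ℤ) = i + k + 1 by push_cast; ring] at *
    simp only [len_false, Bool.false_eq_true, if_false] at a1
    rw [Nat.succ_mul]
    omega

/-- The recursion has top eigenvalue `2 + √5` with eigenvector the golden ratio. The rounded-up
values 4.24 and 1.62 still form a supersolution. -/
theorem weight_le (K : ℕ) {n : ℕ} (hn : 1 ≤ n) :
    ((weight K n).1 : ℝ) ≤ K * 4.24 ^ n ∧ ((weight K n).2 : ℝ) ≤ 1.62 * K * 4.24 ^ n := by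
  induction n, hn using Nat.le_induction with
  | base =>
    have : (0 : ℝ) ≤ K := by positivity
    constructor <;> simp only [weight, pow_one] <;> linarith
  | succ n hn ih =>
    obtain ⟨m, rfl⟩ : ∃ m, n = m + 1 := ⟨n - 1, by omega⟩
    obtain ⟨h1, h2⟩ := ih
    have h3 : (0 : ℝ) ≤ K * 4.24 ^ (m + 1) := by positivity
    rw [pow_succ _ (m + 1)]
    simp only [weight]
    push_cast
    constructor <;> linarith

/-- The combination `2 * b + a` grows by a factor of at least 5 per level, because `b ≤ 5 * u`. -/
theorem Good.growth (hc : c.Good v) {n : ℕ} (hn : 1 ≤ n) : 5 ^ n ≤ c.u n := by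
  have h : 15 * 5 ^ n ≤ 2 * c.b n + c.a n := by
    induction n, hn using Nat.le_induction with
    | base =>
      have := hc.u_le 1 le_rfl
      have := hc.u_ge 1 le_rfl
      omega
    | succ n hn ih =>
      have := hc.valid.recursive.a_succ n hn
      have := hc.valid.recursive.b_succ n hn
      have := hc.b_le n hn
      rw [pow_succ]
      omega
  have := hc.b_le n hn
  have := hc.valid.recursive.a_le_b n hn
  omega

theorem Good.period_succ (hc : c.Good v) {n : ℕ} (hn : 1 ≤ n) : c.u (n + 1) ≤ 10 * c.u n * 5 ∧
    c.a (n + 1) + c.u (n + 1) ≤ 50 * (c.a n + c.u n) := by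
  have h1 := hc.valid.recursive.a_succ n hn
  have h2 := hc.valid.recursive.b_succ n hn
  have h3 := hc.b_le n hn
  have h4 := hc.b_le_a n hn
  have h5 := hc.u_le (n + 1) (by omega)
  have h6 := hc.valid.recursive.a_le_b n hn
  have h7 := hc.valid.recursive.a_le_b (n + 1) (by omega)
  omega

/-- The number of filled links in a short piece is at most a small power of its length. -/
theorem weight_le_rpow (hc : c.Good v) : ∃ K : ℝ, 0 < K ∧ ∀ n, 1 ≤ n →
    ((weight (c.b 1) n).1 : ℝ) ≤ K * (c.u n : ℝ) ^ (44 / 49 : ℝ) := by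
  refine ⟨c.b 1, ?_, ?_⟩
  · have := hc.u_le 1 le_rfl
    have := hc.u_ge 1 le_rfl
    exact_mod_cast (show 0 < c.b 1 by omega)
  · intro n hn
    refine (weight_le _ hn).1.trans (mul_le_mul_of_nonneg_left ?_ (by positivity))
    have h1 : (5 : ℝ) ^ n ≤ c.u n := by exact_mod_cast hc.growth hn
    -- Reduces to the numerical inequality `4.24 ^ 49 ≤ 5 ^ 44`.
    have h2 : (4.24 : ℝ) ≤ 5 ^ (44 / 49 : ℝ) := by
      have : (4.24 : ℝ) = ((4.24 : ℝ) ^ (49 : ℕ)) ^ ((49 : ℕ) : ℝ)⁻¹ := by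
        rw [Real.pow_rpow_inv_natCast (by norm_num) (by norm_num)]
      rw [this, show (44 / 49 : ℝ) = ((44 : ℕ) : ℝ) * ((49 : ℕ) : ℝ)⁻¹ by norm_num,
        Real.rpow_mul (by norm_num), Real.rpow_natCast]
      exact Real.rpow_le_rpow (by norm_num) (by norm_num) (by positivity)
    calc (4.24 : ℝ) ^ n ≤ ((5 : ℝ) ^ (44 / 49 : ℝ)) ^ n := pow_le_pow_left₀ (by norm_num) h2 n
      _ = ((5 : ℝ) ^ n) ^ (44 / 49 : ℝ) := by
        rw [← Real.rpow_natCast, ← Real.rpow_mul (by norm_num), mul_comm,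
          Real.rpow_mul (by norm_num), Real.rpow_natCast]
      _ ≤ _ := Real.rpow_le_rpow (by positivity) h1 (by norm_num)

/-- Equivalent to `6 ^ 44 < 5 ^ 49`. -/
theorem lt_logb : (44 / 49 : ℝ) < Real.logb 6 5 := by
  rw [Real.lt_logb_iff_rpow_lt (by norm_num) (by norm_num)]
  have : (5 : ℝ) = ((5 : ℝ) ^ (49 : ℕ)) ^ ((49 : ℕ) : ℝ)⁻¹ := by
    rw [Real.pow_rpow_inv_natCast (by norm_num) (by norm_num)]
  rw [this, show (44 / 49 : ℝ) = ((44 : ℕ) : ℝ) * ((49 : ℕ) : ℝ)⁻¹ by norm_num,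
    Real.rpow_mul (by norm_num), Real.rpow_natCast]
  exact Real.rpow_lt_rpow (by norm_num) (by norm_num) (by positivity)

/-- A multiple of a small power is eventually below the target power. -/
theorem exists_mul_rpow_le (K : ℝ) : ∃ X₀ : ℝ, ∀ X ≥ X₀,
    K * X ^ (44 / 49 : ℝ) ≤ X ^ Real.logb 6 5 := by
  have h : 0 < Real.logb 6 5 - 44 / 49 := sub_pos.2 lt_logb
  obtain ⟨X₀, hX⟩ := Filter.eventually_atTop.1
    ((tendsto_rpow_atTop h).eventually (Filter.eventually_ge_atTop K))
  refine ⟨max X₀ 1, fun X hX' => ?_⟩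
  have h1 := hX X (le_trans (le_max_left _ _) hX')
  have h2 : 0 < X := lt_of_lt_of_le one_pos (le_trans (le_max_right _ _) hX')
  calc K * X ^ (44 / 49 : ℝ) ≤ X ^ (Real.logb 6 5 - 44 / 49) * X ^ (44 / 49 : ℝ) :=
        mul_le_mul_of_nonneg_right h1 (by positivity)
    _ = _ := by rw [← Real.rpow_add h2]; congr 1; ring

end Scale

/-! ### Periodic patterns and rings of arbitrary length -/

theorem IsRun.translate {v τ : ℕ} {h : ℕ → ℤ → Prop} (hh : IsRun v h τ) (d : ℤ) :
    IsRun v (fun t l => h t (l + d)) τ := by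
  have e1 : ∀ t p, LineAnyon (fun t l => h t (l + d)) t p ↔ LineAnyon h t (p + d) := by
    intro t p
    unfold LineAnyon
    simp only [show p - 1 + d = p + d - 1 by ring]
  have e2 : ∀ t p k, SeesRight v (fun t l => h t (l + d)) t p k ↔ SeesRight v h t (p + d) k := by
    intro t p k
    unfold SeesRight
    rw [e1, show p + k + d = p + d + k by ring]
  have e3 : ∀ t p k, SeesLeft v (fun t l => h t (l + d)) t p k ↔ SeesLeft v h t (p + d) k := by
    intro t p k
    unfold SeesLeft
    rw [e1, show p - k + d = p + d - k by ring]
  intro t ht l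
  have := hh t ht (l + d)
  unfold MovesRight MovesLeft at *
  simp only [e1, e2, e3]
  rw [this, show l + d + 1 = l + 1 + d by ring]

namespace Scale

variable {c : Scale} {N : ℕ} {s : ℤ → ℤ} {v : ℕ}

theorem Piece.translate {d : ℤ} {M : ℤ} (hM : ∀ i, s (i + M) = s i + d) {n : ℕ} {τ : Bool} {y : ℤ}
    (h : c.Piece N s n τ y) : c.Piece N s n τ (y + d) := by
  induction h with
  | top i => rw [← hM]; exact Piece.top _
  | a₁ hn p ih => exact Piece.a₁ hn ih
  | a₂ hn p ih => convert Piece.a₂ hn ih using 1; ring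
  | a₃ hn p ih => convert Piece.a₃ hn ih using 1; ring
  | b₁ hn p ih => exact Piece.b₁ hn ih
  | b₂ hn p ih => convert Piece.b₂ hn ih using 1; ring
  | b₃ hn p ih => convert Piece.b₃ hn ih using 1; ring
  | b₄ hn p ih => convert Piece.b₄ hn ih using 1; ring
  | b₅ hn p ih => convert Piece.b₅ hn ih using 1; ring

theorem GapAt.translate {d : ℤ} {M : ℤ} (hM : ∀ i, s (i + M) = s i + d) {n : ℕ} {g : Gap}
    (h : c.GapAt N s n g) : c.GapAt N s n ⟨g.x + d, g.u, g.T⟩ := by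
  cases h with
  | top i =>
    convert GapAt.top (i + M) using 1
    have e : s (i + M + 1) = s (i + 1) + d := by rw [← hM]; congr 1; ring
    rw [e, hM, show s (i + 1) + d - (s i + d) - (c.a N : ℤ) = s (i + 1) - s i - c.a N by ring]
    congr 1; ring
  | inner₁ hn p => convert GapAt.inner₁ hn (p.translate hM) using 2; ring
  | inner₂ hn p => convert GapAt.inner₂ hn (p.translate hM) using 2; ring
  | inner₃ hn p => convert GapAt.inner₃ hn (p.translate hM) using 2; ring
  | inner₄ hn p => convert GapAt.inner₄ hn (p.translate hM) using 2; ring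
  | foam i hi p => convert GapAt.foam i hi (p.translate hM) using 2; ring

theorem filled_translate {d : ℤ} {M : ℤ} (hM : ∀ i, s (i + M) = s i + d) (l : ℤ) :
    filled (c.gaps N s) 0 (l + d) ↔ filled (c.gaps N s) 0 l := by
  have key : ∀ {d M : ℤ}, (∀ i, s (i + M) = s i + d) → ∀ l, filled (c.gaps N s) 0 (l + d) →
      filled (c.gaps N s) 0 l := by
    intro d M hM l h g hg ht hin
    obtain ⟨n, hn⟩ := hg
    refine h ⟨g.x + d, g.u, g.T⟩ ⟨n, hn.translate hM⟩ ht ?_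
    unfold Gap.left Gap.right Gap.ext at *
    simp only at *
    omega
  refine ⟨key hM l, fun h => key (d := -d) (M := -M) (fun i => ?_) (l + d) ?_⟩
  · have := hM (i + -M)
    rw [neg_add_cancel_right] at this
    omega
  · rwa [add_neg_cancel_right]

theorem exists_crossing {f : ℕ → ℕ} (hf : ∀ n, n ≤ f n) {n₀ L : ℕ} (h : f n₀ ≤ L) :
    ∃ n, n₀ ≤ n ∧ f n ≤ L ∧ L < f (n + 1) := by
  by_contra hcon
  push Not at hcon
  have : ∀ k, f (n₀ + k) ≤ L := by
    intro k
    induction k with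
    | zero => exact h
    | succ k ih => exact hcon (n₀ + k) (Nat.le_add_right _ _) ih
  have h1 := this (L + 1)
  have h2 := hf (n₀ + (L + 1))
  omega

theorem int_succ_ediv {M : ℤ} (hM : 0 < M) (i : ℤ) :
    ((i + 1) / M = i / M ∧ ¬ M ∣ i + 1) ∨ ((i + 1) / M = i / M + 1 ∧ M ∣ i + 1) := by
  have h1 := Int.mul_ediv_add_emod i M
  have h2 := Int.emod_nonneg i hM.ne'
  have h3 := Int.emod_lt_of_pos i hM
  generalize i / M = q at *
  generalize i % M = r at *
  rcases eq_or_lt_of_le (show r + 1 ≤ M from h3) with h | h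
  · right
    have : i + 1 = M * (q + 1) := by rw [← h1, ← h]; ring
    rw [this]
    exact ⟨Int.mul_ediv_cancel_left _ hM.ne', Dvd.intro _ rfl⟩
  · left
    have e : i + 1 = (r + 1) + M * q := by rw [← h1]; ring
    constructor
    · rw [e, Int.add_mul_ediv_left _ _ hM.ne', Int.ediv_eq_zero_of_lt (by omega) h, zero_add]
    · rw [e, Int.dvd_add_left (Dvd.intro _ rfl)]
      intro hd
      have := Int.le_of_dvd (by omega) hd
      omega

/-- The distribution of an excess length `R` over the gaps of a ring of `M` pieces. -/
theorem exists_excess (hv : 3 ≤ v) {u T M R : ℕ} (hu : Odd u) (h0 : ¬ (v + 1) ∣ u + 2 * T)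
    (hM : 2 ≤ M) (hR : 2 ≤ R) : ∃ h e₁ e₂ : ℕ, M * h + e₁ + e₂ = R ∧ M * h ≤ R ∧ e₁ ≤ 3 * M ∧
      e₂ ≤ 3 * M ∧ ¬ (v + 1) ∣ u + 2 * h + 2 * T ∧ ¬ (v + 1) ∣ u + 2 * (h + e₁) + 2 * T ∧
      ¬ (v + 1) ∣ u + 2 * (h + e₂) + 2 * T := by
  have sep : ∀ m, (v + 1) ∣ m → ¬ (v + 1) ∣ m + 2 := by
    intro m h1 h2
    have := Nat.le_of_dvd (by omega) ((Nat.dvd_add_right h1).1 h2)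
    omega
  -- Only `v = 3` lets `v + 1` divide 4, and then it would divide an odd number.
  have sep4 : ∀ m, Odd m → (v + 1) ∣ m → ¬ (v + 1) ∣ m + 4 := by
    rintro m ⟨r, hr⟩ h1 h2
    have h3 := (Nat.dvd_add_right h1).1 h2
    have := Nat.le_of_dvd (by omega) h3
    obtain rfl : v = 3 := by omega
    omega
  -- The common enlargement is close to the average `R / M`. If one choice of `h` is inadmissible,
  -- the preceding one is not. The remainder, at most `3 * M`, goes to two exceptional gaps as `0`,
  -- `1` or `2` and the rest.
  obtain ⟨h, a1, a2, a3⟩ : ∃ h, ¬ (v + 1) ∣ u + 2 * h + 2 * T ∧ M * h + 2 ≤ R ∧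
      R ≤ M * h + 3 * M := by
    have d1 := Nat.div_add_mod R M
    have d2 := Nat.mod_lt R (show 0 < M by omega)
    generalize R / M = q at *
    rcases Nat.lt_or_ge q 1 with hq | hq
    · obtain rfl : q = 0 := by omega
      exact ⟨0, by simpa using h0, by omega, by omega⟩
    obtain ⟨q, rfl⟩ : ∃ k, q = k + 1 := ⟨q - 1, by omega⟩
    by_cases hd : (v + 1) ∣ u + 2 * q + 2 * T
    · rcases Nat.eq_zero_or_pos q with rfl | hq
      · exact absurd (by simpa using hd) h0
      obtain ⟨q, rfl⟩ : ∃ k, q = k + 1 := ⟨q - 1, by omega⟩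
      refine ⟨q, fun hd' => sep _ hd' ?_, ?_, ?_⟩
      · rwa [show u + 2 * q + 2 * T + 2 = u + 2 * (q + 1) + 2 * T by ring]
      · rw [Nat.mul_succ, Nat.mul_succ] at d1; omega
      · rw [Nat.mul_succ, Nat.mul_succ] at d1; omega
    · refine ⟨q, hd, ?_, ?_⟩ <;> rw [Nat.mul_succ] at d1 <;> omega
  obtain ⟨r, rfl⟩ : ∃ r, R = M * h + (r + 2) := ⟨R - M * h - 2, by omega⟩
  by_cases c0 : (v + 1) ∣ u + 2 * (h + (r + 2)) + 2 * T
  · have c1 : ¬ (v + 1) ∣ u + 2 * (h + (r + 1)) + 2 * T := fun hd => sep _ hd (by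
      rwa [show u + 2 * (h + (r + 1)) + 2 * T + 2 = u + 2 * (h + (r + 2)) + 2 * T by ring])
    by_cases c2 : (v + 1) ∣ u + 2 * (h + 1) + 2 * T
    · refine ⟨h, 2, r, by ring, by omega, by omega, by omega, a1, fun hd => sep _ c2 (by
        rwa [show u + 2 * (h + 1) + 2 * T + 2 = u + 2 * (h + 2) + 2 * T by ring]), fun hd => ?_⟩
      refine sep4 _ ?_ hd (by
        rwa [show u + 2 * (h + r) + 2 * T + 4 = u + 2 * (h + (r + 2)) + 2 * T by ring])
      obtain ⟨z, hz⟩ := hu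
      exact ⟨z + (h + r) + T, by omega⟩
    · exact ⟨h, 1, r + 1, by ring, by omega, by omega, by omega, a1, c2, c1⟩
  · exact ⟨h, 0, r + 2, by ring, by omega, by omega, by omega, a1, by simpa using a1, c0⟩

/-- The starting points of the pieces of a ring. -/
def ring (P M e₁ e₂ : ℕ) (i : ℤ) : ℤ := P * i + 2 * e₁ * (i / M) + 2 * e₂ * ((i + 1) / M)

theorem ring_add {P M e₁ e₂ : ℕ} (hM : 2 ≤ M) (i : ℤ) :
    ring P M e₁ e₂ (i + M) = ring P M e₁ e₂ i + (P * M + 2 * e₁ + 2 * e₂ : ℕ) := by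
  have hM' : (M : ℤ) ≠ 0 := by omega
  unfold ring
  rw [show i + M + 1 = i + 1 + M by ring, Int.add_ediv_of_dvd_right (dvd_refl _),
    Int.add_ediv_of_dvd_right (dvd_refl _), Int.ediv_self hM']
  push_cast; ring_nf

theorem ring_zero {P M e₁ e₂ : ℕ} (hM : 2 ≤ M) : ring P M e₁ e₂ 0 = 0 := by
  unfold ring
  rw [Int.zero_ediv, zero_add, Int.ediv_eq_zero_of_lt (by omega) (by omega)]
  simp

/-- The two exceptional gaps of a period are distinct, because `M ≥ 2` excludes consecutive
multiples of `M`. -/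
theorem ring_step {P M e₁ e₂ : ℕ} (hM : 2 ≤ M) (i : ℤ) :
    ring P M e₁ e₂ (i + 1) - ring P M e₁ e₂ i = P ∨
      ring P M e₁ e₂ (i + 1) - ring P M e₁ e₂ i = P + 2 * e₁ ∨
      ring P M e₁ e₂ (i + 1) - ring P M e₁ e₂ i = P + 2 * e₂ := by
  have hM' : (0 : ℤ) < M := by omega
  unfold ring
  rcases int_succ_ediv hM' i with ⟨h1, h2⟩ | ⟨h1, h2⟩ <;>
    rcases int_succ_ediv hM' (i + 1) with ⟨h3, h4⟩ | ⟨h3, h4⟩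
  · left; rw [h3, h1]; ring_nf
  · right; right; rw [h3, h1]; ring_nf
  · right; left; rw [h3, h1]; ring_nf
  · exfalso
    have := Int.le_of_dvd (by omega) ((Int.dvd_add_right h2).1 h4)
    omega

theorem GapAt.life_le (hc : c.Good v) (hN : 1 ≤ N)
    (hw : ∀ i, 100 * (s (i + 1) - s i - c.a N).toNat ≤ 101 * c.u N) {n : ℕ} {g : Gap}
    (h : c.GapAt N s n g) : g.life ≤ 4 * c.u N := by
  have hl := h.level
  have h3 := hc.life_le N hN
  have h4 := hc.u_ge N hN
  rcases Nat.eq_or_lt_of_le hl with rfl | hlt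
  · obtain ⟨e1, ⟨e2, -⟩ | ⟨-, i, e2⟩⟩ := h.width hN
    · omega
    · have := hw i
      unfold Gap.life
      unfold Scale.life at h3
      rw [e1]
      omega
  · rw [h.life_eq hc.valid hlt]
    have := hc.valid.life_mono hl
    omega

end Scale

open Classical in
/-- On a ring of any large length there is a sparse pattern that fills the ring. -/
theorem exists_filling_pattern {v : ℕ} (hv : 3 ≤ v) : ∃ L₀ : ℕ, ∀ L : ℕ, L₀ ≤ L →
    ∃ (h : ℕ → ℤ → Prop) (τ : ℕ), IsRun v h τ ∧ (∀ l, h 0 (l + L) ↔ h 0 l) ∧ v * τ < L ∧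
      (∀ l, h τ l) ∧
      ((((Finset.Ico (0 : ℤ) L).filter fun l => h 0 l).card : ℕ) : ℝ) ≤
        (L : ℝ) ^ Real.logb 6 5 := by
  obtain ⟨c, hc⟩ := Scale.exists_good hv
  obtain ⟨K, hK0, hK⟩ := Scale.weight_le_rpow hc
  -- At least `6000 + 4 * v` pieces: the 6000 keeps the enlargement of each gap within one percent,
  -- and the `4 * v` lets the pattern finish before `L` message updates.
  obtain ⟨Q, hQ⟩ : ∃ Q, Q = 6000 + 4 * v + 3 := ⟨_, rfl⟩
  obtain ⟨X₀, hX₀⟩ := Scale.exists_mul_rpow_le ((50 * Q : ℕ) * K)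
  -- At such a level the extra enlargement of the two exceptional gaps, of order `M ≤ 50 * Q`, is
  -- negligible against `c.u N`.
  obtain ⟨n₀, hn₀⟩ : ∃ n₀, n₀ = 2 + 50000 * Q := ⟨_, rfl⟩
  refine ⟨max (Q * (c.a n₀ + c.u n₀)) ⌈X₀⌉₊, fun L hL => ?_⟩
  have hLX : X₀ ≤ L := (Nat.le_ceil X₀).trans (by exact_mod_cast (le_max_right _ _).trans hL)
  have hgrow : ∀ n, 1 ≤ n → n ≤ c.u n := fun n hn =>
    (Nat.lt_pow_self (by norm_num)).le.trans (hc.growth hn)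
  obtain ⟨N, hN, h1, h2⟩ := Scale.exists_crossing (f := fun n => Q * (c.a n + c.u n))
    (fun n => by
      rcases Nat.eq_zero_or_pos n with rfl | hn
      · exact Nat.zero_le _
      · exact (hgrow n hn).trans ((Nat.le_add_left _ _).trans
          (Nat.le_mul_of_pos_left _ (by omega)))) ((le_max_left _ _).trans hL)
  have hN1 : 1 ≤ N := by omega
  have hu := hgrow N hN1
  have hper := (hc.period_succ hN1).2
  have hb := hc.b_le N hN1
  have hab := hc.valid.recursive.a_le_b N hN1
  obtain ⟨r, hr⟩ := hc.even N hN1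
  obtain ⟨z, hz⟩ := hc.odd N hN1
  obtain ⟨P, hP⟩ : ∃ P, P = c.a N + c.u N := ⟨_, rfl⟩
  simp only [← hP] at h1 h2 hper
  have hPpos : 0 < P := by omega
  have hLQ : L < 50 * Q * P := h2.trans_le (by
    calc _ ≤ Q * (50 * P) := Nat.mul_le_mul_left _ hper
      _ = _ := by ring)
  have hq1 : Q ≤ L / P := (Nat.le_div_iff_mul_le hPpos).2 h1
  have hq2 : L / P < 50 * Q := (Nat.div_lt_iff_lt_mul hPpos).2 hLQ
  -- The period `P` is odd and widths may change only by even amounts, so `M` must have the parity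
  -- of `L`. Taking two or three pieces fewer than fit leaves an excess of at least `P`.
  obtain ⟨M, hM1, hM2, hMpar⟩ : ∃ M, M + 2 ≤ L / P ∧ L / P ≤ M + 3 ∧ M % 2 = L % 2 := by
    by_cases hpar : (L / P) % 2 = L % 2
    · exact ⟨L / P - 2, by omega, by omega, by omega⟩
    · exact ⟨L / P - 3, by omega, by omega, by omega⟩
  have d1 := Nat.div_add_mod L P
  have d2 := Nat.mod_lt L hPpos
  obtain ⟨R, hR⟩ : ∃ R, L = P * M + 2 * R := by
    have hle : P * M ≤ L := by
      have : P * M ≤ P * (L / P) := Nat.mul_le_mul_left _ (by omega)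
      omega
    have hpar : (P * M) % 2 = L % 2 := by
      rw [Nat.mul_mod, show P % 2 = 1 by omega, one_mul, Nat.mod_mod, hMpar]
    exact ⟨(L - P * M) / 2, by omega⟩
  have hR1 : P ≤ R := by
    have : P * (M + 2) ≤ P * (L / P) := Nat.mul_le_mul_left _ hM1
    rw [Nat.mul_add] at this
    omega
  have hR2 : R ≤ 2 * P := by
    have : P * (L / P) ≤ P * (M + 3) := Nat.mul_le_mul_left _ hM2
    rw [Nat.mul_add] at this
    omega
  obtain ⟨h, e₁, e₂, hh, hhR, he1, he2, g0, g1, g2⟩ := Scale.exists_excess hv (hc.odd N hN1)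
    (hc.not_dvd N (by omega)) (show 2 ≤ M by omega) (show 2 ≤ R by omega)
  have hh6 : 6000 * h ≤ R := (Nat.mul_le_mul_right h (show 6000 ≤ M by omega)).trans hhR
  obtain ⟨P', hP'⟩ : ∃ P', P' = P + 2 * h := ⟨_, rfl⟩
  have hs := Scale.ring_add (P := P') (e₁ := e₁) (e₂ := e₂) (show 2 ≤ M by omega)
  have hL' : P' * M + 2 * e₁ + 2 * e₂ = L := by
    rw [hR, ← hh, hP']; ring
  rw [hL'] at hs
  have hstep := Scale.ring_step (P := P') (e₁ := e₁) (e₂ := e₂) (show 2 ≤ M by omega)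
  have hzero := Scale.ring_zero (P := P') (e₁ := e₁) (e₂ := e₂) (show 2 ≤ M by omega)
  generalize Scale.ring P' M e₁ e₂ = s at *
  have hwid : ∀ i, ∃ e, (s (i + 1) - s i - c.a N).toNat = c.u N + 2 * (h + e) ∧ e ≤ 3 * M ∧
      ¬ (v + 1) ∣ c.u N + 2 * (h + e) + 2 * c.T N := by
    intro i
    rcases hstep i with h | h | h
    · exact ⟨0, by omega, by omega, by simpa using g0⟩
    · exact ⟨e₁, by omega, he1, g1⟩
    · exact ⟨e₂, by omega, he2, g2⟩
  have htop : c.TopWide v N s := by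
    intro i
    obtain ⟨e, h1, h2, h3⟩ := hwid i
    rw [h1]
    refine hc.wide N (by omega) _ ⟨z + (h + e), by omega⟩ (by omega) (by omega) h3
  have hw101 : ∀ i, 100 * (s (i + 1) - s i - c.a N).toNat ≤ 101 * c.u N := by
    intro i
    obtain ⟨e, h1, h2, h3⟩ := hwid i
    rw [h1]
    omega
  have hsp := Scale.spaced_of_topWide hc.valid hN1 htop
  refine ⟨filled (c.gaps N s), 4 * c.u N, Scale.isRun_gaps hv hc.valid (by omega) htop _,
    Scale.filled_translate hs, ?_, ?_, ?_⟩
  · have : v * (4 * c.u N) = 4 * v * c.u N := by ring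
    have h5 : (6000 + 4 * v) * c.u N ≤ M * P := Nat.mul_le_mul (by omega) (by omega)
    rw [Nat.add_mul] at h5
    rw [Nat.mul_comm P M] at hR
    omega
  · rintro l g ⟨n, hg⟩ ht
    exact absurd (hg.life_le hc hN1 hw101) (by omega)
  · have hcount := Scale.count_top_le hc.valid.recursive hsp hN1 0 M
    have : s ((0 : ℤ) + M) = L := by rw [hs, hzero, zero_add]
    rw [this, hzero] at hcount
    refine le_trans (b := ((M * (Scale.weight (c.b 1) N).1 : ℕ) : ℝ)) (by exact_mod_cast hcount) ?_
    push_cast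
    refine le_trans ?_ (hX₀ L hLX)
    have hML : c.u N ≤ L := by
      have : P * 1 ≤ P * M := Nat.mul_le_mul_left _ (by omega)
      omega
    calc (M : ℝ) * ((Scale.weight (c.b 1) N).1 : ℝ)
        ≤ (50 * Q : ℕ) * (K * (c.u N : ℝ) ^ (44 / 49 : ℝ)) := by
          refine mul_le_mul ?_ (hK N hN1) (by positivity) (by positivity)
          exact_mod_cast (show M ≤ 50 * Q by omega)
      _ ≤ (50 * Q : ℕ) * (K * (L : ℝ) ^ (44 / 49 : ℝ)) := by
          have : (c.u N : ℝ) ^ (44 / 49 : ℝ) ≤ (L : ℝ) ^ (44 / 49 : ℝ) :=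
            Real.rpow_le_rpow (by positivity) (by exact_mod_cast hML) (by norm_num)
          gcongr
      _ = _ := by ring

/-! ### Long-lived patterns on a segment -/

namespace Scale

variable {c : Scale} {v : ℕ}

theorem Good.exists_level (hc : c.Good v) {n₀ t : ℕ} (hn₀ : 1 ≤ n₀) (ht : c.life n₀ ≤ t) :
    ∃ N, n₀ ≤ N ∧ t < c.life N ∧ c.u N ≤ 100 * t ∧ t ≤ 3 * c.u N := by
  obtain ⟨n, h1, h2, h3⟩ := exists_crossing (f := c.life) (fun n => by
    rcases Nat.eq_zero_or_pos n with rfl | hn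
    · exact Nat.zero_le _
    · have h4 := (Nat.lt_pow_self (a := 5) (n := n - 1) (by norm_num)).le
      have h5 := hc.growth hn
      obtain ⟨m, rfl⟩ : ∃ m, n = m + 1 := ⟨n - 1, by omega⟩
      rw [pow_succ] at h5
      simp only [Nat.add_sub_cancel] at h4
      have : 1 ≤ 5 ^ m := Nat.one_le_pow _ _ (by norm_num)
      unfold Scale.life
      omega) ht
  have h4 := (hc.period_succ (show 1 ≤ n by omega)).1
  have h5 := hc.life_le (n + 1) (by omega)
  refine ⟨n + 1, by omega, h3, ?_, by omega⟩
  have : c.u n ≤ 2 * c.life n := by unfold Scale.life; omega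
  omega

end Scale

/-- A set of links of a line segment of length `m` such that a decoder of speed `v` whose initial
chain coincides with it on such a segment has anyons until time `t₀`. -/
def Persistent (v m t₀ : ℕ) (F : Finset ℕ) : Prop :=
  ∀ (h : ℕ → ℤ → Prop) (z : ℤ), IsRun v h t₀ →
    (∀ i < m, h 0 (z + i) ↔ i ∈ F) → ∀ t ≤ t₀, ∃ p, LineAnyon h t p

open Classical in
/-- There are sparse patterns that keep the decoder busy for a long time. -/
theorem exists_persistent_pattern {v : ℕ} (hv : 3 ≤ v) : ∃ t₁ : ℕ, ∀ t₀ : ℕ, t₁ ≤ t₀ →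
    ∃ F : Finset ℕ, (∀ i ∈ F, i < t₀ ^ 2) ∧ Persistent v (t₀ ^ 2) t₀ F ∧
      (F.card : ℝ) ≤ (t₀ : ℝ) ^ Real.logb 6 5 := by
  obtain ⟨c, hc⟩ := Scale.exists_good hv
  obtain ⟨K, hK0, hK⟩ := Scale.weight_le_rpow hc
  obtain ⟨X₀, hX₀⟩ := Scale.exists_mul_rpow_le ((6 * (v + 700) : ℕ) * K * 100)
  refine ⟨max (max (c.life 2) ⌈X₀⌉₊) (2 * (v + 700)), fun t₀ ht₀ => ?_⟩
  rw [max_le_iff, max_le_iff] at ht₀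
  obtain ⟨⟨ht1, ht2⟩, ht3⟩ := ht₀
  have htX : X₀ ≤ t₀ := (Nat.le_ceil X₀).trans (by exact_mod_cast ht2)
  obtain ⟨N, hN, hlife, hu1, hu2⟩ := hc.exists_level (show 1 ≤ 2 by omega) ht1
  -- The boundary of the window influences `(v + 2) * t₀` sites on each side. The remaining `698 *
  -- t₀` contain the left end of the first top gap, which stays within about `501 * t₀` of the
  -- centre.
  obtain ⟨W, hW⟩ : ∃ W, W = (v + 700) * t₀ := ⟨_, rfl⟩
  have hW2 : 2 * W ≤ t₀ ^ 2 := by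
    rw [hW, pow_two, ← Nat.mul_assoc]
    exact Nat.mul_le_mul_right _ ht3
  obtain ⟨P, hP⟩ : ∃ P, P = c.a N + c.u N := ⟨_, rfl⟩
  obtain ⟨s, hs⟩ : ∃ s : ℤ → ℤ, ∀ i, s i = P * i := ⟨_, fun _ => rfl⟩
  have hdiff : ∀ i, s (i + 1) - s i - c.a N = c.u N := by
    intro i
    rw [hs, hs, hP]; push_cast; ring
  have htop : c.TopWide v N s := by
    intro i
    rw [hdiff, Int.toNat_natCast]
    exact hc.valid.wide N hN
  have hsp := Scale.spaced_of_topWide hc.valid (by omega) htop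
  have hrun := Scale.isRun_gaps hv hc.valid hN htop t₀
  have hS := Scale.separated_gaps hv hc.valid hN hsp htop
  refine ⟨(Finset.range (2 * W)).filter fun i => filled (c.gaps N s) 0 ((i : ℤ) - W), ?_, ?_, ?_⟩
  · intro i hi
    rw [Finset.mem_filter, Finset.mem_range] at hi
    omega
  · intro h z hh h0 t ht
    obtain ⟨g, hg⟩ : ∃ g, g = (⟨c.a N, c.u N, c.T N⟩ : Gap) := ⟨_, rfl⟩
    have hgS : g ∈ c.gaps N s := by
      refine ⟨N, ?_⟩
      convert Scale.GapAt.top 0 using 1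
      rw [hg, hdiff, Int.toNat_natCast, hs]
      simp
    have hgl : g.life = c.life N := by rw [hg]; rfl
    have han := (lineAnyon_filled hS (p := g.left t) (t := t)).2
      ⟨g, hgS, by omega, Or.inl rfl⟩
    have hagree := (hh.translate (z + W)).eq_of_window (by omega) hrun (lo := -W) (hi := W - 1)
      (by
        intro l hl1 hl2
        obtain ⟨i, hi⟩ : ∃ i : ℕ, l + W = i := ⟨(l + W).toNat, by omega⟩
        have := h0 i (by omega)
        rw [show l + (z + W) = z + i by omega, this, Finset.mem_filter, Finset.mem_range,
          show (i : ℤ) - W = l by omega]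
        exact and_iff_right (by omega)) t ht
    have hb := hc.b_le N (by omega)
    have hab := hc.valid.recursive.a_le_b N (by omega)
    have hx : g.x = c.a N := by rw [hg]
    have e1 : ((v : ℤ) + 2) * t ≤ (v + 2) * t₀ := by
      exact_mod_cast Nat.mul_le_mul_left (v + 2) ht
    have e2 : (W : ℤ) = (v + 2) * t₀ + 698 * t₀ := by rw [hW]; push_cast; ring
    have hl1 : -(t : ℤ) ≤ -g.ext t := by unfold Gap.ext; omega
    have hl2 : -g.ext t ≤ t := by unfold Gap.ext; omega
    have hleft : g.left t = c.a N - g.ext t := by unfold Gap.left; rw [hx]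
    have hlife1 := (hc.valid.life_mono (show 0 ≤ 2 by omega)).trans ht1
    have hlife0 : c.life 0 = 1 := by
      unfold Scale.life; rw [hc.valid.u_zero, hc.valid.T_zero]
    refine ⟨g.left t + (z + W), ?_⟩
    unfold LineAnyon at *
    rw [show g.left t + (z + W) - 1 = g.left t - 1 + (z + W) by ring]
    rw [hagree (g.left t - 1) (by omega) (by omega), hagree (g.left t) (by omega) (by omega)]
    exact han
  · obtain ⟨k, hk⟩ : ∃ k, k = 3 * (v + 700) := ⟨_, rfl⟩
    have hkP : W ≤ P * k := by
      rw [hW, hk]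
      calc (v + 700) * t₀ ≤ (v + 700) * (3 * P) := Nat.mul_le_mul_left _ (by omega)
        _ = _ := by ring
    have hcount := Scale.count_top_le hc.valid.recursive hsp (show 1 ≤ N by omega) (-k) (2 * k)
    have hcard : ((Finset.range (2 * W)).filter
        fun i : ℕ => filled (c.gaps N s) 0 ((i : ℤ) - W)).card ≤
        Scale.count (c.gaps N s) (s (-k)) (s (-k + (2 * k : ℕ))) := by
      unfold Scale.count
      refine Finset.card_le_card_of_injOn (fun i : ℕ => (i : ℤ) - W) ?_ ?_
      · intro i hi
        rw [Finset.mem_coe, Finset.mem_filter, Finset.mem_range] at hi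
        rw [Finset.mem_coe, Finset.mem_filter, Finset.mem_Ico, hs, hs]
        have e1 : (P : ℤ) * (-k + (2 * k : ℕ)) = (P * k : ℕ) := by push_cast; ring
        have e2 : (P : ℤ) * (-k) = -((P * k : ℕ) : ℤ) := by push_cast; ring
        rw [e1, e2]
        simp only
        exact ⟨⟨by omega, by omega⟩, hi.2⟩
      · intro i _ j _ hij
        simp only at hij
        omega
    have hcard2 := hcard.trans hcount
    refine le_trans (b := (((2 * k) * (Scale.weight (c.b 1) N).1 : ℕ) : ℝ))
      (Nat.cast_le.2 hcard2) ?_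
    refine le_trans ?_ (hX₀ t₀ htX)
    have ht0 : (0 : ℝ) ≤ t₀ := by positivity
    calc (((2 * k) * (Scale.weight (c.b 1) N).1 : ℕ) : ℝ)
        = (6 * (v + 700) : ℕ) * ((Scale.weight (c.b 1) N).1 : ℝ) := by
          rw [hk]; push_cast; ring
      _ ≤ (6 * (v + 700) : ℕ) * (K * (c.u N : ℝ) ^ (44 / 49 : ℝ)) := by
          have := hK N (by omega)
          gcongr
      _ ≤ (6 * (v + 700) : ℕ) * (K * (100 * (t₀ : ℝ) ^ (44 / 49 : ℝ))) := by
          have h1 : (c.u N : ℝ) ^ (44 / 49 : ℝ) ≤ (100 * (t₀ : ℝ)) ^ (44 / 49 : ℝ) :=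
            Real.rpow_le_rpow (by positivity) (by exact_mod_cast hu1) (by norm_num)
          have h2 : (100 * (t₀ : ℝ)) ^ (44 / 49 : ℝ) ≤ 100 * (t₀ : ℝ) ^ (44 / 49 : ℝ) := by
            rw [Real.mul_rpow (by norm_num) ht0]
            refine mul_le_mul_of_nonneg_right ?_ (by positivity)
            calc (100 : ℝ) ^ (44 / 49 : ℝ) ≤ 100 ^ (1 : ℝ) :=
                  Real.rpow_le_rpow_of_exponent_le (by norm_num) (by norm_num)
              _ = 100 := Real.rpow_one _
          have h3 := h1.trans h2
          gcongr
      _ = _ := by ring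

/-! ### The messages of the automaton -/

variable {D L : ℕ}

/-- There is an anyon from which a message of direction `d` and value `k` can reach `r`. -/
def Source (c : Chain D L) (d : Dir D) : ℕ → Site D L → Prop
  | 0, r => IsAnyon c r
  | k + 1, r => ∃ r' ∈ face d.2 (r - dirVec L d), Source c d k r'

theorem self_mem_face (a : Fin D) (r : Site D L) : r ∈ face a r := by
  refine Finset.mem_image.2 ⟨0, ?_, add_zero r⟩
  rw [Fintype.mem_piFinset]
  intro b
  split_ifs <;> simp

theorem apply_of_mem_face {a : Fin D} {r r' : Site D L} (h : r' ∈ face a r) : r' a = r a := by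
  obtain ⟨e, he, rfl⟩ := Finset.mem_image.1 h
  have := Fintype.mem_piFinset.1 he a
  rw [if_pos rfl, Finset.mem_singleton] at this
  simp [this]

theorem Source.of_isAnyon {c : Chain D L} {d : Dir D} {k : ℕ} {r : Site D L}
    (h : IsAnyon c (r - k • dirVec L d)) : Source c d k r := by
  induction k generalizing r with
  | zero => simpa [Source] using h
  | succ k ih =>
    refine ⟨r - dirVec L d, self_mem_face _ _, ih ?_⟩
    rwa [sub_sub, ← succ_nsmul']

/-- Messages spread sideways, but a face fixes the coordinate along the direction of travel, which
therefore changes by exactly one per update. -/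
theorem Source.exists_isAnyon {c : Chain D L} {d : Dir D} {k : ℕ} {r : Site D L}
    (h : Source c d k r) : ∃ r', IsAnyon c r' ∧ r' d.2 = r d.2 - k • dirVec L d d.2 := by
  induction k generalizing r with
  | zero => exact ⟨r, h, by simp⟩
  | succ k ih =>
    obtain ⟨r', hr', h⟩ := h
    obtain ⟨r'', h1, h2⟩ := ih h
    refine ⟨r'', h1, ?_⟩
    rw [h2, apply_of_mem_face hr', Pi.sub_apply, sub_sub, ← succ_nsmul']

/-- The messages after a number of updates with given chains. -/
noncomputable def messages (C : ℕ → Chain D L) : ℕ → Messages D L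
  | 0 => fun _ _ => 0
  | j + 1 => automaton (C j) (messages C j)

/-- The values of the messages that reach `r`. -/
def Arrivals (C : ℕ → Chain D L) (j : ℕ) (d : Dir D) (r : Site D L) : Set ℕ :=
  {k | 1 ≤ k ∧ k ≤ j ∧ Source (C (j - k)) d k r}

theorem arrivals_succ (C : ℕ → Chain D L) (j : ℕ) (d : Dir D) (r : Site D L) (k : ℕ) :
    k + 1 ∈ Arrivals C (j + 1) d r ↔ (k = 0 ∧ ∃ r' ∈ face d.2 (r - dirVec L d), IsAnyon (C j) r') ∨
      ∃ r' ∈ face d.2 (r - dirVec L d), k ∈ Arrivals C j d r' := by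
  unfold Arrivals
  simp only [Set.mem_ofPred_eq]
  rw [show j + 1 - (k + 1) = j - k by omega]
  rcases Nat.eq_zero_or_pos k with rfl | hk
  · simp [Source]
  · constructor
    · rintro ⟨-, h2, r', hr', h⟩
      exact Or.inr ⟨r', hr', hk, by omega, h⟩
    · rintro (⟨h, -⟩ | ⟨r', hr', h1, h2, h3⟩)
      · omega
      · exact ⟨by omega, by omega, r', hr', h3⟩

theorem sInf_eq_zero_of_arrivals {C : ℕ → Chain D L} {j : ℕ} {d : Dir D} {r : Site D L} :
    sInf (Arrivals C j d r) = 0 ↔ Arrivals C j d r = ∅ := by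
  rw [Nat.sInf_eq_zero]
  constructor
  · rintro (h | h)
    · exact absurd h.1 (by omega)
    · exact h
  · exact Or.inr

/-- A message has the smallest of the arriving values. -/
theorem messages_eq (C : ℕ → Chain D L) {j : ℕ} (hj : j ≤ L) (d : Dir D) (r : Site D L) :
    messages C j d r = sInf (Arrivals C j d r) := by
  induction j generalizing r with
  | zero =>
    have : Arrivals C 0 d r = ∅ := by
      ext k
      simp only [Arrivals, Set.mem_ofPred_eq, Set.mem_empty_iff_false, iff_false]
      omega
    rw [this, Nat.sInf_empty]
    rfl
  | succ j ih =>
    have ih' : ∀ r, messages C j d r = sInf (Arrivals C j d r) := ih (by omega)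
    show automaton (C j) (messages C j) d r = _
    unfold automaton
    simp only [ih']
    split_ifs with h1 h2 h3
    · have h1' : 0 + 1 ∈ Arrivals C (j + 1) d r := (arrivals_succ C j d r 0).2 (Or.inl ⟨rfl, h1⟩)
      have h2 := Nat.sInf_le h1'
      have h3 := (Nat.sInf_mem ⟨_, h1'⟩).1
      omega
    · symm
      rw [sInf_eq_zero_of_arrivals, Set.eq_empty_iff_forall_notMem]
      intro k hk
      obtain ⟨k, rfl⟩ : ∃ m, k = m + 1 := ⟨k - 1, by have := hk.1; omega⟩
      rcases (arrivals_succ C j d r k).1 hk with ⟨-, h⟩ | ⟨r', hr', h⟩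
      · exact h1 h
      · have := sInf_eq_zero_of_arrivals.1 (h2 r' hr')
        rw [this] at h
        exact h
    all_goals
      push Not at h2
      obtain ⟨r₀, hr₀, hne⟩ := h2
      have hS : (({k | k ≠ 0 ∧ ∃ r' ∈ face d.2 (r - dirVec L d),
        sInf (Arrivals C j d r') = k} : Set ℕ)).Nonempty := ⟨_, hne, r₀, hr₀, rfl⟩
      obtain ⟨m1, r₁, hr₁, m2⟩ := Nat.sInf_mem hS
      have hmem : sInf (Arrivals C j d r₁) ∈ Arrivals C j d r₁ :=
        Nat.sInf_mem (Nat.nonempty_of_pos_sInf (by rw [m2]; exact Nat.pos_of_ne_zero m1))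
    -- No message is deleted here: the arriving values are at most `j`, and `j + 1 ≤ L`.
    · exfalso
      have := hmem.2.1
      rw [m2] at this
      omega
    · refine le_antisymm ?_ ?_
      · have hne' : (Arrivals C (j + 1) d r).Nonempty :=
          ⟨_, (arrivals_succ C j d r _).2 (Or.inr ⟨r₁, hr₁, hmem⟩)⟩
        have hm := Nat.sInf_mem hne'
        obtain ⟨k, hk⟩ : ∃ m, sInf (Arrivals C (j + 1) d r) = m + 1 :=
          ⟨_, (Nat.sub_add_cancel hm.1).symm⟩
        rw [hk] at hm ⊢
        rcases (arrivals_succ C j d r k).1 hm with ⟨-, h⟩ | ⟨r', hr', h⟩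
        · exact absurd h h1
        · have hle := Nat.sInf_le h
          have hpos : sInf (Arrivals C j d r') ≠ 0 := by
            have := (Nat.sInf_mem ⟨_, h⟩).1
            omega
          have := Nat.sInf_le (show sInf (Arrivals C j d r') ∈ ({k | k ≠ 0 ∧
            ∃ r' ∈ face d.2 (r - dirVec L d), sInf (Arrivals C j d r') = k} : Set ℕ) from
            ⟨hpos, r', hr', rfl⟩)
          omega
      · refine Nat.sInf_le ((arrivals_succ C j d r _).2 (Or.inr ⟨r₁, hr₁, ?_⟩))
        rw [← m2]
        exact hmem

/-- The state of the decoder in terms of the messages. -/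
theorem decoderStep_iterate (v : ℕ) (hv : 1 ≤ v) (N : Finset (Link D L)) (t : ℕ) [DecidablePred (· ∈ N)] :
    (decoderStep v)^[t] (fun l => if l ∈ N then 1 else 0, fun _ _ => 0) =
      (evolve v N t, messages (fun i => evolve v N (i / v)) (v * t)) := by
  have e0 : (fun l => if l ∈ N then (1 : ZMod 2) else 0) = evolve v N 0 := by
    unfold evolve
    simp only [Function.iterate_zero, id_eq]
    congr!
  have iter : ∀ (t i : ℕ), i ≤ v → (automaton (evolve v N t))^[i]
      (messages (fun i => evolve v N (i / v)) (v * t)) =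
      messages (fun i => evolve v N (i / v)) (v * t + i) := by
    intro t i hi
    induction i with
    | zero => rfl
    | succ i ih =>
      rw [Function.iterate_succ_apply', ih (by omega), ← add_assoc]
      show _ = automaton (evolve v N ((v * t + i) / v)) _
      rw [Nat.mul_add_div (by omega), Nat.div_eq_of_lt (by omega), add_zero]
  have fst : ∀ t, ((decoderStep v)^[t] (evolve v N 0, fun _ _ => 0)).1 = evolve v N t := by
    intro t
    rw [← e0]
    unfold evolve
    congr!
  have main : ∀ t, (decoderStep v)^[t] (evolve v N 0, fun _ _ => 0) =
      (evolve v N t, messages (fun i => evolve v N (i / v)) (v * t)) := by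
    intro t
    induction t with
    | zero => rfl
    | succ t ih =>
      refine Prod.ext ?_ ?_
      · exact fst (t + 1)
      · rw [Function.iterate_succ_apply', ih]
        show (automaton (evolve v N t))^[v] _ = _
        rw [iter t v le_rfl, Nat.mul_succ]
  rw [e0]
  exact main t

theorem evolve_succ {v : ℕ} (hv : 1 ≤ v) (N : Finset (Link D L)) (t : ℕ) :
    evolve v N (t + 1) = feedback (evolve v N t)
      (messages (fun i => evolve v N (i / v)) (v * (t + 1))) := by
  classical
  have h1 := decoderStep_iterate v hv N t
  have h2 := decoderStep_iterate v hv N (t + 1)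
  rw [Function.iterate_succ_apply', h1] at h2
  have h3 := congrArg Prod.fst h2
  have h4 := congrArg Prod.snd h2
  simp only [decoderStep] at h3 h4
  rw [← h4, ← h3]

theorem evolve_zero (v : ℕ) (N : Finset (Link D L)) (l : Link D L) :
    (evolve v N 0 l = 1 ↔ l ∈ N) ∧ (evolve v N 0 l = 0 ↔ l ∉ N) := by
  unfold evolve
  simp only [Function.iterate_zero, id_eq]
  by_cases h : l ∈ N <;> simp [h]

/-! ### Errors on a line -/

/-- The chain on the line through the origin along the axis `a`. -/
def lineChain (a : Fin D) (g : ZMod L → ZMod 2) : Chain D L :=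
  fun l => if l.2 = a ∧ l.1 = Pi.single a (l.1 a) then g (l.1 a) else 0

theorem add_eq_one_iff_ne (x y : ZMod 2) : x + y = 1 ↔ y ≠ x := by
  revert x y; decide

theorem ne_iff_not_iff (x y : ZMod 2) : x ≠ y ↔ ¬ (x = 1 ↔ y = 1) := by
  revert x y; decide

theorem add_ite_eq_one_iff (x : ZMod 2) (P : Prop) [Decidable P] :
    x + (if P then 1 else 0) = 1 ↔ Xor (x = 1) P := by
  have h : ∀ x : ZMod 2, x + 1 = 1 ↔ ¬ x = 1 := by decide
  by_cases hP : P
  · simp only [hP, if_true, h, Xor]; tauto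
  · simp only [hP, if_false, add_zero, Xor]; tauto

theorem sub_unitVec_eq_single {a : Fin D} {r : Site D L} :
    r - unitVec L a = Pi.single a ((r - unitVec L a) a) ↔ r = Pi.single a (r a) := by
  have h : (Pi.single a (r a - 1) : Site D L) = Pi.single a (r a) - Pi.single a 1 :=
    Pi.single_sub _ _ _
  simp only [unitVec, Pi.sub_apply, Pi.single_eq_same, h]
  constructor
  · exact fun h => sub_left_injective h
  · intro h; rw [← h]

theorem isAnyon_lineChain {a : Fin D} {g : ZMod L → ZMod 2} {r : Site D L} :
    IsAnyon (lineChain a g) r ↔ r = Pi.single a (r a) ∧ g (r a - 1) ≠ g (r a) := by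
  unfold IsAnyon syndrome
  rw [Finset.sum_eq_single a]
  · unfold lineChain
    simp only [true_and, sub_unitVec_eq_single]
    by_cases h : r = Pi.single a (r a)
    · rw [if_pos h, if_pos h, add_eq_one_iff_ne]
      simp only [unitVec, Pi.sub_apply, Pi.single_eq_same]
      tauto
    · rw [if_neg h, if_neg h]
      simp [h]
  · intro b _ hb
    simp [lineChain, hb]
  · simp

theorem isAnyon_lineChain_single {a : Fin D} {g : ZMod L → ZMod 2} {n : ZMod L} :
    IsAnyon (lineChain a g) (Pi.single a n) ↔ g (n - 1) ≠ g n := by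
  rw [isAnyon_lineChain, Pi.single_eq_same]
  exact and_iff_right rfl

theorem dirVec_apply (d : Dir D) : dirVec L d d.2 = if d.1 then 1 else -1 := by
  unfold dirVec unitVec
  split_ifs <;> simp

/-- Sideways spreading creates no extra sources: all anyons are on the line, where one is determined
by its coordinate along `a`. -/
theorem source_lineChain {a : Fin D} {g : ZMod L → ZMod 2} {s : Bool} {k : ℕ} {n : ZMod L} :
    Source (lineChain a g) (s, a) k (Pi.single a n) ↔
      g (n - k • (if s then 1 else -1) - 1) ≠ g (n - k • (if s then 1 else -1)) := by
  have e : (Pi.single a n - k • dirVec L (s, a) : Site D L) =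
      Pi.single a (n - k • (if s then 1 else -1)) := by
    have : dirVec L (s, a) = Pi.single a (if s then 1 else -1) := by
      unfold dirVec unitVec
      cases s <;> simp [Pi.single_neg]
    rw [this, ← Pi.single_smul, ← Pi.single_sub]
  rw [← isAnyon_lineChain_single, ← e]
  constructor
  · intro h
    obtain ⟨r', h1, h2⟩ := h.exists_isAnyon
    have h3 := (isAnyon_lineChain.1 h1).1
    rw [Pi.single_eq_same, dirVec_apply] at h2
    simp only at h2
    rw [e, ← h2, ← h3]
    exact h1
  · exact Source.of_isAnyon

/-- A message along another axis has to return to coordinate zero on that axis, hence to travel a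
multiple of `L`. -/
theorem not_source_lineChain {a b : Fin D} (hb : b ≠ a) {g : ZMod L → ZMod 2} {s : Bool} {k : ℕ}
    (hk : 1 ≤ k) (hkL : k < L) {n : ZMod L} :
    ¬ Source (lineChain a g) (s, b) k (Pi.single a n) := by
  intro h
  obtain ⟨r', h1, h2⟩ := h.exists_isAnyon
  rw [(isAnyon_lineChain.1 h1).1, dirVec_apply] at h2
  simp only [Pi.single_eq_of_ne hb] at h2
  have h3 : (k : ZMod L) = 0 := by
    cases s <;> simpa using h2.symm
  rw [ZMod.natCast_eq_zero_iff] at h3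
  exact absurd (Nat.le_of_dvd (by omega) h3) (by omega)

/-! ### The force on the line -/

/-- The convention `sInf ∅ = 0` matches the code 0 for the absence of a message, since genuine
values are at least one. -/
theorem axisForce_sInf {A B : Set ℕ} (hA : ∀ k ∈ A, 1 ≤ k) (hB : ∀ k ∈ B, 1 ≤ k) :
    (axisForce (sInf A) (sInf B) = 1 ↔ ∃ k ∈ B, ∀ k' ≤ k, k' ∉ A) ∧
      (axisForce (sInf A) (sInf B) = -1 ↔ ∃ k ∈ A, ∀ k' ≤ k, k' ∉ B) := by
  have key : ∀ {X Y : Set ℕ}, (∀ k ∈ X, 1 ≤ k) → (∀ k ∈ Y, 1 ≤ k) →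
      ((∃ k ∈ Y, ∀ k' ≤ k, k' ∉ X) ↔ sInf Y ≠ 0 ∧ (sInf X = 0 ∨ sInf Y < sInf X)) := by
    intro X Y hX hY
    constructor
    · rintro ⟨k, hk, h⟩
      have h1 := Nat.sInf_mem ⟨k, hk⟩
      have h2 := Nat.sInf_le hk
      refine ⟨by have := hY _ h1; omega, ?_⟩
      rcases Set.eq_empty_or_nonempty X with rfl | hne
      · left; simp
      · right
        by_contra hcon
        exact h (sInf X) (by omega) (Nat.sInf_mem hne)
    · rintro ⟨h1, h2⟩
      refine ⟨sInf Y, Nat.sInf_mem (Nat.nonempty_of_pos_sInf (Nat.pos_of_ne_zero h1)), ?_⟩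
      intro k' hk' hX'
      have h3 := Nat.sInf_le hX'
      have h4 := hX _ (Nat.sInf_mem ⟨k', hX'⟩)
      omega
  rw [key hA hB, key hB hA]
  generalize sInf A = x
  generalize sInf B = y
  unfold axisForce
  constructor <;> split_ifs <;> simp <;> omega

/-- With messages on one axis only, that axis is selected. The tie-break between its two directions
is irrelevant, as equal messages give no force. -/
theorem force_of_line {m : Messages D L} {r : Site D L} {a : Fin D}
    (h : ∀ s, ∀ b ≠ a, m (s, b) r = 0) (b : Fin D) :
    force m r b = if b = a then axisForce (m (true, a) r) (m (false, a) r) else 0 := by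
  unfold force
  by_cases hb : b = a
  · subst hb
    rw [if_pos rfl]
    split_ifs with hn
    · rfl
    · by_contra hcon
      apply hn
      have hd : dirLabel ((false, b) : Dir D) ≤ dirLabel ((true, b) : Dir D) := by
        simp only [dirLabel]; simp; omega
      have key : ∀ s : Bool, m (s, b) r ≠ 0 → (m (!s, b) r ≠ 0 → m (s, b) r < m (!s, b) r ∨
          (m (s, b) r = m (!s, b) r ∧ s = false)) → IsNearest m r (s, b) := by
        intro s h0 h1
        refine ⟨h0, ?_⟩
        rintro ⟨s', b'⟩ hne
        by_cases hb' : b' = b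
        · subst hb'
          by_cases hs : s' = s
          · subst hs; right; exact ⟨rfl, le_rfl⟩
          · obtain rfl : s' = !s := by cases s <;> cases s' <;> simp_all
            rcases h1 hne with h | ⟨h, rfl⟩
            · exact Or.inl h
            · exact Or.inr ⟨h, hd⟩
        · exact absurd (h s' b' hb') hne
      have k1 := key true
      have k2 := key false
      simp only [Bool.not_true, Bool.not_false] at k1 k2
      generalize m (true, b) r = x at *
      generalize m (false, b) r = y at *
      by_cases hx : x = 0
      · by_cases hy : y = 0
        · exfalso; apply hcon; simp [axisForce, hx, hy]
        · exact ⟨false, k2 hy (fun h => absurd hx h)⟩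
      · by_cases hxy : x < y ∨ y = 0
        · exact ⟨true, k1 hx (fun h => by omega)⟩
        · exact ⟨false, k2 (by omega) (fun h => by simp; omega)⟩
  · rw [if_neg hb, if_neg]
    rintro ⟨s, hs⟩
    exact hs.1 (h s b hb)

/-! ### The decoder on the line -/

/-- Converts update counts to time steps: a message of value `k` read after `v * (t + 1)` updates
was emitted in update `v * (t + 1) - k`, and `v` consecutive updates share the same chain. -/
theorem sub_div_eq {v t k : ℕ} (hv : 1 ≤ v) (hk : 1 ≤ k) (hkt : k ≤ v * (t + 1)) :
    (v * (t + 1) - k) / v = t - (k - 1) / v ∧ (k - 1) / v ≤ t := by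
  have h1 := Nat.div_add_mod (k - 1) v
  have h2 := Nat.mod_lt (k - 1) (show 0 < v by omega)
  have h3 : (k - 1) / v ≤ t := by
    have : (k - 1) / v < t + 1 := (Nat.div_lt_iff_lt_mul (by omega)).2 (by
      rw [Nat.mul_comm]; omega)
    omega
  refine ⟨?_, h3⟩
  generalize (k - 1) / v = e at *
  generalize (k - 1) % v = f at *
  obtain ⟨d, rfl⟩ : ∃ d, t = e + d := ⟨t - e, by omega⟩
  rw [Nat.add_sub_cancel_left]
  have : v * (e + d + 1) - k = v * d + (v - 1 - f) := by
    have e1 : v * (e + d + 1) = v * e + v * d + v := by ring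
    omega
  rw [this, Nat.mul_add_div (by omega), Nat.div_eq_of_lt (by omega), add_zero]

/-- The restriction of a history to the line along the axis `a`, unfolded to `ℤ`. -/
def lineHistory (a : Fin D) (v : ℕ) (N : Finset (Link D L)) (t : ℕ) (l : ℤ) : Prop :=
  evolve v N t (Pi.single a (l : ZMod L), a) = 1

/-- The chain at time `t` is supported on the line along the axis `a`. -/
def OnLine (a : Fin D) (c : Chain D L) : Prop :=
  c = lineChain a fun n => c (Pi.single a n, a)

theorem arrivals_line {v : ℕ} (hv : 1 ≤ v) {a : Fin D} {N : Finset (Link D L)} {t : ℕ}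
    (h : ∀ t' ≤ t, OnLine a (evolve v N t')) (p : ℤ) (k : ℕ) :
    (k ∈ Arrivals (fun i => evolve v N (i / v)) (v * (t + 1)) (true, a)
      (Pi.single a (p : ZMod L)) ↔ SeesLeft v (lineHistory a v N) t p k) ∧
    (k ∈ Arrivals (fun i => evolve v N (i / v)) (v * (t + 1)) (false, a)
      (Pi.single a (p : ZMod L)) ↔ SeesRight v (lineHistory a v N) t p k) := by
  unfold Arrivals SeesLeft SeesRight LineAnyon lineHistory
  simp only [Set.mem_ofPred_eq]
  have base : ∀ P Q : Prop, (1 ≤ k → k ≤ v * (t + 1) → (P ↔ Q)) →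
      ((1 ≤ k ∧ k ≤ v * (t + 1) ∧ P) ↔ (1 ≤ k ∧ (k - 1) / v ≤ t ∧ Q)) := by
    intro P Q hPQ
    constructor
    · rintro ⟨h1, h2, h3⟩
      exact ⟨h1, (sub_div_eq hv h1 h2).2, (hPQ h1 h2).1 h3⟩
    · rintro ⟨h1, h2, h3⟩
      have h4 : k ≤ v * (t + 1) := by
        have := (Nat.div_lt_iff_lt_mul (show 0 < v by omega)).1 (Nat.lt_succ_of_le h2)
        rw [Nat.mul_comm] at this
        have e : v * t.succ = v * (t + 1) := rfl
        omega
      exact ⟨h1, h4, (hPQ h1 h4).2 h3⟩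
  constructor
  · refine base _ _ fun h1 h2 => ?_
    rw [(sub_div_eq hv h1 h2).1, h _ (Nat.sub_le t ((k - 1) / v)), source_lineChain,
      ne_iff_not_iff, ← h _ (Nat.sub_le t ((k - 1) / v))]
    simp
  · refine base _ _ fun h1 h2 => ?_
    rw [(sub_div_eq hv h1 h2).1, h _ (Nat.sub_le t ((k - 1) / v)), source_lineChain,
      ne_iff_not_iff, ← h _ (Nat.sub_le t ((k - 1) / v))]
    simp

theorem arrivals_transverse {v : ℕ} (hv : 1 ≤ v) {a b : Fin D} (hb : b ≠ a)
    {N : Finset (Link D L)} {t : ℕ} (hL : v * (t + 1) < L)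
    (h : ∀ t' ≤ t, OnLine a (evolve v N t')) (s : Bool) (n : ZMod L) :
    Arrivals (fun i => evolve v N (i / v)) (v * (t + 1)) (s, b) (Pi.single a n) = ∅ := by
  rw [Set.eq_empty_iff_forall_notMem]
  rintro k ⟨h1, h2, h3⟩
  simp only at h3
  rw [(sub_div_eq hv h1 h2).1, h _ (Nat.sub_le t ((k - 1) / v))] at h3
  exact not_source_lineChain hb h1 (by omega) h3

theorem line_step {v : ℕ} (hv : 1 ≤ v) {a : Fin D} {N : Finset (Link D L)} {t : ℕ}
    (hL : v * (t + 1) < L) (h : ∀ t' ≤ t, OnLine a (evolve v N t')) :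
    OnLine a (evolve v N (t + 1)) ∧ ∀ l, lineHistory a v N (t + 1) l ↔ Xor (lineHistory a v N t l)
      (MovesRight v (lineHistory a v N) t l ∨ MovesLeft v (lineHistory a v N) t (l + 1)) := by
  have hm := fun d r => messages_eq (fun i => evolve v N (i / v)) hL.le d r
  have hzero : ∀ n : ZMod L, ∀ s, ∀ b ≠ a,
      messages (fun i => evolve v N (i / v)) (v * (t + 1)) (s, b) (Pi.single a n) = 0 := by
    intro n s b hb
    rw [hm, arrivals_transverse hv hb hL h]
    exact Nat.sInf_empty
  have hforce := fun (n : ZMod L) b => force_of_line (hzero n) b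
  have hax : ∀ p : ℤ, _ := fun p : ℤ => axisForce_sInf
    (A := Arrivals (fun i => evolve v N (i / v)) (v * (t + 1)) (true, a)
      (Pi.single a (p : ZMod L)))
    (B := Arrivals (fun i => evolve v N (i / v)) (v * (t + 1)) (false, a)
      (Pi.single a (p : ZMod L))) (fun k hk => hk.1) (fun k hk => hk.1)
  simp only [← hm, fun p k => (arrivals_line hv h p k).1, fun p k => (arrivals_line hv h p k).2]
    at hax
  have hany : ∀ r, IsAnyon (evolve v N t) r → r = Pi.single a (r a) := by
    intro r hr
    rw [h t le_rfl] at hr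
    exact (isAnyon_lineChain.1 hr).1
  have hanyl : ∀ p : ℤ, IsAnyon (evolve v N t) (Pi.single a (p : ZMod L)) ↔
      LineAnyon (lineHistory a v N) t p := by
    intro p
    rw [h t le_rfl, isAnyon_lineChain_single, ne_iff_not_iff]
    unfold LineAnyon lineHistory
    simp
  have hh : ∀ l : ℤ, lineHistory a v N (t + 1) l ↔ feedback (evolve v N t)
      (messages (fun i => evolve v N (i / v)) (v * (t + 1))) (Pi.single a (l : ZMod L), a) = 1 := by
    intro l
    rw [← evolve_succ hv]
    rfl
  rw [OnLine, evolve_succ hv]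
  generalize messages (fun i => evolve v N (i / v)) (v * (t + 1)) = m at *
  have hr : ∀ p : ℤ, IsAnyon (evolve v N t) (Pi.single a (p : ZMod L)) ∧
      force m (Pi.single a (p : ZMod L)) a = 1 ↔ MovesRight v (lineHistory a v N) t p := by
    intro p
    rw [hanyl, hforce, if_pos rfl, (hax p).1]
    rfl
  have hl : ∀ p : ℤ, IsAnyon (evolve v N t) (Pi.single a (p : ZMod L)) ∧
      force m (Pi.single a (p : ZMod L)) a = -1 ↔ MovesLeft v (lineHistory a v N) t p := by
    intro p
    rw [hanyl, hforce, if_pos rfl, (hax p).2]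
    rfl
  constructor
  · funext l
    obtain ⟨r, b⟩ := l
    unfold lineChain
    split_ifs with hc
    · obtain ⟨rfl, hc⟩ := hc
      simp only at hc ⊢
      rw [← hc]
    -- An anyon that moves is on the line and moves along it, so a link off the line is never
    -- flipped.
    · have hnot : ¬ ((IsAnyon (evolve v N t) r ∧ force m r b = 1) ∨
          (IsAnyon (evolve v N t) (r + unitVec L b) ∧ force m (r + unitVec L b) b = -1)) := by
        have hf : ∀ r', IsAnyon (evolve v N t) r' → force m r' b ≠ 0 → b = a := by
          intro r' h1 h2
          by_contra hb
          rw [hany r' h1, hforce, if_neg hb] at h2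
          exact h2 rfl
        rintro (⟨h1, h2⟩ | ⟨h1, h2⟩)
        · exact hc ⟨hf _ h1 (by rw [h2]; decide), hany r h1⟩
        · have hb := hf _ h1 (by rw [h2]; decide)
          subst hb
          have h3 := hany _ h1
          have := sub_unitVec_eq_single (a := b) (r := r + unitVec L b)
          rw [add_sub_cancel_right] at this
          exact hc ⟨rfl, this.2 h3⟩
      unfold feedback
      rw [if_neg hnot, add_zero, h t le_rfl]
      unfold lineChain
      rw [if_neg hc]
  · intro l
    have e : (Pi.single a (l : ZMod L) + unitVec L a : Site D L) =
        Pi.single a ((l + 1 : ℤ) : ZMod L) := by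
      unfold unitVec
      rw [← Pi.single_add]
      push_cast
      rfl
    rw [hh]
    unfold feedback
    rw [add_ite_eq_one_iff]
    simp only [e, hr, hl]
    rfl

/-- The decoder acts on a line as the decoder of the integers. -/
theorem isRun_lineHistory {v : ℕ} (hv : 1 ≤ v) {a : Fin D} {N : Finset (Link D L)}
    (hN : ∀ l ∈ N, l.2 = a ∧ l.1 = Pi.single a (l.1 a)) {τ : ℕ} (hτ : v * τ < L) :
    IsRun v (lineHistory a v N) τ ∧ ∀ t ≤ τ, OnLine a (evolve v N t) := by
  have main : ∀ t ≤ τ, ∀ t' ≤ t, OnLine a (evolve v N t') := by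
    intro t
    induction t with
    | zero =>
      intro _ t' ht'
      obtain rfl : t' = 0 := by omega
      funext l
      unfold lineChain
      split_ifs with h
      · obtain ⟨r, b⟩ := l
        obtain ⟨h1, h2⟩ := h
        simp only at h1 h2
        simp only [h1]
        rw [← h2]
      · exact (evolve_zero v N l).2.2 fun hl => h (hN l hl)
    | succ t ih =>
      intro ht t' ht'
      rcases Nat.lt_or_ge t' (t + 1) with h | h
      · exact ih (by omega) t' (by omega)
      · obtain rfl : t' = t + 1 := by omega
        exact (line_step hv (lt_of_le_of_lt (Nat.mul_le_mul_left _ ht) hτ)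
          (ih (by omega))).1
  refine ⟨fun t ht l => ?_, fun t ht => main t ht t le_rfl⟩
  exact (line_step hv (lt_of_le_of_lt (Nat.mul_le_mul_left _ ht) hτ) (main t ht.le)).2 l

/-! ### Logical errors -/

/-- The parity of the errors on the links along the axis `a` that start in a fixed hyperplane. -/
noncomputable def crossing (L : ℕ) [NeZero L] (a : Fin D) : Chain D L →ₗ[ZMod 2] ZMod 2 :=
  ∑ r ∈ Finset.univ.filter (fun r : Site D L => r a = 0), LinearMap.proj (r, a)

theorem crossing_apply [NeZero L] (a : Fin D) (c : Chain D L) :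
    crossing L a c = ∑ r ∈ Finset.univ.filter (fun r : Site D L => r a = 0), c (r, a) := by
  simp [crossing, LinearMap.sum_apply]

theorem crossing_single [NeZero L] (a b : Fin D) (r : Site D L) :
    crossing L a (Pi.single (r, b) 1) = if b = a ∧ r a = 0 then 1 else 0 := by
  rw [crossing_apply]
  split_ifs with h
  · obtain ⟨rfl, h⟩ := h
    rw [Finset.sum_eq_single r]
    · simp
    · intro r' _ hne
      rw [Pi.single_eq_of_ne]
      simpa using hne
    · intro hr
      exact absurd (by simp [h]) hr
  · refine Finset.sum_eq_zero fun r' hr' => ?_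
    rw [Pi.single_eq_of_ne]
    intro he
    rw [Prod.mk.injEq] at he
    obtain ⟨rfl, rfl⟩ := he
    exact h ⟨rfl, (Finset.mem_filter.1 hr').2⟩

/-- The two links of a plaquette parallel to `a` start at the same coordinate along `a`, so they
cross the hyperplane together or not at all. The full line crosses it once, which makes it
nontrivial. -/
theorem crossing_eq_zero [NeZero L] (a : Fin D) {c : Chain D L} (hc : c ∈ trivialChains D L) :
    crossing L a c = 0 := by
  suffices h : trivialChains D L ≤ LinearMap.ker (crossing L a) from h hc
  refine Submodule.span_le.2 ?_
  rintro _ ⟨r, b, b', hne, rfl⟩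
  rw [SetLike.mem_coe, LinearMap.mem_ker]
  simp only [plaquette, map_add, crossing_single, Pi.add_apply, unitVec]
  by_cases h1 : b = a
  · subst h1
    have h2 : b' ≠ b := fun h => hne h.symm
    simp [h2, hne, CharTwo.add_self_eq_zero]
  · by_cases h2 : b' = a
    · subst h2
      simp [h1, Ne.symm hne, CharTwo.add_self_eq_zero]
    · simp [h1, h2]

theorem lineChain_one_notMem (hL : 1 ≤ L) (a : Fin D) :
    lineChain a (fun _ : ZMod L => (1 : ZMod 2)) ∉ trivialChains D L := by
  have : NeZero L := ⟨by omega⟩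
  intro h
  have h1 := crossing_eq_zero a h
  rw [crossing_apply, Finset.sum_eq_single 0] at h1
  · simp [lineChain] at h1
  · intro r hr hne
    unfold lineChain
    rw [if_neg]
    rintro ⟨-, h2⟩
    simp only at h2
    rw [(Finset.mem_filter.1 hr).2, Pi.single_zero] at h2
    exact hne h2
  · intro h2
    exact absurd (by simp) h2

theorem evolve_eq_of_no_anyon {v : ℕ} (hv : 1 ≤ v) {N : Finset (Link D L)} {τ : ℕ}
    (h : ∀ r, ¬ IsAnyon (evolve v N τ) r) {t : ℕ} (ht : τ ≤ t) :
    evolve v N t = evolve v N τ := by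
  induction t, ht using Nat.le_induction with
  | base => rfl
  | succ t _ ih =>
    rw [evolve_succ hv, ih]
    funext l
    unfold feedback
    rw [if_neg, add_zero]
    rintro (⟨h1, -⟩ | ⟨h1, -⟩) <;> exact h _ h1

/-- On the torus there are sparse patterns that end in a logical error. -/
theorem exists_failing_pattern (a : Fin D) {v : ℕ} (hv : 3 ≤ v) : ∃ L₀ : ℕ, ∀ L : ℕ, 1 ≤ L →
    L₀ ≤ L → ∃ Q : Finset (Link D L), (Q.card : ℝ) ≤ (L : ℝ) ^ Real.logb 6 5 ∧
      ¬ ∃ t₀ : ℕ, ∀ t ≥ t₀, evolve v Q t ∈ trivialChains D L := by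
  classical
  obtain ⟨L₀, hL₀⟩ := exists_filling_pattern hv
  refine ⟨L₀, fun L hL1 hL => ?_⟩
  obtain ⟨h, τ, hrun, hper, hτ, hfull, hcard⟩ := hL₀ L hL
  obtain ⟨Q, hQ⟩ : ∃ Q : Finset (Link D L), Q = ((Finset.Ico (0 : ℤ) L).filter fun l => h 0 l).image
    fun l : ℤ => (Pi.single a (l : ZMod L), a) := ⟨_, rfl⟩
  have hperm : ∀ (m : ℕ) (l : ℤ), h 0 (l + L * m) ↔ h 0 l := by
    intro m l
    induction m with
    | zero => simp
    | succ m ih =>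
      rw [show l + L * ((m + 1 : ℕ) : ℤ) = l + L * m + L by push_cast; ring, hper, ih]
  have hperz : ∀ (m l : ℤ), h 0 (l + L * m) ↔ h 0 l := by
    intro m l
    obtain ⟨k, rfl | rfl⟩ := m.eq_nat_or_neg
    · exact hperm k l
    · rw [← hperm k (l + L * -k), show l + L * -(k : ℤ) + L * k = l by ring]
  have hmem : ∀ l : ℤ, ((Pi.single a (l : ZMod L), a) : Link D L) ∈ Q ↔ h 0 l := by
    intro l
    rw [hQ, Finset.mem_image]
    constructor
    · rintro ⟨l', hl', he⟩
      have he' := congrFun (Prod.mk.inj he).1 a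
      rw [Pi.single_eq_same, Pi.single_eq_same, ZMod.intCast_eq_intCast_iff_dvd_sub] at he'
      obtain ⟨m, hm⟩ := he'
      rw [show l = l' + L * m by linarith, hperz]
      exact (Finset.mem_filter.1 hl').2
    · intro hl
      have hLpos : (0 : ℤ) < L := by exact_mod_cast hL1
      have hdm := Int.mul_ediv_add_emod l L
      refine ⟨l % (L : ℤ), Finset.mem_filter.2 ⟨Finset.mem_Ico.2 ⟨Int.emod_nonneg _ hLpos.ne',
        Int.emod_lt_of_pos _ hLpos⟩, ?_⟩, ?_⟩
      · rw [← hperz (l / (L : ℤ)), add_comm, hdm]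
        exact hl
      · simp only [Prod.mk.injEq, and_true]
        congr 1
        exact ZMod.intCast_mod l L
  have hline : ∀ l ∈ Q, l.2 = a ∧ l.1 = Pi.single a (l.1 a) := by
    intro l hl
    rw [hQ, Finset.mem_image] at hl
    obtain ⟨l', -, rfl⟩ := hl
    exact ⟨rfl, by simp⟩
  obtain ⟨hr, hon⟩ := isRun_lineHistory (show 1 ≤ v by omega) hline hτ
  have hend : evolve v Q τ = lineChain a (fun _ : ZMod L => (1 : ZMod 2)) := by
    rw [hon τ le_rfl]
    congr 1
    funext n
    obtain ⟨l, rfl⟩ := ZMod.intCast_surjective n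
    have := (hr.eq_of_window (by omega) hrun (lo := l - (v + 2) * τ) (hi := l + (v + 2) * τ)
      (fun l _ _ => by
        unfold lineHistory
        rw [(evolve_zero v Q _).1, hmem]) τ le_rfl l (by omega) (by omega)).2 (hfull l)
    exact this
  refine ⟨Q, ?_, ?_⟩
  · refine le_trans ?_ hcard
    rw [hQ]
    exact_mod_cast Finset.card_image_le
  · rintro ⟨t₀, ht₀⟩
    have h1 := ht₀ (max t₀ τ) (le_max_left _ _)
    rw [evolve_eq_of_no_anyon (by omega) (fun r hr => ?_) (le_max_right t₀ τ), hend] at h1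
    · exact lineChain_one_notMem hL1 a h1
    · rw [hend] at hr
      exact (isAnyon_lineChain.1 hr).2 rfl

/-- A persistent pattern on a segment delays the decoder. -/
theorem Persistent.le_decodingTime {a : Fin D} {v m t₀ : ℕ} (hv : 1 ≤ v) {F : Finset ℕ}
    (hF : Persistent v m t₀ F) (hL : v * t₀ < L) {N : Finset (Link D L)}
    (hN : ∀ l ∈ N, l.2 = a ∧ l.1 = Pi.single a (l.1 a)) {z : ℕ}
    (hz : ∀ i < m, ((Pi.single a ((z + i : ℕ) : ZMod L), a) : Link D L) ∈ N ↔ i ∈ F) :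
    (t₀ : ℝ≥0∞) ≤ decodingTime v N := by
  obtain ⟨hr, hon⟩ := isRun_lineHistory hv hN hL
  unfold decodingTime
  refine le_iInf₂ fun t ht => ?_
  by_contra hcon
  have hlt : t ≤ t₀ := by
    have := not_le.1 hcon
    exact_mod_cast this.le
  obtain ⟨p, hp⟩ := hF _ z hr (fun i hi => by
    unfold lineHistory
    rw [(evolve_zero v N _).1, ← hz i hi]
    push_cast
    rfl) t hlt
  refine ht (Pi.single a (p : ZMod L)) ?_
  rw [hon t hlt, isAnyon_lineChain_single, ne_iff_not_iff]
  unfold LineAnyon lineHistory at hp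
  simpa using hp

/-! ### Noise models -/

theorem prob_mono {E : NoiseModel D L} {S S' : Set (Finset (Link D L))} (h : S ⊆ S') :
    prob E S ≤ prob E S' := E.toOuterMeasure.mono h

theorem prob_le_one (E : NoiseModel D L) (S : Set (Finset (Link D L))) : prob E S ≤ 1 := by
  refine (prob_mono (Set.subset_univ S)).trans (le_of_eq ?_)
  exact (PMF.toOuterMeasure_apply_eq_one_iff _ _).2 (Set.subset_univ _)

/-- The law of a set whose index is drawn from finitely many with given probabilities. -/
theorem exists_noise {ι : Type*} [Fintype ι] (f : ι → ℝ) (hf : ∀ i, 0 ≤ f i) (h1 : ∑ i, f i = 1)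
    (Q : ι → Finset (Link D L)) : ∃ E : NoiseModel D L, ∀ S, prob E S =
      ENNReal.ofReal (∑ i, (Q ⁻¹' S).indicator f i) := by
  have hsum : ∑ i, ENNReal.ofReal (f i) = 1 := by
    rw [← ENNReal.ofReal_sum_of_nonneg fun i _ => hf i, h1, ENNReal.ofReal_one]
  refine ⟨(PMF.ofFintype (fun i => ENNReal.ofReal (f i)) hsum).map Q, fun S => ?_⟩
  unfold prob
  rw [PMF.toOuterMeasure_map_apply, PMF.toOuterMeasure_apply_fintype,
    ENNReal.ofReal_sum_of_nonneg]
  · refine Finset.sum_congr rfl fun i _ => ?_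
    by_cases h : i ∈ Q ⁻¹' S
    · rw [Set.indicator_of_mem h, Set.indicator_of_mem h, PMF.ofFintype_apply]
    · rw [Set.indicator_of_notMem h, Set.indicator_of_notMem h, ENNReal.ofReal_zero]
  · intro i _
    exact Set.indicator_nonneg (fun i _ => hf i) i

/-- A mixture of finitely many error patterns. -/
theorem exists_mixture {p : ℝ} (hp0 : 0 < p) (hp1 : p < 1) {n : ℕ} (hn : 1 ≤ n)
    (Q : Fin n → Finset (Link D L)) : ∃ E : NoiseModel D L, IsPBounded p E ∧
      ∀ i S, Q i ∈ S → ENNReal.ofReal (p ^ (Q i).card / n) ≤ prob E S := by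
  have hn' : (0 : ℝ) < n := by exact_mod_cast hn
  have hpow : ∀ k : ℕ, 0 ≤ p ^ k := fun k => pow_nonneg hp0.le k
  have hsum : ∑ i : Fin n, p ^ (Q i).card / n ≤ 1 := by
    calc ∑ i : Fin n, p ^ (Q i).card / n ≤ ∑ _i : Fin n, 1 / (n : ℝ) :=
          Finset.sum_le_sum fun i _ =>
            div_le_div_of_nonneg_right (pow_le_one₀ hp0.le hp1.le) hn'.le
      _ = 1 := by
          rw [Finset.sum_const, Finset.card_univ, Fintype.card_fin, nsmul_eq_mul]
          field_simp
  -- The mass not used by the patterns is given to the absence of errors, which contains no nonempty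
  -- `A`.
  obtain ⟨f, hf⟩ : ∃ f : Option (Fin n) → ℝ, f = fun o => o.elim
    (1 - ∑ i : Fin n, p ^ (Q i).card / n) fun i => p ^ (Q i).card / n := ⟨_, rfl⟩
  obtain ⟨R, hR⟩ : ∃ R : Option (Fin n) → Finset (Link D L), R = fun o => o.elim ∅ Q := ⟨_, rfl⟩
  have hf0 : ∀ o, 0 ≤ f o := by
    rintro (_ | i)
    · rw [hf]; exact sub_nonneg.2 hsum
    · rw [hf]; exact div_nonneg (hpow _) hn'.le
  obtain ⟨E, hE⟩ := exists_noise f hf0 (by rw [Fintype.sum_option, hf]; simp) R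
  refine ⟨E, fun A => ?_, fun i S hi => ?_⟩
  · rcases A.eq_empty_or_nonempty with rfl | hA
    · simpa using prob_le_one E _
    · rw [hE, Fintype.sum_option]
      refine ENNReal.ofReal_le_ofReal ?_
      rw [Set.indicator_of_notMem, zero_add]
      · calc _ ≤ ∑ _i : Fin n, p ^ A.card / (n : ℝ) := by
              refine Finset.sum_le_sum fun i _ => ?_
              refine Set.indicator_le' (f := f) (g := fun _ => p ^ A.card / (n : ℝ)) ?_ ?_ (some i)
              · rintro (_ | j) hj
                · rw [hR] at hj
                  exact absurd (Finset.subset_empty.1 hj) hA.ne_empty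
                · rw [hR] at hj
                  rw [hf]
                  exact div_le_div_of_nonneg_right
                    (pow_le_pow_of_le_one hp0.le hp1.le (Finset.card_le_card hj)) hn'.le
              · intro _ _
                exact div_nonneg (hpow _) hn'.le
          _ = p ^ A.card := by
            rw [Finset.sum_const, Finset.card_univ, Fintype.card_fin, nsmul_eq_mul]
            field_simp
      · intro h
        rw [hR] at h
        exact hA.ne_empty (Finset.subset_empty.1 h)
  · rw [hE]
    refine ENNReal.ofReal_le_ofReal ?_
    have h1 : some i ∈ R ⁻¹' S := by rw [hR]; exact hi
    refine le_trans (le_of_eq ?_) (Finset.single_le_sum (f := (R ⁻¹' S).indicator f)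
      (fun o _ => Set.indicator_nonneg (fun o _ => hf0 o) o) (Finset.mem_univ (some i)))
    rw [Set.indicator_of_mem h1, hf]
    rfl

/-- The probability that a random subset, containing each point independently with probability `a`,
avoids `J`. -/
theorem sum_disjoint {ι : Type*} [Fintype ι] [DecidableEq ι] {a b : ℝ} (hab : a + b = 1)
    (J : Finset ι) : ∑ T : Finset ι with Disjoint T J,
      a ^ T.card * b ^ (Fintype.card ι - T.card) = b ^ J.card := by
  have hfil : (Finset.univ.filter fun T : Finset ι => Disjoint T J) = Jᶜ.powerset := by
    ext T
    rw [Finset.mem_filter, Finset.mem_powerset, Finset.subset_compl_iff_disjoint_right]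
    simp
  rw [hfil]
  have hcard := J.card_add_card_compl
  calc ∑ T ∈ Jᶜ.powerset, a ^ T.card * b ^ (Fintype.card ι - T.card)
      = ∑ T ∈ Jᶜ.powerset, b ^ J.card * (a ^ T.card * b ^ (Jᶜ.card - T.card)) := by
        refine Finset.sum_congr rfl fun T hT => ?_
        have := Finset.card_le_card (Finset.mem_powerset.1 hT)
        rw [show Fintype.card ι - T.card = J.card + (Jᶜ.card - T.card) by omega, pow_add]
        ring
    _ = b ^ J.card := by
        rw [← Finset.mul_sum, Finset.sum_pow_mul_eq_add_pow, hab, one_pow, mul_one]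

theorem sum_superset {ι : Type*} [Fintype ι] [DecidableEq ι] {a b : ℝ} (hab : a + b = 1)
    (J : Finset ι) : ∑ T : Finset ι with J ⊆ T,
      a ^ T.card * b ^ (Fintype.card ι - T.card) = a ^ J.card := by
  rw [← sum_disjoint (a := b) (b := a) (by rw [add_comm, hab]) J]
  refine Finset.sum_nbij' (fun T => Tᶜ) (fun T => Tᶜ) ?_ ?_ ?_ ?_ ?_
  · intro T hT
    rw [Finset.mem_filter] at *
    exact ⟨Finset.mem_univ _, Finset.disjoint_left.2 fun i hi hJ =>
      Finset.mem_compl.1 hi (hT.2 hJ)⟩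
  · intro T hT
    rw [Finset.mem_filter] at *
    exact ⟨Finset.mem_univ _, fun i hi => Finset.mem_compl.2 fun hi' =>
      Finset.disjoint_left.1 hT.2 hi' hi⟩
  · simp
  · simp
  · intro T _
    have := T.card_add_card_compl
    rw [show Fintype.card ι - T.card = Tᶜ.card by omega,
      show Fintype.card ι - Tᶜ.card = T.card by omega, mul_comm]

/-- Independent disjoint error patterns. -/
theorem exists_independent {p q : ℝ} (hp0 : 0 < p) (hp1 : p < 1) (hq0 : 0 ≤ q) (hq1 : q ≤ 1)
    {ι : Type*} [Fintype ι] [DecidableEq ι] (Q : ι → Finset (Link D L))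
    (hdisj : ∀ i j, i ≠ j → Disjoint (Q i) (Q j)) (hq : ∀ i, q ≤ p ^ (Q i).card) :
    ∃ E : NoiseModel D L, IsPBounded p E ∧ ∀ (J : Finset ι) (S : Set (Finset (Link D L))),
      (∀ T : Finset ι, ¬ Disjoint T J → T.biUnion Q ∉ S) →
        prob E S ≤ ENNReal.ofReal ((1 - q) ^ J.card) := by
  classical
  obtain ⟨f, hf⟩ : ∃ f : Finset ι → ℝ, f = fun T =>
    q ^ T.card * (1 - q) ^ (Fintype.card ι - T.card) := ⟨_, rfl⟩
  have hf0 : ∀ T, 0 ≤ f T := by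
    intro T
    rw [hf]
    exact mul_nonneg (pow_nonneg hq0 _) (pow_nonneg (by linarith) _)
  have hab : q + (1 - q) = 1 := by ring
  have hle : ∀ (P : Finset ι → Prop) (U : Set (Finset ι)), (∀ T ∈ U, P T) →
      ∑ T, U.indicator f T ≤ ∑ T : Finset ι with P T, f T := by
    intro P U hU
    rw [Finset.sum_filter]
    refine Finset.sum_le_sum fun T _ => ?_
    by_cases hT : T ∈ U
    · rw [Set.indicator_of_mem hT, if_pos (hU T hT)]
    · rw [Set.indicator_of_notMem hT]
      split_ifs
      · exact hf0 T
      · exact le_rfl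
  obtain ⟨E, hE⟩ := exists_noise f hf0 (by
    have := sum_disjoint hab (∅ : Finset ι)
    simp only [Finset.disjoint_empty_right, Finset.filter_true, Finset.card_empty, pow_zero]
      at this
    rw [hf]
    exact this) fun T : Finset ι => T.biUnion Q
  refine ⟨E, fun A => ?_, fun J S hS => ?_⟩
  · rw [hE]
    refine ENNReal.ofReal_le_ofReal ?_
    by_cases hA : A ⊆ Finset.univ.biUnion Q
    -- All blocks that meet `A` must be present, with probability `q ^ J.card`. Each factor
    -- satisfies `q ≤ p ^ (Q i).card ≤ p ^ (A ∩ Q i).card`.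
    · obtain ⟨J, hJ⟩ : ∃ J : Finset ι, J = Finset.univ.filter fun i => (A ∩ Q i).Nonempty := ⟨_, rfl⟩
      refine (hle (fun T => J ⊆ T) _ ?_).trans ?_
      · intro T hT i hi
        rw [hJ, Finset.mem_filter] at hi
        obtain ⟨l, hl⟩ := hi.2
        rw [Finset.mem_inter] at hl
        obtain ⟨j, hj, hlj⟩ := Finset.mem_biUnion.1 (hT hl.1)
        by_contra hcon
        have hne : i ≠ j := by rintro rfl; exact hcon hj
        exact Finset.disjoint_left.1 (hdisj i j hne) hl.2 hlj
      · have h1 := sum_superset hab J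
        refine (show _ = _ by simp only [hf]; congr!).trans_le (h1.trans_le ?_)
        have hcard : A.card ≤ ∑ i ∈ J, (A ∩ Q i).card := by
          refine le_trans (Finset.card_le_card ?_) Finset.card_biUnion_le
          intro l hl
          obtain ⟨i, -, hi⟩ := Finset.mem_biUnion.1 (hA hl)
          have : l ∈ A ∩ Q i := Finset.mem_inter.2 ⟨hl, hi⟩
          exact Finset.mem_biUnion.2 ⟨i, by
            rw [hJ, Finset.mem_filter]; exact ⟨Finset.mem_univ _, l, this⟩, this⟩
        calc q ^ J.card = ∏ _i ∈ J, q := by rw [Finset.prod_const]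
          _ ≤ ∏ i ∈ J, p ^ (A ∩ Q i).card := by
              refine Finset.prod_le_prod (fun _ _ => hq0) fun i _ => (hq i).trans ?_
              exact pow_le_pow_of_le_one hp0.le hp1.le
                (Finset.card_le_card Finset.inter_subset_right)
          _ = p ^ ∑ i ∈ J, (A ∩ Q i).card := by rw [Finset.prod_pow_eq_pow_sum]
          _ ≤ p ^ A.card := pow_le_pow_of_le_one hp0.le hp1.le hcard
    · rw [Finset.sum_eq_zero]
      · positivity
      · intro T _
        refine Set.indicator_of_notMem (fun hT => hA ?_) _
        exact Finset.Subset.trans hT (Finset.biUnion_subset_biUnion_of_subset_left _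
          (Finset.subset_univ _))
  · rw [hE]
    refine ENNReal.ofReal_le_ofReal ?_
    have h1 := sum_disjoint hab J
    rw [← h1]
    refine (hle (fun T => Disjoint T J) _ ?_).trans (le_of_eq ?_)
    · intro T hT
      by_contra hcon
      exact hS T hcon hT
    · simp only [hf]; congr!

/-! ### Noise models with large failure rate -/

theorem isPBounded_pure_empty (p : ℝ) : IsPBounded p (PMF.pure ∅ : NoiseModel D L) := by
  classical
  intro A
  unfold prob
  rw [PMF.toOuterMeasure_pure_apply]
  split_ifs with h
  · rw [Finset.subset_empty.1 h]
    simp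
  · exact bot_le

/-- The model is chosen before the speed: it mixes, with weight `1 / L` each, failing patterns for
all `v < L` for which there is one with at most `B` links. -/
theorem exists_noise_logicalFailureRate {p : ℝ} (hp0 : 0 < p) (hp1 : p < 1) (hL : 1 ≤ L) (B : ℝ) :
    ∃ E : NoiseModel D L, IsPBounded p E ∧ ∀ v < L, ∀ Q : Finset (Link D L), (Q.card : ℝ) ≤ B →
      (¬ ∃ t₀, ∀ t ≥ t₀, evolve v Q t ∈ trivialChains D L) →
        ENNReal.ofReal (p ^ B / L) ≤ logicalFailureRate v E := by
  classical
  have hQ : ∀ v : Fin L, ∃ Q : Finset (Link D L),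
      ∀ Q₀ : Finset (Link D L), (Q₀.card : ℝ) ≤ B →
        (¬ ∃ t₀, ∀ t ≥ t₀, evolve v Q₀ t ∈ trivialChains D L) →
          (Q.card : ℝ) ≤ B ∧ ¬ ∃ t₀, ∀ t ≥ t₀, evolve v Q t ∈ trivialChains D L := by
    intro v
    by_cases h : ∃ Q : Finset (Link D L), (Q.card : ℝ) ≤ B ∧
        ¬ ∃ t₀, ∀ t ≥ t₀, evolve v Q t ∈ trivialChains D L
    · obtain ⟨Q, hQ⟩ := h
      exact ⟨Q, fun _ _ _ => hQ⟩
    · exact ⟨∅, fun Q₀ h1 h2 => absurd ⟨Q₀, h1, h2⟩ h⟩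
  choose Q hQ using hQ
  obtain ⟨E, hE, hE'⟩ := exists_mixture hp0 hp1 hL Q
  refine ⟨E, hE, fun v hv Q₀ h1 h2 => ?_⟩
  obtain ⟨h3, h4⟩ := hQ ⟨v, hv⟩ Q₀ h1 h2
  refine le_trans (ENNReal.ofReal_le_ofReal ?_) (hE' ⟨v, hv⟩ _ h4)
  refine div_le_div_of_nonneg_right ?_ (Nat.cast_nonneg L)
  rw [← Real.rpow_natCast]
  exact Real.rpow_le_rpow_of_exponent_ge hp0 hp1.le h3

theorem logb_pos : 0 < Real.logb 6 5 := lt_trans (by norm_num) Scale.lt_logb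

theorem exists_noise_family_logicalFailureRate (a : Fin D) {p : ℝ} (hp0 : 0 < p) (hp1 : p < 1) :
    ∃ (E : ∀ L : ℕ, NoiseModel D L) (C : ℝ),
      (∀ L : ℕ, 1 ≤ L → IsPBounded p (E L)) ∧
      ∀ v : ℕ, 3 ≤ v → ∃ L₀ : ℕ, ∀ L : ℕ, 1 ≤ L → L₀ ≤ L →
        ENNReal.ofReal (Real.exp (-(C * (L : ℝ) ^ Real.logb 6 5))) ≤
          logicalFailureRate v (E L) := by
  have hl0 := logb_pos
  have hE : ∀ L : ℕ, ∃ E : NoiseModel D L, 1 ≤ L → IsPBounded p E ∧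
      ∀ v < L, ∀ Q : Finset (Link D L), (Q.card : ℝ) ≤ (L : ℝ) ^ Real.logb 6 5 →
      (¬ ∃ t₀, ∀ t ≥ t₀, evolve v Q t ∈ trivialChains D L) →
        ENNReal.ofReal (p ^ ((L : ℝ) ^ Real.logb 6 5) / L) ≤ logicalFailureRate v E := by
    intro L
    by_cases hL : 1 ≤ L
    · obtain ⟨E, hE⟩ := exists_noise_logicalFailureRate hp0 hp1 hL ((L : ℝ) ^ Real.logb 6 5)
      exact ⟨E, fun _ => hE⟩
    · exact ⟨PMF.pure ∅, fun h => absurd h hL⟩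
  choose E hE using hE
  -- The second summand pays for the factor `1 / L`, by `log L ≤ L ^ α / α` with `α = logb 6 5`.
  refine ⟨E, -Real.log p + 1 / Real.logb 6 5, fun L hL => (hE L hL).1, fun v hv => ?_⟩
  obtain ⟨L₀, hL₀⟩ := exists_failing_pattern a hv
  refine ⟨max L₀ (v + 1), fun L hL hL' => ?_⟩
  obtain ⟨Q, hQ, hf⟩ := hL₀ L hL ((le_max_left _ _).trans hL')
  refine le_trans (ENNReal.ofReal_le_ofReal ?_)
    ((hE L hL).2 v (lt_of_lt_of_le v.lt_succ_self ((le_max_right _ _).trans hL')) Q hQ hf)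
  have hLp : (0 : ℝ) < L := by exact_mod_cast hL
  have hlog := Real.log_le_rpow_div hLp.le hl0
  have h1 : p ^ ((L : ℝ) ^ Real.logb 6 5) / L =
      Real.exp (Real.log p * (L : ℝ) ^ Real.logb 6 5 - Real.log L) := by
    rw [Real.exp_sub, Real.exp_log hLp, ← Real.rpow_def_of_pos hp0]
  rw [h1]
  refine Real.exp_le_exp.2 ?_
  have h2 : 1 / Real.logb 6 5 * (L : ℝ) ^ Real.logb 6 5 =
      (L : ℝ) ^ Real.logb 6 5 / Real.logb 6 5 := by ring
  rw [add_mul, h2]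
  linarith

/-! ### Noise models with large decoding time -/

theorem eq_of_mul_add_eq {m b i i' : ℕ} {k k' : ℕ × ℕ} (hi : i < m) (hi' : i' < m)
    (hk : k.2 < b) (hk' : k'.2 < b)
    (h : (k.1 * b + k.2) * m + i = (k'.1 * b + k'.2) * m + i') : k = k' ∧ i = i' := by
  have hm : 0 < m := by omega
  have hb : 0 < b := by omega
  have h1 : i = i' := by
    have := congrArg (· % m) h
    simpa [Nat.mod_eq_of_lt hi, Nat.mod_eq_of_lt hi'] using this
  subst h1
  have h2 := Nat.eq_of_mul_eq_mul_right hm (Nat.add_right_cancel h)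
  have h3 : k.2 = k'.2 := by
    have := congrArg (· % b) h2
    simpa [Nat.mod_eq_of_lt hk, Nat.mod_eq_of_lt hk'] using this
  rw [h3] at h2
  exact ⟨Prod.ext (Nat.eq_of_mul_eq_mul_right hb (Nat.add_right_cancel h2)) h3, rfl⟩

theorem mul_add_lt_of_lt {m b n x y i : ℕ} (hx : x < n) (hy : y < b) (hi : i < m) :
    (x * b + y) * m + i < n * (b * m) := by
  have h1 : x * b + y + 1 ≤ n * b := by nlinarith
  nlinarith

/-- The line carries `n * t₀` disjoint segments of length `t₀ ^ 2`, with `n` of them reserved for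
each speed below `t₀`. One present block for the actual speed delays the decoder, so failure to
delay requires all `n` to be absent. -/
theorem exists_noise_decodingTime (a : Fin D) {p q : ℝ} (hp0 : 0 < p) (hp1 : p < 1) (hq0 : 0 ≤ q)
    (hq1 : q ≤ 1) {n t₀ : ℕ} (hn : 1 ≤ n) (hL : n * t₀ ^ 3 ≤ L) {B : ℝ} (hB0 : 0 ≤ B)
    (hB : ∀ k : ℕ, (k : ℝ) ≤ B → q ≤ p ^ k) :
    ∃ E : NoiseModel D L, IsPBounded p E ∧ ∀ v, 1 ≤ v → v < t₀ → ∀ F : Finset ℕ,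
      (∀ i ∈ F, i < t₀ ^ 2) → Persistent v (t₀ ^ 2) t₀ F → (F.card : ℝ) ≤ B →
        prob E {N | decodingTime v N < t₀} ≤ ENNReal.ofReal ((1 - q) ^ n) := by
  classical
  have hF : ∀ v : Fin t₀, ∃ F : Finset ℕ, ((∀ i ∈ F, i < t₀ ^ 2) ∧ (F.card : ℝ) ≤ B) ∧
      ∀ F₀ : Finset ℕ, (∀ i ∈ F₀, i < t₀ ^ 2) → Persistent v (t₀ ^ 2) t₀ F₀ →
        (F₀.card : ℝ) ≤ B → Persistent v (t₀ ^ 2) t₀ F := by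
    intro v
    by_cases h : ∃ F : Finset ℕ, (∀ i ∈ F, i < t₀ ^ 2) ∧ Persistent v (t₀ ^ 2) t₀ F ∧
        (F.card : ℝ) ≤ B
    · obtain ⟨F, h1, h2, h3⟩ := h
      exact ⟨F, ⟨h1, h3⟩, fun _ _ _ _ => h2⟩
    · exact ⟨∅, ⟨by simp, by simpa using hB0⟩,
        fun F₀ h1 h2 h3 => absurd ⟨F₀, h1, h2, h3⟩ h⟩
  choose F hF hF' using hF
  have hcube : t₀ ^ 3 = t₀ * t₀ ^ 2 := by ring
  rw [hcube] at hL
  obtain ⟨z, hz⟩ : ∃ z : Fin n × Fin t₀ → ℕ, z = fun k => (k.1 * t₀ + k.2) * t₀ ^ 2 := ⟨_, rfl⟩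
  obtain ⟨g, hg⟩ : ∃ g : ℕ → Link D L, g = fun j : ℕ => (Pi.single a (j : ZMod L), a) := ⟨_, rfl⟩
  have hzL : ∀ k, ∀ i < t₀ ^ 2, z k + i < L := fun k i hi => by
    rw [hz]
    exact (mul_add_lt_of_lt k.1.2 k.2.2 hi).trans_le hL
  have hinj : ∀ k k', ∀ i < t₀ ^ 2, ∀ i' < t₀ ^ 2, g (z k + i) = g (z k' + i') →
      k = k' ∧ i = i' := by
    intro k k' i hi i' hi' h
    rw [hg] at h
    have h1 := Pi.single_injective a (Prod.mk.inj h).1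
    rw [ZMod.natCast_eq_natCast_iff'] at h1
    rw [Nat.mod_eq_of_lt (hzL k i hi), Nat.mod_eq_of_lt (hzL k' i' hi')] at h1
    rw [hz] at h1
    obtain ⟨h2, h3⟩ := eq_of_mul_add_eq (k := (k.1, k.2)) (k' := (k'.1, k'.2)) hi hi'
      k.2.2 k'.2.2 h1
    obtain ⟨h4, h5⟩ := Prod.mk.inj h2
    exact ⟨Prod.ext (Fin.ext h4) (Fin.ext h5), h3⟩
  obtain ⟨Q, hQ⟩ : ∃ Q : Fin n × Fin t₀ → Finset (Link D L),
    Q = fun k => (F k.2).image fun i => g (z k + i) := ⟨_, rfl⟩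
  have hmem : ∀ k l, l ∈ Q k ↔ ∃ i ∈ F k.2, g (z k + i) = l := fun k l => by
    rw [hQ, Finset.mem_image]
  obtain ⟨E, hE, hE'⟩ := exists_independent hp0 hp1 hq0 hq1 Q (by
    intro k k' hne
    rw [Finset.disjoint_left]
    intro l hl hl'
    obtain ⟨i, hi, rfl⟩ := (hmem _ _).1 hl
    obtain ⟨i', hi', h⟩ := (hmem _ _).1 hl'
    exact hne (hinj _ _ _ ((hF _).1 i hi) _ ((hF _).1 i' hi') h.symm).1) (by
    intro k
    refine hB _ (le_trans ?_ (hF k.2).2)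
    rw [hQ]
    exact_mod_cast Finset.card_image_le)
  refine ⟨E, hE, fun v hv hvt F₀ h1 h2 h3 => ?_⟩
  have hpers := hF' ⟨v, hvt⟩ F₀ h1 h2 h3
  obtain ⟨J, hJ⟩ : ∃ J : Finset (Fin n × Fin t₀),
    J = Finset.univ.image fun m : Fin n => (m, (⟨v, hvt⟩ : Fin t₀)) := ⟨_, rfl⟩
  have hJc : J.card = n := by
    rw [hJ, Finset.card_image_of_injective _ fun m m' h => (Prod.mk.inj h).1, Finset.card_univ,
      Fintype.card_fin]
  rw [← hJc]
  refine hE' J _ fun T hT => ?_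
  rw [Set.mem_ofPred_eq, not_lt]
  obtain ⟨k, hkT, hkJ⟩ := Finset.not_disjoint_iff.1 hT
  rw [hJ] at hkJ
  obtain ⟨m, -, rfl⟩ := Finset.mem_image.1 hkJ
  have hvL : v * t₀ < L := by
    have ht1 : 1 ≤ t₀ := by omega
    have : t₀ * t₀ ≤ t₀ * t₀ ^ 2 := by nlinarith
    have h6 : v * t₀ < t₀ * t₀ := by nlinarith
    nlinarith
  refine hpers.le_decodingTime (a := a) hv hvL (z := z (m, ⟨v, hvt⟩)) ?_ ?_
  · intro l hl
    obtain ⟨k, -, hk⟩ := Finset.mem_biUnion.1 hl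
    obtain ⟨i, -, rfl⟩ := (hmem _ _).1 hk
    rw [hg]
    simp
  · intro i hi
    constructor
    · intro h
      obtain ⟨k, -, hk⟩ := Finset.mem_biUnion.1 h
      obtain ⟨i', hi', h'⟩ := (hmem _ _).1 hk
      have h'' : g (z k + i') = g (z (m, ⟨v, hvt⟩) + i) := by rw [h', hg]
      obtain ⟨rfl, rfl⟩ := hinj _ _ _ ((hF _).1 i' hi') _ hi h''
      exact hi'
    · intro h
      exact Finset.mem_biUnion.2 ⟨_, hkT, (hmem _ _).2 ⟨i, h, by rw [hg]⟩⟩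

/-- Markov's inequality in the form `s ≤ s * P(T < s) + E T`. -/
theorem le_expectedDecodingTime {E : NoiseModel D L} {v s : ℕ}
    (h : prob E {N | decodingTime v N < s} ≤ 1 / 2) :
    (s : ℝ≥0∞) / 2 ≤ expectedDecodingTime v E := by
  have h1 : (s : ℝ≥0∞) ≤ s * prob E {N | decodingTime v N < s} + expectedDecodingTime v E := by
    calc (s : ℝ≥0∞) = ∑' N, E N * s := by rw [ENNReal.tsum_mul_right, E.tsum_coe, one_mul]
      _ ≤ ∑' N, (s * {N | decodingTime v N < s}.indicator E N + E N * decodingTime v N) := by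
          refine ENNReal.tsum_le_tsum fun N => ?_
          by_cases hN : decodingTime v N < s
          · rw [Set.indicator_of_mem (by exact hN), mul_comm]
            exact le_self_add
          · exact (mul_le_mul_right (not_lt.1 hN) (E N)).trans le_add_self
      _ = _ := by
          rw [ENNReal.tsum_add, ENNReal.tsum_mul_left]
          unfold prob expectedDecodingTime
          rw [PMF.toOuterMeasure_apply]
  have h2 : (s : ℝ≥0∞) * prob E {N | decodingTime v N < s} ≤ s / 2 := by
    rw [ENNReal.div_eq_inv_mul, mul_comm, ← one_div]
    gcongr
  have h3 : (s : ℝ≥0∞) / 2 + s / 2 ≤ s / 2 + expectedDecodingTime v E := by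
    rw [ENNReal.add_halves]
    exact h1.trans (by gcongr)
  refine (ENNReal.add_le_add_iff_left ?_).1 h3
  exact ENNReal.div_ne_top (ENNReal.natCast_ne_top s) (by norm_num)

/-! ### Asymptotics of the decoding time -/

/-- The real-valued time scale attached to size `L`, whose `logb 6 5`-th power is
`log L / (4 log (1 / p))`. -/
noncomputable def timeScale (p : ℝ) (L : ℕ) : ℝ :=
  (Real.log L / (4 * -Real.log p)) ^ (1 / Real.logb 6 5)

theorem log_div_nonneg {p : ℝ} (hp0 : 0 < p) (hp1 : p < 1) (L : ℕ) :
    0 ≤ Real.log L / (4 * -Real.log p) := by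
  have := Real.log_neg hp0 hp1
  exact div_nonneg (Real.log_natCast_nonneg L) (by linarith)

theorem timeScale_nonneg {p : ℝ} (hp0 : 0 < p) (hp1 : p < 1) (L : ℕ) : 0 ≤ timeScale p L :=
  Real.rpow_nonneg (log_div_nonneg hp0 hp1 L) _

theorem timeScale_rpow {p : ℝ} (hp0 : 0 < p) (hp1 : p < 1) (L : ℕ) :
    timeScale p L ^ Real.logb 6 5 = Real.log L / (4 * -Real.log p) := by
  rw [timeScale, ← Real.rpow_mul (log_div_nonneg hp0 hp1 L),
    one_div_mul_cancel logb_pos.ne', Real.rpow_one]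

theorem timeScale_eq {p : ℝ} (hp0 : 0 < p) (hp1 : p < 1) (L : ℕ) :
    timeScale p L = (4 * -Real.log p) ^ (-(1 / Real.logb 6 5)) *
      Real.log L ^ (1 / Real.logb 6 5) := by
  have := Real.log_neg hp0 hp1
  rw [timeScale, Real.div_rpow (Real.log_natCast_nonneg L) (by linarith),
    Real.rpow_neg (by linarith), div_eq_inv_mul]

theorem rpow_timeScale {p : ℝ} (hp0 : 0 < p) (hp1 : p < 1) (hL : 1 ≤ L) :
    p ^ (timeScale p L ^ Real.logb 6 5) = (L : ℝ) ^ (-(1 / 4) : ℝ) := by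
  have h := Real.log_neg hp0 hp1
  have hLp : (0 : ℝ) < L := by exact_mod_cast hL
  rw [timeScale_rpow hp0 hp1, Real.rpow_def_of_pos hp0, Real.rpow_def_of_pos hLp]
  congr 1
  have := h.ne
  field_simp

theorem tendsto_timeScale {p : ℝ} (hp0 : 0 < p) (hp1 : p < 1) :
    Filter.Tendsto (timeScale p) Filter.atTop Filter.atTop := by
  have h := Real.log_neg hp0 hp1
  refine (tendsto_rpow_atTop (one_div_pos.2 logb_pos)).comp ?_
  exact (Real.tendsto_log_atTop.comp tendsto_natCast_atTop_atTop).atTop_div_const (by linarith)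

theorem eventually_timeScale_pow_le {p : ℝ} (hp0 : 0 < p) (hp1 : p < 1) :
    ∀ᶠ L : ℕ in Filter.atTop, timeScale p L ^ 3 ≤ (L : ℝ) ^ (1 / 4 : ℝ) := by
  have h := Real.log_neg hp0 hp1
  have ho := isLittleO_log_rpow_rpow_atTop (3 * (1 / Real.logb 6 5))
    (show (0 : ℝ) < 1 / 4 by norm_num)
  obtain ⟨A, hA⟩ : ∃ A : ℝ, A = ((4 * -Real.log p) ^ (-(1 / Real.logb 6 5))) ^ 3 := ⟨_, rfl⟩
  have hA0 : 0 < A := by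
    rw [hA]
    exact pow_pos (Real.rpow_pos_of_pos (by linarith) _) _
  have hb := tendsto_natCast_atTop_atTop.eventually (ho.bound (inv_pos.2 hA0))
  filter_upwards [hb] with L hb
  have hl := Real.log_natCast_nonneg L
  rw [Real.norm_of_nonneg (Real.rpow_nonneg hl _),
    Real.norm_of_nonneg (Real.rpow_nonneg (Nat.cast_nonneg L) _)] at hb
  rw [timeScale_eq hp0 hp1, mul_pow, ← hA, ← Real.rpow_natCast (Real.log L ^ _),
    ← Real.rpow_mul hl, mul_comm _ ((3 : ℕ) : ℝ)]
  push_cast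
  calc _ ≤ A * (A⁻¹ * (L : ℝ) ^ (1 / 4 : ℝ)) := mul_le_mul_of_nonneg_left hb hA0.le
    _ = _ := by rw [← mul_assoc, mul_inv_cancel₀ hA0.ne', one_mul]

theorem one_sub_pow_le_exp {x y : ℝ} {n : ℕ} (hx : x ≤ y) (hy : y ≤ 1) :
    (1 - y) ^ n ≤ Real.exp (-(x * n)) := by
  calc (1 - y) ^ n ≤ Real.exp (-y) ^ n :=
        pow_le_pow_left₀ (by linarith) (by linarith [Real.add_one_le_exp (-y)]) n
    _ = Real.exp (-(y * n)) := by rw [← Real.exp_nat_mul]; congr 1; ring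
    _ ≤ _ := Real.exp_le_exp.2 (by
        have : x * n ≤ y * n := mul_le_mul_of_nonneg_right hx (Nat.cast_nonneg n)
        linarith)

/-- At `timeScale` a block may have probability `q = L ^ (-1/4)`, while `t₀ ^ 3 ≤ L ^ (1/4)` leaves
at least `L ^ (3/4) - 1` blocks per speed. The chance that none is present is thus at most `exp (1 -
L ^ (1/2))`. -/
theorem exists_noise_family_decodingTime_lt (a : Fin D) {p : ℝ} (hp0 : 0 < p) (hp1 : p < 1) :
    ∃ E : ∀ L : ℕ, NoiseModel D L, (∀ L : ℕ, 1 ≤ L → IsPBounded p (E L)) ∧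
      ∀ v : ℕ, 3 ≤ v → Filter.Tendsto
        (fun L : ℕ => prob (E L) {N | decodingTime v N < (⌊timeScale p L⌋₊ : ℕ)})
        Filter.atTop (nhds 0) := by
  have hE : ∀ L : ℕ, ∃ E : NoiseModel D L, (1 ≤ L → IsPBounded p E) ∧
      (1 ≤ L → 1 ≤ L / ⌊timeScale p L⌋₊ ^ 3 → ∀ v, 1 ≤ v → v < ⌊timeScale p L⌋₊ →
        ∀ F : Finset ℕ, (∀ i ∈ F, i < ⌊timeScale p L⌋₊ ^ 2) →
          Persistent v (⌊timeScale p L⌋₊ ^ 2) ⌊timeScale p L⌋₊ F →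
          (F.card : ℝ) ≤ (⌊timeScale p L⌋₊ : ℝ) ^ Real.logb 6 5 →
          prob E {N | decodingTime v N < (⌊timeScale p L⌋₊ : ℕ)} ≤
            ENNReal.ofReal ((1 - (L : ℝ) ^ (-(1 / 4) : ℝ)) ^ (L / ⌊timeScale p L⌋₊ ^ 3))) := by
    intro L
    by_cases h : 1 ≤ L ∧ 1 ≤ L / ⌊timeScale p L⌋₊ ^ 3
    · have hLp : (1 : ℝ) ≤ L := by exact_mod_cast h.1
      obtain ⟨E, h1, h2⟩ := exists_noise_decodingTime (L := L) a hp0 hp1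
        (q := (L : ℝ) ^ (-(1 / 4) : ℝ)) (Real.rpow_nonneg (Nat.cast_nonneg L) _)
        (Real.rpow_le_one_of_one_le_of_nonpos hLp (by norm_num)) h.2
        (Nat.div_mul_le_self L (⌊timeScale p L⌋₊ ^ 3))
        (B := (⌊timeScale p L⌋₊ : ℝ) ^ Real.logb 6 5)
        (Real.rpow_nonneg (Nat.cast_nonneg _) _) (by
          intro k hk
          rw [← rpow_timeScale hp0 hp1 h.1, ← Real.rpow_natCast]
          refine Real.rpow_le_rpow_of_exponent_ge hp0 hp1.le (hk.trans ?_)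
          exact Real.rpow_le_rpow (Nat.cast_nonneg _)
            (Nat.floor_le (timeScale_nonneg hp0 hp1 L)) logb_pos.le)
      exact ⟨E, fun _ => h1, fun _ _ => h2⟩
    · exact ⟨PMF.pure ∅, fun _ => isPBounded_pure_empty p, fun h1 h2 => absurd ⟨h1, h2⟩ h⟩
  choose E hE1 hE2 using hE
  refine ⟨E, hE1, fun v hv => ?_⟩
  obtain ⟨t₁, ht₁⟩ := exists_persistent_pattern hv
  have hfloor := Filter.tendsto_atTop.1
    (tendsto_nat_floor_atTop.comp (tendsto_timeScale hp0 hp1)) (max t₁ (v + 1))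
  have hlim : Filter.Tendsto (fun L : ℕ => ENNReal.ofReal
      (Real.exp (1 - (L : ℝ) ^ (1 / 2 : ℝ)))) Filter.atTop (nhds 0) := by
    rw [← ENNReal.ofReal_zero]
    refine ENNReal.tendsto_ofReal (Real.tendsto_exp_atBot.comp ?_)
    refine Filter.tendsto_atBot_add_const_left _ 1 (Filter.tendsto_neg_atTop_atBot.comp ?_)
    exact (tendsto_rpow_atTop (by norm_num)).comp tendsto_natCast_atTop_atTop
  refine tendsto_of_tendsto_of_tendsto_of_le_of_le' tendsto_const_nhds hlim
    (Filter.Eventually.of_forall fun _ => bot_le) ?_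
  filter_upwards [hfloor, eventually_timeScale_pow_le hp0 hp1, Filter.eventually_ge_atTop 1]
    with L hf h3 hL
  rw [Function.comp_apply] at hf
  obtain ⟨F, hF1, hF2, hF3⟩ := ht₁ _ ((le_max_left _ _).trans hf)
  have hvt : v < ⌊timeScale p L⌋₊ :=
    lt_of_lt_of_le v.lt_succ_self ((le_max_right _ _).trans hf)
  have hL1 : (1 : ℝ) ≤ L := by exact_mod_cast hL
  have hL0 : (0 : ℝ) < L := by linarith
  have hcube : ((⌊timeScale p L⌋₊ ^ 3 : ℕ) : ℝ) ≤ (L : ℝ) ^ (1 / 4 : ℝ) := by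
    push_cast
    exact le_trans (pow_le_pow_left₀ (Nat.cast_nonneg _)
      (Nat.floor_le (timeScale_nonneg hp0 hp1 L)) 3) h3
  have hpos : 0 < ⌊timeScale p L⌋₊ ^ 3 := pow_pos (by omega) 3
  have hn : 1 ≤ L / ⌊timeScale p L⌋₊ ^ 3 := by
    rw [Nat.one_le_div_iff hpos]
    have : ((⌊timeScale p L⌋₊ ^ 3 : ℕ) : ℝ) ≤ L := by
      refine hcube.trans ?_
      calc (L : ℝ) ^ (1 / 4 : ℝ) ≤ (L : ℝ) ^ (1 : ℝ) :=
            Real.rpow_le_rpow_of_exponent_le hL1 (by norm_num)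
        _ = L := Real.rpow_one _
    exact_mod_cast this
  refine (hE2 L hL hn v (by omega) hvt F hF1 hF2 hF3).trans (ENNReal.ofReal_le_ofReal ?_)
  have hq1 : (L : ℝ) ^ (-(1 / 4) : ℝ) ≤ 1 :=
    Real.rpow_le_one_of_one_le_of_nonpos hL1 (by norm_num)
  have hq0 : 0 < (L : ℝ) ^ (-(1 / 4) : ℝ) := Real.rpow_pos_of_pos hL0 _
  refine (one_sub_pow_le_exp le_rfl hq1).trans (Real.exp_le_exp.2 ?_)
  have hdiv : (L : ℝ) ^ (3 / 4 : ℝ) - 1 ≤ ((L / ⌊timeScale p L⌋₊ ^ 3 : ℕ) : ℝ) := by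
    have h5 := Nat.lt_div_mul_add (a := L) hpos
    have h6 : (L : ℝ) ≤ ((L / ⌊timeScale p L⌋₊ ^ 3 : ℕ) + 1) *
        ((⌊timeScale p L⌋₊ ^ 3 : ℕ) : ℝ) := by
      rw [add_one_mul]
      exact_mod_cast h5.le
    have h7 : (L : ℝ) ^ (3 / 4 : ℝ) * (L : ℝ) ^ (1 / 4 : ℝ) ≤
        ((L / ⌊timeScale p L⌋₊ ^ 3 : ℕ) + 1) * (L : ℝ) ^ (1 / 4 : ℝ) := by
      rw [← Real.rpow_add hL0]
      norm_num only
      rw [Real.rpow_one]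
      exact h6.trans (mul_le_mul_of_nonneg_left hcube (by positivity))
    linarith [le_of_mul_le_mul_right h7 (Real.rpow_pos_of_pos hL0 _)]
  have h8 : (L : ℝ) ^ (-(1 / 4) : ℝ) * ((L : ℝ) ^ (3 / 4 : ℝ) - 1) =
      (L : ℝ) ^ (1 / 2 : ℝ) - (L : ℝ) ^ (-(1 / 4) : ℝ) := by
    rw [mul_sub, ← Real.rpow_add hL0, mul_one]
    norm_num only
  have h9 := mul_le_mul_of_nonneg_left hdiv hq0.le
  linarith

theorem exists_noise_family_decodingTime (a : Fin D) {p : ℝ} (hp0 : 0 < p) (hp1 : p < 1) :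
    ∃ (E' : ∀ L : ℕ, NoiseModel D L) (c : ℝ), 0 < c ∧
      (∀ L : ℕ, 1 ≤ L → IsPBounded p (E' L)) ∧
      ∀ v : ℕ, 3 ≤ v →
        (∃ L₀ : ℕ, ∀ L : ℕ, 1 ≤ L → L₀ ≤ L →
          ENNReal.ofReal (c * Real.log L ^ (1 / Real.logb 6 5)) ≤
            expectedDecodingTime v (E' L)) ∧
        Filter.Tendsto
          (fun L : ℕ => prob (E' L)
            {N | decodingTime v N < ENNReal.ofReal (c * Real.log L ^ (1 / Real.logb 6 5))})
          Filter.atTop (nhds 0) := by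
  have h := Real.log_neg hp0 hp1
  obtain ⟨E, hE, hlim⟩ := exists_noise_family_decodingTime_lt a hp0 hp1
  -- The divisor 4 covers the factor 2 lost in the expectation and the rounding of `timeScale` once
  -- it is at least 2.
  refine ⟨E, (4 * -Real.log p) ^ (-(1 / Real.logb 6 5)) / 4,
    div_pos (Real.rpow_pos_of_pos (by linarith) _) (by norm_num), hE, fun v hv => ?_⟩
  have hc : ∀ L : ℕ, (4 * -Real.log p) ^ (-(1 / Real.logb 6 5)) / 4 *
      Real.log L ^ (1 / Real.logb 6 5) = timeScale p L / 4 := fun L => by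
    rw [timeScale_eq hp0 hp1]
    ring
  simp only [hc]
  have hlarge := Filter.tendsto_atTop.1 (tendsto_timeScale hp0 hp1) 2
  have hle : ∀ᶠ L : ℕ in Filter.atTop,
      ENNReal.ofReal (timeScale p L / 4) ≤ (⌊timeScale p L⌋₊ : ℝ≥0∞) / 2 := by
    filter_upwards [hlarge] with L hL
    have h1 := Nat.lt_floor_add_one (timeScale p L)
    have h2 : (⌊timeScale p L⌋₊ : ℝ≥0∞) / 2 = ENNReal.ofReal (⌊timeScale p L⌋₊ / 2) := by
      rw [ENNReal.ofReal_div_of_pos (by norm_num), ENNReal.ofReal_natCast]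
      norm_num
    rw [h2]
    exact ENNReal.ofReal_le_ofReal (by linarith)
  constructor
  · have hhalf := (hlim v hv).eventually_le_const (show (0 : ℝ≥0∞) < 1 / 2 by norm_num)
    obtain ⟨L₀, hL₀⟩ := Filter.eventually_atTop.1 (hhalf.and hle)
    exact ⟨L₀, fun L _ hL => (hL₀ L hL).2.trans (le_expectedDecodingTime (hL₀ L hL).1)⟩
  · refine tendsto_of_tendsto_of_tendsto_of_le_of_le' tendsto_const_nhds (hlim v hv)
      (Filter.Eventually.of_forall fun _ => bot_le) ?_
    filter_upwards [hle] with L hL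
    exact prob_mono fun N hN => lt_of_lt_of_le hN (hL.trans ENNReal.half_le_self)

end MessagePassing

theorem mainTheorem7 (D : ℕ) (hD : 1 ≤ D) (p : ℝ) (hp0 : 0 < p) (hp1 : p < 1) :
    (∃ (E : ∀ L : ℕ, MessagePassing.NoiseModel D L) (C : ℝ),
      (∀ L : ℕ, 1 ≤ L → MessagePassing.IsPBounded p (E L)) ∧
      ∀ v : ℕ, 3 ≤ v → ∃ L₀ : ℕ, ∀ L : ℕ, 1 ≤ L → L₀ ≤ L →
        ENNReal.ofReal (Real.exp (-(C * (L : ℝ) ^ Real.logb 6 5))) ≤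
          MessagePassing.logicalFailureRate v (E L)) ∧
    (∃ (E' : ∀ L : ℕ, MessagePassing.NoiseModel D L) (c : ℝ), 0 < c ∧
      (∀ L : ℕ, 1 ≤ L → MessagePassing.IsPBounded p (E' L)) ∧
      ∀ v : ℕ, 3 ≤ v →
        (∃ L₀ : ℕ, ∀ L : ℕ, 1 ≤ L → L₀ ≤ L →
          ENNReal.ofReal (c * Real.log L ^ (1 / Real.logb 6 5)) ≤
            MessagePassing.expectedDecodingTime v (E' L)) ∧
        Filter.Tendsto
          (fun L : ℕ => MessagePassing.prob (E' L)
            {N | MessagePassing.decodingTime v N <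
              ENNReal.ofReal (c * Real.log L ^ (1 / Real.logb 6 5))})
          Filter.atTop (nhds 0)) := by
  exact ⟨MessagePassing.exists_noise_family_logicalFailureRate ⟨0, hD⟩ hp0 hp1,
    MessagePassing.exists_noise_family_decodingTime ⟨0, hD⟩ hp0 hp1⟩
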